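/- Let $\varphi:\mathbb{C}\to\mathbb{R}$ be a $C^2$ function such that, for some $\epsilon>0$, $\varphi(z)\ge(1+\epsilon)\log|z|$ for all $z$ with $|z|$ sufficiently large. Let $L(\mathbb{C})$ be the class of subharmonic functions $u$ on $\mathbb{C}$ for which $u(z)-\log|z|$ is bounded above as $|z|\to\infty$, put $$U_\varphi(z)=\sup\{u(z):u\in L(\mathbb{C}),\ u\le\varphi\text{ on }\mathbb{C}\},\qquad D_\varphi=\{z\in\mathbb{C}:U_\varphi(z)=\varphi(z)\},$$ and let the bulk $\mathcal{B}_\varphi$ be the interior of $\{z\in D_\varphi:\Delta\varphi(z)>0\}$. For all sufficiently large $n$, the space $\mathcal{P}_n$ of complex polynomials of degree at most $n$ has an orthonormal basis with respect to the inner product $\langle f,g\rangle=\int_{\mathbb{C}}f(z)\overline{g(z)}e^{-2n\varphi(z)}\,dz$, where $dz$ is Lebesgue measure. Whichever orthonormal basis $\{P^n_j\}_{j=0}^n$ of $\mathcal{P}_n$ is chosen for each large $n$, let $$K_n(z,w)=\sum_{j=0}^nP^n_j(z)\overline{P^n_j(w)},\quad K_n^{(1,0)}(z,w)=\sum_{j=0}^n(P^n_j)'(z)\overline{P^n_j(w)},\quad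 K_n^{(1,1)}(z,w)=\sum_{j=0}^n(P^n_j)'(z)\overline{(P^n_j)'(w)}.$$ Then, as $n\to\infty$, $$n^{-2}K_n^{(1,0)}(z,z)e^{-2n\varphi(z)}\to\frac1\pi\Delta\varphi(z)\frac{\partial\varphi}{\partial z}(z),\qquad n^{-3}K_n^{(1,1)}(z,z)e^{-2n\varphi(z)}\to\frac1\pi\Delta\varphi(z)\Big(2\frac{\partial\varphi}{\partial z}(z)\frac{\partial\varphi}{\partial\bar z}(z)\Big),$$ in each case uniformly on compact subsets of $\mathcal{B}_\varphi$. If moreover $\varphi$ is radially symmetric, i.e. $\varphi(z)=\varphi(|z|)$ for all $z\in\mathbb{C}$, then for all sufficiently large $n$ the numbers $K_n(x,x)$, $K_n^{(1,0)}(x,x)$, $K_n^{(1,1)}(x,x)$ are real for every $x\in\mathbb{R}$, and for every real interval $[a,b]\subset\mathcal{B}_\varphi$, $$\frac1{\sqrt n}\,\frac{\sqrt{K_n^{(1,1)}(x,x)K_n(x,x)-\big(K_n^{(1,0)}(x,x)\big)^2}}{K_n(x,x)}\to\sqrt{\tfrac12\Delta\varphi(x)}\qquad(n\to\infty)$$ uniformly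 for $x\in[a,b]$. -/

import Mathlib

open Filter Topology MeasureTheory
open scoped ComplexConjugate Polynomial

noncomputable section

/-- The Wirtinger derivative `∂φ/∂z = (1/2) (∂φ/∂x - i ∂φ/∂y)` of a real-valued function. -/
def wirtingerDeriv (φ : ℂ → ℝ) (z : ℂ) : ℂ :=
  (1 / 2 : ℂ) * ((fderiv ℝ φ z 1 : ℂ) - Complex.I * (fderiv ℝ φ z Complex.I : ℂ))

/-- The Wirtinger derivative `∂φ/∂z̄ = (1/2) (∂φ/∂x + i ∂φ/∂y)` of a real-valued function. -/
def wirtingerDerivBar (φ : ℂ → ℝ) (z : ℂ) : ℂ :=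
  (1 / 2 : ℂ) * ((fderiv ℝ φ z 1 : ℂ) + Complex.I * (fderiv ℝ φ z Complex.I : ℂ))

/-- Subharmonic functions `u : ℂ → [-∞, ∞)`: upper semicontinuous, not identically `-∞`, with the
sub-mean value inequality on all circles. The mean of the upper semicontinuous function `u` over a
circle (possibly `-∞`) is the infimum of the means of the continuous functions `g ≥ u` on that
circle, so the inequality is written as `u c ≤ mean of g` for all such `g`. -/
structure IsSubharmonic (u : ℂ → EReal) : Prop where
  ne_top : ∀ z, u z ≠ ⊤
  exists_ne_bot : ∃ z, u z ≠ ⊥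
  upperSemicontinuous : UpperSemicontinuous u
  le_circleAverage : ∀ (c : ℂ) (r : ℝ), 0 < r → ∀ g : ℂ → ℝ, Continuous g →
    (∀ w ∈ Metric.sphere c r, u w ≤ (g w : EReal)) →
    u c ≤ ((Real.circleAverage g c r : ℝ) : EReal)

/-- The class `L(ℂ)`: subharmonic functions `u` such that `u(z) - log |z|` is bounded above as
`|z| → ∞`. -/
def IsLogGrowthSubharmonic (u : ℂ → EReal) : Prop :=
  IsSubharmonic u ∧
    ∃ C : ℝ, ∀ᶠ z in Bornology.cobounded ℂ, u z ≤ ((Real.log ‖z‖ + C : ℝ) : EReal)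

/-- The equilibrium potential `U_φ`: the upper envelope of all `u ∈ L(ℂ)` with `u ≤ φ` on `ℂ`. -/
def equilibriumPotential (φ : ℂ → ℝ) (z : ℂ) : EReal :=
  sSup {t : EReal | ∃ u : ℂ → EReal,
    IsLogGrowthSubharmonic u ∧ (∀ w, u w ≤ (φ w : EReal)) ∧ t = u z}

/-- The contact set `D_φ = {U_φ = φ}`. -/
def contactSet (φ : ℂ → ℝ) : Set ℂ :=
  {z | equilibriumPotential φ z = (φ z : EReal)}

/-- The bulk `B_φ`: the interior of `{z ∈ D_φ : Δφ(z) > 0}`. -/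
def bulk (φ : ℂ → ℝ) : Set ℂ :=
  interior {z | z ∈ contactSet φ ∧ 0 < Laplacian.laplacian φ z}

/-- The growth condition `φ(z) ≥ (1 + ε) log |z|` for `|z|` large and some `ε > 0`. -/
def HasLogGrowth (φ : ℂ → ℝ) : Prop :=
  ∃ ε : ℝ, 0 < ε ∧ ∀ᶠ z in Bornology.cobounded ℂ, (1 + ε) * Real.log ‖z‖ ≤ φ z

/-- The weighted inner product `∫ f(z) conj(g(z)) e^{-2nφ(z)} dz` with respect to Lebesgue
measure on `ℂ`. -/
def weightedInner (φ : ℂ → ℝ) (n : ℕ) (f g : ℂ[X]) : ℂ :=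
  ∫ z : ℂ, f.eval z * conj (g.eval z) * (Real.exp (-2 * n * φ z) : ℂ)

/-- `P 0, …, P n` is an orthonormal basis of the polynomials of degree at most `n` for the weighted
inner product. (The value `1` of the integrals with `i = j` forces each `P i` to be square
integrable, and `n + 1` orthonormal elements of this `(n + 1)`-dimensional space span it.) -/
structure IsWeightedOrthonormalBasis (φ : ℂ → ℝ) (n : ℕ) (P : Fin (n + 1) → ℂ[X]) : Prop where
  natDegree_le : ∀ j, (P j).natDegree ≤ n
  orthonormal : ∀ i j, weightedInner φ n (P i) (P j) = if i = j then 1 else 0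

/-- The Bergman kernel `K_n(z, w)` written in the basis `P`. -/
def bergmanKernel {n : ℕ} (P : Fin (n + 1) → ℂ[X]) (z w : ℂ) : ℂ :=
  ∑ j, (P j).eval z * conj ((P j).eval w)

/-- The derivative `K_n^{(1,0)}(z, w)` of the Bergman kernel. -/
def bergmanKernel10 {n : ℕ} (P : Fin (n + 1) → ℂ[X]) (z w : ℂ) : ℂ :=
  ∑ j, (P j).derivative.eval z * conj ((P j).eval w)

/-- The derivative `K_n^{(1,1)}(z, w)` of the Bergman kernel. -/
def bergmanKernel11 {n : ℕ} (P : Fin (n + 1) → ℂ[X]) (z w : ℂ) : ℂ :=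
  ∑ j, (P j).derivative.eval z * conj ((P j).derivative.eval w)

end

/-!
Write `c = Δφ / 2` and, for a polynomial `f`, let the weighted jets at `z` be
`a₀(f) = f(z) e^{-nφ(z)}` and `a₁(f) = (f'(z) - 2n (∂φ/∂z)(z) f(z)) e^{-nφ(z)}`. In an orthonormal
basis, `K_n`, `K_n^{(1,0)}` and `K_n^{(1,1)}` on the diagonal, times `e^{-2nφ}`, are explicit
combinations of the entries of the Gram matrix `(∑ a_k(P_j) conj (a_l(P_j)))` of the two functionals
`a₀`, `a₁`. All limits follow once this matrix is known to be `diag (cn / π, (cn)² / π)` to leading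
order, with off-diagonal entry `o(n^{3/2})`, uniformly on compact subsets of the bulk
(`exists_gram_asymptotics`). The determinant `K_n K_n^{(1,1)} - |K_n^{(1,0)}|²` is the determinant of
the same matrix (`kernel_det_eq`), which gives the last limit.

The diagonal entries are squared norms of `a₀` and `a₁`, and by
`IsWeightedOrthonormalBasis.gram_bounds` it is enough to have two estimates.

*Upper bound* (`exists_jet_upper`): `|a₀|² π / (cn) + |a₁|² π / (cn)² ≤ (1 + δ) ‖f‖²` for all entire
`f`. Near `z`, `φ` is the real part of a holomorphic quadratic polynomial plus `c |w|² / 2`, so this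
is Parseval's inequality on circles integrated against a Gaussian. That the two terms stand in one
inequality is what makes the off-diagonal entry small.

*Lower bound* (`exists_jet_lower`): each of the two terms is attained up to `1 - δ` by a polynomial
of degree at most `n`. The natural candidate `(ζ - z)^k e^{nH(ζ - z)}`, cut off near `z`, has to be
replaced by a polynomial without `∂̄`-estimates. For points `ζ` in an annulus about `z`, all in the
contact set, one needs polynomials `E_ζ` of degree at most `n` with `E_ζ(ζ) = 1` whose modulus is at
most a power of `n` times `e^{n(φ - φ(ζ))}`. Then `(1 - E_ζ(w)) / (ζ - w)` is a polynomial in `w` that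
can replace the Cauchy kernel, with an exponentially small error (`exists_polynomial_approx`). The
`E_ζ` are built from Fekete polynomials: at a contact point one of them is nearly as large as
`e^{nφ}` (`exists_peak_polynomials`), since otherwise the logarithmic potential of the Fekete points
would, by the maximum principle for `L(ℂ)`, bound `U_φ(ζ)` strictly below `φ(ζ)`.

For radial `φ`, conjugating the coefficients maps orthonormal bases to orthonormal bases, and the
kernels do not depend on the basis; hence they are real on the real diagonal.
-/

noncomputable section

/-! ### Polar coordinates and Gaussian integrals -/

open Real in
/-- Integration over an annulus in polar coordinates, written with circle averages. The conclusion
includes interval integrability because circle averages of a merely measurable function need not be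
integrable for every radius. -/
theorem annulus_polar {E : Type*} [NormedAddCommGroup E] [NormedSpace ℝ E]
    {F : ℂ → E} (hF : StronglyMeasurable F) (c : ℂ) {a b : ℝ} (ha : 0 ≤ a) (hab : a ≤ b)
    (hint : IntegrableOn F {z | a < ‖z - c‖ ∧ ‖z - c‖ ≤ b}) :
    IntervalIntegrable (fun ρ => (2 * π * ρ) • Real.circleAverage F c ρ) volume a b ∧
    ∫ z in {z | a < ‖z - c‖ ∧ ‖z - c‖ ≤ b}, F z
      = ∫ ρ in a..b, (2 * π * ρ) • Real.circleAverage F c ρ := by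
  set S : Set ℂ := {z | a < ‖z - c‖ ∧ ‖z - c‖ ≤ b} with hS
  have hSm : MeasurableSet S := by
    have h1 : IsOpen {z : ℂ | a < ‖z - c‖} := isOpen_lt continuous_const (by fun_prop)
    have h2 : IsClosed {z : ℂ | ‖z - c‖ ≤ b} := isClosed_le (by fun_prop) continuous_const
    exact h1.measurableSet.inter h2.measurableSet
  set G : ℂ → E := fun w => S.indicator F (c + w) with hG
  have hFi : Integrable (S.indicator F) := (integrable_indicator_iff hSm).2 hint
  have hGi : Integrable G := by
    simpa [hG] using hFi.comp_add_left c
  have hGsm : StronglyMeasurable G :=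
    (hF.indicator hSm).comp_measurable (measurable_const_add c)
  have hcont : Continuous (fun p : ℝ × ℝ => Complex.polarCoord.symm p) := by
    simp only [Complex.polarCoord_symm_apply]
    fun_prop
  have hGp : IntegrableOn (fun p : ℝ × ℝ => p.1 • G (Complex.polarCoord.symm p))
      polarCoord.target := by
    refine ⟨?_, ?_⟩
    · refine (StronglyMeasurable.smul measurable_fst.stronglyMeasurable ?_).aestronglyMeasurable
      exact hGsm.comp_measurable hcont.measurable
    · have h := Complex.lintegral_comp_polarCoord_symm (fun w => ‖G w‖ₑ)
      unfold HasFiniteIntegral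
      have h2 : ∫⁻ p in polarCoord.target, ‖p.1 • G (Complex.polarCoord.symm p)‖ₑ
          = ∫⁻ p in polarCoord.target, ENNReal.ofReal p.1 • ‖G (Complex.polarCoord.symm p)‖ₑ := by
        refine setLIntegral_congr_fun polarCoord.open_target.measurableSet ?_
        intro p hp
        have hp1 : 0 < p.1 := hp.1
        simp only [enorm_smul, smul_eq_mul]
        rw [Real.enorm_of_nonneg hp1.le]
      rw [h2, h]
      exact hGi.2
  have hpol := Complex.integral_comp_polarCoord_symm G
  have hpt : polarCoord.target = Set.Ioi (0 : ℝ) ×ˢ Set.Ioo (-π) π := rfl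
  have hval : ∀ ρ : ℝ, 0 < ρ → ∫ θ in Set.Ioo (-π) π, ρ • G (Complex.polarCoord.symm (ρ, θ)) =
      (Set.Ioc a b).indicator (fun ρ => (2 * π * ρ) • Real.circleAverage F c ρ) ρ := by
    intro ρ hρ
    have hsym : ∀ θ : ℝ, c + Complex.polarCoord.symm (ρ, θ) = circleMap c ρ θ := by
      intro θ
      simp [circleMap, Complex.exp_mul_I]
    have hmem : ∀ θ : ℝ, circleMap c ρ θ ∈ S ↔ ρ ∈ Set.Ioc a b := by
      intro θ
      simp [hS, circleMap, abs_of_pos hρ]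
    by_cases hρS : ρ ∈ Set.Ioc a b
    · rw [Set.indicator_of_mem hρS]
      have : ∀ θ : ℝ, G (Complex.polarCoord.symm (ρ, θ)) = F (circleMap c ρ θ) := by
        intro θ
        simp only [hG, hsym]
        rw [Set.indicator_of_mem ((hmem θ).2 hρS)]
      simp only [this]
      rw [integral_smul, Real.circleAverage_eq_integral_add (-π),
        intervalIntegral.integral_comp_add_right (fun θ => F (circleMap c ρ θ)) (-π),
        intervalIntegral.integral_of_le (by linarith [pi_pos]), integral_Ioc_eq_integral_Ioo,
        smul_smul]
      have e1 : 2 * π + -π = π := by ring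
      have e2 : 2 * π * ρ * (2 * π)⁻¹ = ρ := by field_simp
      rw [e1, e2, zero_add]
    · rw [Set.indicator_of_notMem hρS]
      have : ∀ θ : ℝ, G (Complex.polarCoord.symm (ρ, θ)) = 0 := by
        intro θ
        simp only [hG, hsym]
        rw [Set.indicator_of_notMem (fun h => hρS ((hmem θ).1 h))]
      simp only [this, smul_zero, integral_zero]
  have hprod : volume.restrict polarCoord.target
      = (volume.restrict (Set.Ioi (0 : ℝ))).prod (volume.restrict (Set.Ioo (-π) π)) := by
    rw [hpt, Measure.prod_restrict]; rfl
  have hind : Integrable ((Set.Ioc a b).indicator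
      (fun ρ => (2 * π * ρ) • Real.circleAverage F c ρ)) (volume.restrict (Set.Ioi (0 : ℝ))) := by
    unfold IntegrableOn at hGp
    rw [hprod] at hGp
    refine (hGp.integral_prod_left).congr ?_
    filter_upwards [ae_restrict_mem measurableSet_Ioi] with ρ hρ
    exact hval ρ hρ
  have hsub : Set.Ioc a b ⊆ Set.Ioi (0 : ℝ) := fun x hx => lt_of_le_of_lt ha hx.1
  constructor
  · rw [intervalIntegrable_iff_integrableOn_Ioc_of_le hab]
    rw [integrable_indicator_iff measurableSet_Ioc] at hind
    unfold IntegrableOn at hind ⊢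
    rwa [Measure.restrict_restrict measurableSet_Ioc, Set.inter_eq_left.2 hsub] at hind
  · rw [← integral_indicator hSm, ← integral_add_left_eq_self (S.indicator F) c]
    change ∫ w, G w = _
    rw [← hpol]
    unfold IntegrableOn at hGp
    rw [hprod] at hGp ⊢
    rw [integral_prod _ hGp, intervalIntegral.integral_of_le hab]
    rw [setIntegral_congr_fun measurableSet_Ioi (fun ρ hρ => hval ρ hρ)]
    rw [integral_indicator measurableSet_Ioc, Measure.restrict_restrict measurableSet_Ioc,
      Set.inter_eq_left.2 hsub]

open Real in
theorem closedBall_polar {E : Type*} [NormedAddCommGroup E] [NormedSpace ℝ E]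
    {F : ℂ → E} (hF : Continuous F) (c : ℂ) {r : ℝ} (hr : 0 ≤ r) :
    ∫ z in Metric.closedBall c r, F z = ∫ ρ in (0 : ℝ)..r, (2 * π * ρ) • Real.circleAverage F c ρ := by
  have hae : ({z | 0 < ‖z - c‖ ∧ ‖z - c‖ ≤ r} : Set ℂ) =ᵐ[volume] Metric.closedBall c r := by
    have h0 : ∀ᵐ z : ℂ, z ≠ c := by
      simp [ae_iff]
    refine Filter.eventuallyEq_set.2 ?_
    filter_upwards [h0] with z hz
    have : 0 < ‖z - c‖ := norm_pos_iff.2 (sub_ne_zero.2 hz)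
    rw [Metric.mem_closedBall, dist_eq_norm]
    exact ⟨fun h => h.2, fun h => ⟨this, h⟩⟩
  rw [← setIntegral_congr_set hae]
  refine (annulus_polar hF.stronglyMeasurable c le_rfl hr ?_).2
  rw [integrableOn_congr_set_ae hae]
  exact hF.continuousOn.integrableOn_compact (isCompact_closedBall c r)

theorem normSq_le_circleAverage {f : ℂ → ℂ} (hf : Differentiable ℂ f) (c : ℂ) (ρ : ℝ) :
    ‖f c‖ ^ 2 ≤ Real.circleAverage (fun z => ‖f z‖ ^ 2) c ρ := by
  have hmean : Real.circleAverage f c ρ = f c := hf.diffContOnCl.circleAverage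
  have hci : ∀ g : ℂ → ℝ, Continuous g → CircleIntegrable g c ρ := fun g hg =>
    hg.continuousOn.circleIntegrable'
  have hc := hf.continuous
  set L : ℂ →L[ℝ] ℝ := (2 : ℝ) • (innerSL ℝ (f c)) with hL
  have hLm : Real.circleAverage (fun z => L (f z)) c ρ = L (f c) := by
    rw [← hmean]
    have := L.circleAverage_comp_comm (f := f) (c := c) (R := ρ)
      hc.continuousOn.circleIntegrable'
    rw [hmean] at this ⊢
    exact this
  have hLc : L (f c) = 2 * ‖f c‖ ^ 2 := by
    simp [hL]
  have h1 : Real.circleAverage (fun z => L (f z) - ‖f c‖ ^ 2) c ρ = ‖f c‖ ^ 2 := by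
    rw [Real.circleAverage_fun_sub (hci _ (by fun_prop)) (hci _ (by fun_prop)), hLm, hLc,
      Real.circleAverage_const]
    ring
  rw [← h1]
  refine Real.circleAverage_mono (hci _ (by fun_prop)) (hci _ (by fun_prop)) fun z _ => ?_
  have := norm_sub_sq_real (f c) (f z)
  have h3 : L (f z) = 2 * inner ℝ (f c) (f z) := by simp [hL]
  rw [h3]
  nlinarith [sq_nonneg ‖f c - f z‖]

/-- Parseval's inequality for the first two Taylor coefficients of an entire function. -/
theorem jet_le_circleAverage {q : ℂ → ℂ} (hq : Differentiable ℂ q) (ρ : ℝ) :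
    ‖q 0‖ ^ 2 + ρ ^ 2 * ‖deriv q 0‖ ^ 2 ≤ Real.circleAverage (fun z => ‖q z‖ ^ 2) 0 ρ := by
  set h : ℂ → ℂ := dslope q 0 with hh
  have hd : Differentiable ℂ h := by
    have := (Complex.differentiableOn_dslope (f := q) (c := 0) (s := Set.univ) Filter.univ_mem).2
      hq.differentiableOn
    exact fun z => (this z trivial).differentiableAt Filter.univ_mem
  have hqh : ∀ z, q z = q 0 + z * h z := by
    intro z
    have := sub_smul_dslope q 0 z
    simp only [sub_zero, smul_eq_mul] at this
    rw [hh, this]; ring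
  have h0 : h 0 = deriv q 0 := dslope_same q 0
  have hci : ∀ g : ℂ → ℝ, Continuous g → CircleIntegrable g 0 ρ := fun g hg =>
    hg.continuousOn.circleIntegrable'
  have hc := hd.continuous
  have hw : Differentiable ℂ (fun z => z * h z) := differentiable_id.mul hd
  set L : ℂ →L[ℝ] ℝ := (2 : ℝ) • (innerSL ℝ (q 0)) with hL
  have hLm : Real.circleAverage (fun z => L (z * h z)) 0 ρ = 0 := by
    have := L.circleAverage_comp_comm (f := fun z => z * h z) (c := 0) (R := ρ)
      hw.continuous.continuousOn.circleIntegrable'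
    rw [hw.diffContOnCl.circleAverage, zero_mul, map_zero] at this
    exact this
  have h1 : Real.circleAverage (fun z => ‖q z‖ ^ 2) 0 ρ
      = ‖q 0‖ ^ 2 + ρ ^ 2 * Real.circleAverage (fun z => ‖h z‖ ^ 2) 0 ρ := by
    have e : Real.circleAverage (fun z => ‖q z‖ ^ 2) 0 ρ = Real.circleAverage
        (fun z => (‖q 0‖ ^ 2 + L (z * h z)) + ρ ^ 2 * ‖h z‖ ^ 2) 0 ρ := by
      refine Real.circleAverage_congr_sphere fun z hz => ?_
      have hz' : ‖z‖ = |ρ| := by simpa using hz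
      have := norm_add_sq_real (q 0) (z * h z)
      rw [hqh z, this]
      simp [hL, mul_pow, hz']
    rw [e, Real.circleAverage_fun_add (hci _ (by fun_prop)) (hci _ (by fun_prop)),
      Real.circleAverage_fun_add (hci _ (by fun_prop)) (hci _ (by fun_prop)), hLm,
      Real.circleAverage_const, add_zero]
    congr 1
    exact Real.circleAverage_fun_smul (a := ρ ^ 2) (f := fun z => ‖h z‖ ^ 2)
  rw [h1, ← h0]
  have := normSq_le_circleAverage hd 0 ρ
  gcongr

open Real in
theorem integral_gauss_zero {c : ℝ} (hc : 0 < c) (r : ℝ) :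
    ∫ ρ in (0 : ℝ)..r, 2 * π * ρ * exp (-c * ρ ^ 2) = π / c * (1 - exp (-c * r ^ 2)) := by
  have hd : ∀ x ∈ Set.uIcc 0 r, HasDerivAt (fun ρ : ℝ => -(π / c) * exp (-c * ρ ^ 2))
      (2 * π * x * exp (-c * x ^ 2)) x := by
    intro x _
    have h1 : HasDerivAt (fun ρ : ℝ => -c * ρ ^ 2) (-c * (2 * x)) x := by
      simpa using (hasDerivAt_pow 2 x).const_mul (-c)
    have h2 := h1.exp.const_mul (-(π / c))
    convert! h2 using 1
    field_simp
  rw [intervalIntegral.integral_eq_sub_of_hasDerivAt hd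
    (Continuous.intervalIntegrable (by fun_prop) _ _)]
  simp
  ring

open Real in
theorem integral_gauss_two {c : ℝ} (hc : 0 < c) (r : ℝ) :
    ∫ ρ in (0 : ℝ)..r, 2 * π * ρ * (ρ ^ 2 * exp (-c * ρ ^ 2))
      = π / c ^ 2 * (1 - (1 + c * r ^ 2) * exp (-c * r ^ 2)) := by
  have hd : ∀ x ∈ Set.uIcc 0 r, HasDerivAt
      (fun ρ : ℝ => -(π / c ^ 2) * ((1 + c * ρ ^ 2) * exp (-c * ρ ^ 2)))
      (2 * π * x * (x ^ 2 * exp (-c * x ^ 2))) x := by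
    intro x _
    have h1 : HasDerivAt (fun ρ : ℝ => -c * ρ ^ 2) (-c * (2 * x)) x := by
      simpa using (hasDerivAt_pow 2 x).const_mul (-c)
    have h3 : HasDerivAt (fun ρ : ℝ => 1 + c * ρ ^ 2) (c * (2 * x)) x := by
      simpa using ((hasDerivAt_pow 2 x).const_mul c).const_add 1
    have h2 := (h3.mul h1.exp).const_mul (-(π / c ^ 2))
    convert! h2 using 1
    field_simp
    ring
  rw [intervalIntegral.integral_eq_sub_of_hasDerivAt hd
    (Continuous.intervalIntegrable (by fun_prop) _ _)]
  simp
  ring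

open Real in
/-- The first two Taylor coefficients at the centre of a disc are bounded by a Gaussian `L²` norm
over the disc. The constants are the exact Gaussian masses of `1` and `w`. -/
theorem jet_le_gauss_integral {q : ℂ → ℂ} (hq : Differentiable ℂ q) {c : ℝ} (hc : 0 < c) {r : ℝ}
    (hr : 0 ≤ r) :
    ‖q 0‖ ^ 2 * (π / c * (1 - exp (-c * r ^ 2)))
      + ‖deriv q 0‖ ^ 2 * (π / c ^ 2 * (1 - (1 + c * r ^ 2) * exp (-c * r ^ 2)))
      ≤ ∫ w in Metric.closedBall (0 : ℂ) r, ‖q w‖ ^ 2 * exp (-c * ‖w‖ ^ 2) := by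
  have hqc := hq.continuous
  rw [closedBall_polar (by fun_prop) 0 hr, ← integral_gauss_zero hc, ← integral_gauss_two hc,
    ← intervalIntegral.integral_const_mul, ← intervalIntegral.integral_const_mul,
    ← intervalIntegral.integral_add (Continuous.intervalIntegrable (by fun_prop) _ _)
      (Continuous.intervalIntegrable (by fun_prop) _ _)]
  have havg : ∀ ρ : ℝ, Real.circleAverage (fun w => ‖q w‖ ^ 2 * exp (-c * ‖w‖ ^ 2)) 0 ρ
      = exp (-c * ρ ^ 2) * Real.circleAverage (fun w => ‖q w‖ ^ 2) 0 ρ := by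
    intro ρ
    rw [← smul_eq_mul, ← Real.circleAverage_fun_smul]
    refine Real.circleAverage_congr_sphere fun z hz => ?_
    have hz' : ‖z‖ = |ρ| := by simpa using hz
    simp [hz', mul_comm]
  have hci : Continuous fun ρ : ℝ =>
      Real.circleAverage (fun w => ‖q w‖ ^ 2 * exp (-c * ‖w‖ ^ 2)) 0 ρ :=
    Continuous.circleAverage (by fun_prop)
  refine intervalIntegral.integral_mono_on hr (Continuous.intervalIntegrable (by fun_prop) _ _)
    (Continuous.intervalIntegrable (by fun_prop) _ _) fun ρ hρ => ?_
  rw [havg, smul_eq_mul]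
  have := jet_le_circleAverage hq ρ
  have hρ0 := hρ.1
  calc _ = 2 * π * ρ * (exp (-c * ρ ^ 2) * (‖q 0‖ ^ 2 + ρ ^ 2 * ‖deriv q 0‖ ^ 2)) := by ring
    _ ≤ _ := by gcongr

open Real in
theorem gauss_integral_le {c : ℝ} (hc : 0 < c) {r : ℝ} (hr : 0 ≤ r) (k : ℕ) (hk : k ≤ 1) :
    ∫ w in Metric.closedBall (0 : ℂ) r, ‖w‖ ^ (2 * k) * exp (-c * ‖w‖ ^ 2) ≤ π / c ^ (k + 1) := by
  rw [closedBall_polar (by fun_prop) 0 hr]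
  have havg : ∀ ρ : ℝ, Real.circleAverage (fun w : ℂ => ‖w‖ ^ (2 * k) * exp (-c * ‖w‖ ^ 2)) 0 ρ
      = |ρ| ^ (2 * k) * exp (-c * ρ ^ 2) := by
    intro ρ
    refine Real.circleAverage_const_on_circle fun z hz => ?_
    have hz' : ‖z‖ = |ρ| := by simpa using hz
    simp [hz']
  have hpi := pi_pos
  simp only [havg, smul_eq_mul]
  interval_cases k
  · simp only [mul_zero, pow_zero, one_mul, zero_add, pow_one]
    rw [integral_gauss_zero hc]
    have := exp_pos (-c * r ^ 2)
    have h2 : 0 < π / c := by positivity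
    nlinarith
  · simp only [mul_one, sq_abs]
    rw [integral_gauss_two hc]
    have h2 : 0 < π / c ^ 2 := by positivity
    have h3 : 0 ≤ (1 + c * r ^ 2) * exp (-c * r ^ 2) := by positivity
    show _ ≤ π / c ^ 2
    nlinarith

/-- The kernel `|ζ - z|⁻¹` is integrable over a set of finite area, with a bound uniform in `z`. -/
theorem exists_integral_inv_dist_le (S : Set ℂ) (hS' : volume S ≠ ⊤) :
    ∃ C : ℝ, 0 ≤ C ∧ ∀ z : ℂ, IntegrableOn (fun ζ => ‖ζ - z‖⁻¹) S ∧ ∫ ζ in S, ‖ζ - z‖⁻¹ ≤ C := by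
  set f : ℂ → ℝ := fun w => (Set.Iic (1:ℝ)).indicator (fun t => t⁻¹) ‖w‖ with hf
  have hfi : Integrable f := by
    rw [hf, integrable_fun_norm_addHaar (μ := (volume : Measure ℂ))
      (f := (Set.Iic (1:ℝ)).indicator (fun t => t⁻¹))]
    have h1 : IntegrableOn ((Set.Iic (1:ℝ)).indicator (fun _ => (1:ℝ))) (Set.Ioi 0) := by
      rw [IntegrableOn, integrable_indicator_iff measurableSet_Iic, IntegrableOn,
        Measure.restrict_restrict measurableSet_Iic]
      rw [Set.inter_comm, Set.Ioi_inter_Iic]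
      exact integrableOn_const (by simp)
    refine h1.congr_fun (fun t ht => ?_) measurableSet_Ioi
    have ht' : (t:ℝ) ≠ 0 := ne_of_gt ht
    simp only [Complex.finrank_real_complex, Set.indicator_apply]
    split_ifs <;> simp [ht']
  have hf0 : ∀ w, 0 ≤ f w := by
    intro w
    rw [hf]
    exact Set.indicator_apply_nonneg fun _ => inv_nonneg.2 (norm_nonneg w)
  have hle : ∀ w : ℂ, ‖w‖⁻¹ ≤ f w + 1 := by
    intro w
    by_cases h : ‖w‖ ≤ 1
    · rw [hf]
      simp only
      rw [Set.indicator_of_mem (by exact h)]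
      linarith
    · have : ‖w‖⁻¹ ≤ 1 := inv_le_one_of_one_le₀ (le_of_not_ge h)
      linarith [hf0 w]
  have hint : ∀ z, Integrable fun ζ : ℂ => f (ζ - z) := fun z => hfi.comp_sub_right z
  have h1 : IntegrableOn (fun _ : ℂ => (1:ℝ)) S := integrableOn_const hS'
  have hmaj : ∀ z, IntegrableOn (fun ζ => f (ζ - z) + 1) S := fun z =>
    (hint z).integrableOn.add h1
  have hI : ∀ z : ℂ, IntegrableOn (fun ζ => ‖ζ - z‖⁻¹) S := by
    intro z
    refine (hmaj z).mono' (by fun_prop) (ae_of_all _ fun ζ => ?_)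
    rw [Real.norm_of_nonneg (by positivity)]
    exact hle _
  refine ⟨(∫ w, f w) + volume.real S, add_nonneg (integral_nonneg hf0) measureReal_nonneg,
    fun z => ⟨hI z, ?_⟩⟩
  calc ∫ ζ in S, ‖ζ - z‖⁻¹ ≤ ∫ ζ in S, (f (ζ - z) + 1) :=
        setIntegral_mono (hI z) (hmaj z) fun ζ => hle _
    _ = (∫ ζ in S, f (ζ - z)) + volume.real S := by
        rw [integral_add (hint z).integrableOn h1]; simp
    _ ≤ _ := by
        gcongr
        rw [← integral_sub_right_eq_self f z]
        exact setIntegral_le_integral (hint z) (ae_of_all _ fun ζ => hf0 _)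

/-! ### Growth of weighted polynomials -/

/-- Bernstein's inequality outside the unit disc, from the maximum principle for the reflected
polynomial. -/
theorem norm_eval_le_pow_mul {q : ℂ[X]} {n : ℕ} (hq : q.natDegree ≤ n) {A : ℝ}
    (hA : ∀ w : ℂ, ‖w‖ = 1 → ‖q.eval w‖ ≤ A) {z : ℂ} (hz : 1 ≤ ‖z‖) :
    ‖q.eval z‖ ≤ ‖z‖ ^ n * A := by
  have key : ∀ x : ℂ, x ≠ 0 → (q.reflect n).eval x⁻¹ * x ^ n = q.eval x := by
    intro x hx
    let _ := invertibleOfNonzero hx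
    have := Polynomial.eval₂_reflect_mul_pow (RingHom.id ℂ) x n q hq
    simpa [Polynomial.eval₂_id, invOf_eq_inv] using this
  have hz0 : z ≠ 0 := norm_pos_iff.1 (by linarith)
  have hmax : ‖(q.reflect n).eval z⁻¹‖ ≤ A := by
    refine Complex.norm_le_of_forall_mem_frontier_norm_le (f := fun w => (q.reflect n).eval w)
      (U := Metric.ball (0 : ℂ) 1) Metric.isBounded_ball
      (q.reflect n).differentiable.diffContOnCl ?_ ?_
    · intro w hw
      rw [frontier_ball (0 : ℂ) one_ne_zero, mem_sphere_zero_iff_norm] at hw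
      have hw0 : w⁻¹ ≠ 0 := inv_ne_zero (norm_pos_iff.1 (by linarith))
      have h1 := key w⁻¹ hw0
      have h2 : ‖w⁻¹‖ = 1 := by simp [hw]
      have h3 := hA w⁻¹ h2
      rw [← h1, norm_mul, norm_pow, h2, inv_inv, one_pow, mul_one] at h3
      exact h3
    · rw [closure_ball (0 : ℂ) one_ne_zero, mem_closedBall_zero_iff, norm_inv]
      exact inv_le_one_of_one_le₀ hz
  rw [← key z hz0, norm_mul, norm_pow, mul_comm]
  gcongr

/-- A weighted bound `M` for a polynomial of degree at most `n` on the unit disc improves far away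
by the exponentially small factor `|z|^{-nε}`. -/
theorem exists_growth {φ : ℂ → ℝ} (hφ : Continuous φ) (hg : HasLogGrowth φ) :
    ∃ ε > 0, ∃ R > 1, ∀ (n : ℕ) (q : ℂ[X]) (M : ℝ), q.natDegree ≤ n →
      (∀ w, ‖w‖ ≤ 1 → ‖q.eval w‖ ≤ M * Real.exp (n * φ w)) →
      ∀ z, R ≤ ‖z‖ → ‖q.eval z‖ ≤ M * Real.exp (-(n * ε * Real.log ‖z‖)) * Real.exp (n * φ z) := by
  obtain ⟨ε, hε, hev⟩ := hg
  obtain ⟨R₁, hR₁⟩ : ∃ R₁ : ℝ, ∀ z : ℂ, R₁ ≤ ‖z‖ → (1 + ε) * Real.log ‖z‖ ≤ φ z := by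
    rw [← comap_norm_atTop, Filter.eventually_comap] at hev
    obtain ⟨R₁, h⟩ := Filter.eventually_atTop.1 hev
    exact ⟨R₁, fun z hz => h _ hz z rfl⟩
  obtain ⟨B, hB⟩ : ∃ B : ℝ, ∀ z : ℂ, ‖z‖ ≤ 1 → φ z ≤ B := by
    obtain ⟨B, hB⟩ := (isCompact_closedBall (0 : ℂ) 1).bddAbove_image hφ.continuousOn
    exact ⟨B, fun z hz => hB ⟨z, by simpa using hz, rfl⟩⟩
  refine ⟨ε / 2, by positivity, max (max R₁ 2) (Real.exp (2 * B / ε)), ?_, ?_⟩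
  · exact lt_of_lt_of_le one_lt_two ((le_max_right _ _).trans (le_max_left _ _))
  intro n q M hq hM z hz
  have hz1 : R₁ ≤ ‖z‖ := ((le_max_left _ _).trans (le_max_left _ _)).trans hz
  have hz2 : 2 ≤ ‖z‖ := ((le_max_right _ _).trans (le_max_left _ _)).trans hz
  have hz3 : Real.exp (2 * B / ε) ≤ ‖z‖ := (le_max_right _ _).trans hz
  have hzpos : 0 < ‖z‖ := by linarith
  have hM0 : 0 ≤ M := by
    have := (norm_nonneg _).trans (hM 0 (by simp))
    exact nonneg_of_mul_nonneg_left this (Real.exp_pos _)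
  have hlog : 2 * B / ε ≤ Real.log ‖z‖ := (Real.le_log_iff_exp_le hzpos).2 hz3
  have hB' : B ≤ ε / 2 * Real.log ‖z‖ := by
    rw [div_le_iff₀ hε] at hlog; linarith
  have h1 := norm_eval_le_pow_mul hq (A := M * Real.exp (n * B)) (fun w hw =>
    (hM w hw.le).trans (by have := hB w hw.le; gcongr)) (by linarith : 1 ≤ ‖z‖)
  refine h1.trans ?_
  have h2 : ‖z‖ ^ n = Real.exp (n * Real.log ‖z‖) := by
    rw [mul_comm, Real.exp_mul, Real.exp_log hzpos, Real.rpow_natCast]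
  rw [h2, mul_assoc M, ← Real.exp_add, mul_left_comm, ← Real.exp_add]
  refine mul_le_mul_of_nonneg_left (Real.exp_le_exp.2 ?_) hM0
  have := hR₁ z hz1
  have hn : (0 : ℝ) ≤ n := n.cast_nonneg
  have h3 : Real.log ‖z‖ + B ≤ -(ε / 2 * Real.log ‖z‖) + φ z := by nlinarith
  nlinarith [mul_le_mul_of_nonneg_left h3 hn]

/-- A weighted bound on a fixed disc propagates to the plane with a square integrable gain
`(1 + |z|)⁻²` in amplitude. The threshold for `n` is needed to turn the excess `ε` in the growth
condition into two powers of `|z|`. -/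
theorem exists_decay {φ : ℂ → ℝ} (hφ : Continuous φ) (hg : HasLogGrowth φ) :
    ∃ C > 0, ∃ R > 0, ∃ N : ℕ, ∀ n ≥ N, ∀ (q : ℂ[X]) (M : ℝ), q.natDegree ≤ n →
      (∀ w, ‖w‖ ≤ R → ‖q.eval w‖ ≤ M * Real.exp (n * φ w)) →
      ∀ z, ‖q.eval z‖ ≤ M * (C * ((1 + ‖z‖) ^ 2)⁻¹) * Real.exp (n * φ z) := by
  obtain ⟨ε, hε, R, hR, h⟩ := exists_growth hφ hg
  obtain ⟨N, hN⟩ := exists_nat_ge (2 / ε)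
  refine ⟨(1 + R) ^ 2 + 4, by positivity, R, by linarith, N, fun n hn q M hq hM z => ?_⟩
  have hM0 : 0 ≤ M := by
    have := (norm_nonneg _).trans (hM 0 (by simp; linarith))
    exact nonneg_of_mul_nonneg_left this (Real.exp_pos _)
  rcases le_total ‖z‖ R with hz | hz
  · refine (hM z hz).trans ?_
    have : 1 ≤ ((1 + R) ^ 2 + 4) * ((1 + ‖z‖) ^ 2)⁻¹ := by
      rw [← div_eq_mul_inv, one_le_div (by positivity)]
      have : (1 + ‖z‖) ^ 2 ≤ (1 + R) ^ 2 := by gcongr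
      linarith
    have := mul_le_mul_of_nonneg_left this hM0
    gcongr
    linarith
  · refine (h n q M hq (fun w hw => hM w (by linarith)) z hz).trans ?_
    gcongr
    have hz1 : 1 < ‖z‖ := by linarith
    have hzp : 0 < ‖z‖ := by linarith
    have hlog : 0 < Real.log ‖z‖ := Real.log_pos hz1
    have hnε : 2 ≤ n * ε := by
      have : (N : ℝ) ≤ n := by exact_mod_cast hn
      have := hN.trans this
      rwa [div_le_iff₀ hε] at this
    have h1 : Real.exp (-(n * ε * Real.log ‖z‖)) ≤ (‖z‖ ^ 2)⁻¹ := by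
      have : (‖z‖ ^ 2)⁻¹ = Real.exp (-(2 * Real.log ‖z‖)) := by
        rw [Real.exp_neg, mul_comm, Real.exp_mul, Real.exp_log hzp]
        norm_cast
      rw [this]
      refine Real.exp_le_exp.2 ?_
      nlinarith
    refine h1.trans ?_
    rw [inv_le_iff_one_le_mul₀ (by positivity), mul_assoc, ← div_eq_inv_mul, mul_div_assoc',
      one_le_div (by positivity)]
    nlinarith

/-! ### Second order Taylor expansion -/

/-- Second order Taylor estimate with an arbitrary bilinear form `A` in place of the Hessian. -/
theorem taylor_bound {φ : ℂ → ℝ} (hφ : ContDiff ℝ 2 φ) {z : ℂ} {r κ : ℝ}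
    (A : ℂ →L[ℝ] ℂ →L[ℝ] ℝ)
    (hA : ∀ w : ℂ, ‖w‖ ≤ r → ‖fderiv ℝ (fderiv ℝ φ) (z + w) - A‖ ≤ κ) {w : ℂ} (hw : ‖w‖ ≤ r) :
    |φ (z + w) - φ z - fderiv ℝ φ z w - 1 / 2 * A w w| ≤ κ * ‖w‖ ^ 2 := by
  have hd1 : Differentiable ℝ φ := hφ.differentiable (by norm_num)
  have hd2 : Differentiable ℝ (fderiv ℝ φ) :=
    (hφ.fderiv_right (m := 1) (by norm_num)).differentiable (by norm_num)
  have hr : 0 ≤ r := (norm_nonneg w).trans hw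
  have hκ : 0 ≤ κ := (norm_nonneg (fderiv ℝ (fderiv ℝ φ) (z + 0) - A)).trans (hA 0 (by simpa using hr))
  have step : ∀ v : ℂ, ‖v‖ ≤ r → ‖fderiv ℝ φ (z + v) - fderiv ℝ φ z - A v‖ ≤ κ * ‖v‖ := by
    intro v hv
    have := (convex_closedBall z r).norm_image_sub_le_of_norm_hasFDerivWithin_le'
      (f := fderiv ℝ φ) (f' := fun x => fderiv ℝ (fderiv ℝ φ) x) (φ := A) (C := κ)
      (x := z) (y := z + v)
      (fun x _ => (hd2 x).hasFDerivAt.hasFDerivWithinAt)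
      (fun x hx => by
        have := hA (x - z) (by simpa [dist_eq_norm] using hx)
        simpa using this)
      (by simpa using hr) (by simpa [dist_eq_norm] using hv)
    simpa using this
  have hder : ∀ t ∈ Set.Icc (0 : ℝ) 1, HasDerivWithinAt
      (fun t : ℝ => φ (z + t • w) - t * fderiv ℝ φ z w - t ^ 2 / 2 * A w w)
      (fderiv ℝ φ (z + t • w) w - fderiv ℝ φ z w - t * A w w) (Set.Icc 0 1) t := by
    intro t _
    have h1 : HasDerivAt (fun t : ℝ => z + t • w) w t := by
      simpa using ((hasDerivAt_id t).smul_const w).const_add z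
    have h2 := (hd1 (z + t • w)).hasFDerivAt.comp_hasDerivAt t h1
    have h3 : HasDerivAt (fun t : ℝ => t * fderiv ℝ φ z w) (fderiv ℝ φ z w) t := by
      simpa using (hasDerivAt_id t).mul_const (fderiv ℝ φ z w)
    have h4 : HasDerivAt (fun t : ℝ => t ^ 2 / 2 * A w w) (t * A w w) t := by
      have := ((hasDerivAt_pow 2 t).div_const 2).mul_const (A w w)
      convert! this using 1
      simp
    exact ((h2.sub h3).sub h4).hasDerivWithinAt
  have := norm_image_sub_le_of_norm_deriv_le_segment_01' (C := κ * ‖w‖ ^ 2) hder (fun t ht => by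
    have ht0 := ht.1
    have htw : ‖t • w‖ ≤ ‖w‖ := by
      rw [norm_smul, Real.norm_of_nonneg ht0]
      nlinarith [ht.2, norm_nonneg w]
    have e : fderiv ℝ φ (z + t • w) w - fderiv ℝ φ z w - t * A w w
        = (fderiv ℝ φ (z + t • w) - fderiv ℝ φ z - A (t • w)) w := by
      simp only [sub_apply, map_smul, smul_apply, smul_eq_mul]
    rw [e]
    refine (ContinuousLinearMap.le_opNorm _ _).trans ?_
    have := step (t • w) (htw.trans hw)
    calc _ ≤ (κ * ‖t • w‖) * ‖w‖ := by gcongr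
      _ ≤ (κ * ‖w‖) * ‖w‖ := by gcongr
      _ = _ := by ring)
  rw [Real.norm_eq_abs] at this
  convert this using 2
  simp
  ring

theorem re_two_mul_wirtingerDeriv (φ : ℂ → ℝ) (z w : ℂ) :
    (2 * wirtingerDeriv φ z * w).re = fderiv ℝ φ z w := by
  have hw : w = w.re • (1 : ℂ) + w.im • Complex.I := by
    apply Complex.ext <;> simp
  conv_rhs => rw [hw, map_add, map_smul, map_smul]
  simp [wirtingerDeriv]
  ring

theorem exists_quadratic_bound {φ : ℂ → ℝ} (hφ : ContDiff ℝ 2 φ) {K : Set ℂ} (hK : IsCompact K) :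
    ∃ C > 0, ∀ z ∈ K, ∀ w : ℂ, ‖w‖ ≤ 1 →
      |φ (z + w) - φ z - (2 * wirtingerDeriv φ z * w).re| ≤ C * ‖w‖ ^ 2 := by
  have hc : Continuous (fderiv ℝ (fderiv ℝ φ)) :=
    (hφ.fderiv_right (m := 1) (by norm_num)).continuous_fderiv (by norm_num)
  obtain ⟨C, hC⟩ := IsCompact.exists_bound_of_continuousOn
    (E := ℂ →L[ℝ] ℂ →L[ℝ] ℝ) (hK.cthickening (r := 1)) hc.continuousOn
  refine ⟨max C 1, by positivity, fun z hz w hw => ?_⟩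
  have := taylor_bound hφ (z := z) (r := 1) (κ := max C 1) 0 (fun w hw => by
    rw [sub_zero]
    refine le_trans (hC (z + w) ?_) (le_max_left _ _)
    exact Metric.mem_cthickening_of_dist_le _ z _ _ hz (by simpa using hw)) hw
  rw [re_two_mul_wirtingerDeriv]
  simpa using this

/-- A real quadratic form on `ℂ` is the real part of a holomorphic one plus a quarter of its trace
times `|w|²`. -/
theorem half_bilin_eq (A : ℂ →L[ℝ] ℂ →L[ℝ] ℝ) :
    ∃ b : ℂ, ∀ w : ℂ, 1 / 2 * A w w
      = (b * w ^ 2).re + (A 1 1 + A Complex.I Complex.I) / 4 * ‖w‖ ^ 2 := by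
  refine ⟨⟨(A 1 1 - A Complex.I Complex.I) / 4, -(A 1 Complex.I + A Complex.I 1) / 4⟩,
    fun w => ?_⟩
  have hw : w = w.re • (1 : ℂ) + w.im • Complex.I := by
    apply Complex.ext <;> simp
  have h1 : A w w = w.re ^ 2 * A 1 1 + w.re * w.im * (A 1 Complex.I + A Complex.I 1)
      + w.im ^ 2 * A Complex.I Complex.I := by
    conv_lhs => rw [hw]
    simp only [map_add, map_smul, add_apply, smul_apply,
      smul_eq_mul]
    ring
  rw [h1, Complex.sq_norm, Complex.normSq_apply]
  simp [pow_two]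
  ring

/-- Near a compact set, `φ` is the real part of a holomorphic quadratic polynomial plus
`Δφ / 4 * |w|²`, up to an error `κ |w|²` on discs of uniform radius. -/
theorem uniform_taylor {φ : ℂ → ℝ} (hφ : ContDiff ℝ 2 φ) {K : Set ℂ} (hK : IsCompact K)
    {κ : ℝ} (hκ : 0 < κ) :
    ∃ r > 0, ∀ z ∈ K, ∃ b : ℂ, ∀ w : ℂ, ‖w‖ ≤ r →
      |φ (z + w) - (φ z + (2 * wirtingerDeriv φ z * w + b * w ^ 2)).re
        - Laplacian.laplacian φ z / 4 * ‖w‖ ^ 2| ≤ κ * ‖w‖ ^ 2 := by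
  have hc : Continuous (fderiv ℝ (fderiv ℝ φ)) :=
    (hφ.fderiv_right (m := 1) (by norm_num)).continuous_fderiv (by norm_num)
  have hu := (hK.cthickening (r := 1)).uniformContinuousOn_of_continuous hc.continuousOn
  obtain ⟨δ, hδ, h⟩ := (Metric.uniformContinuousOn_iff_le (α := ℂ)
    (β := ℂ →L[ℝ] ℂ →L[ℝ] ℝ)).1 hu κ hκ
  refine ⟨min δ 1, by positivity, fun z hz => ?_⟩
  obtain ⟨b, hb⟩ := half_bilin_eq (fderiv ℝ (fderiv ℝ φ) z)
  refine ⟨b, fun w hw => ?_⟩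
  have := taylor_bound hφ (z := z) (r := min δ 1) (κ := κ) (fderiv ℝ (fderiv ℝ φ) z)
    (fun w hw => by
      have := h (z + w) (Metric.mem_cthickening_of_dist_le _ z _ _ hz
        (by simpa using hw.trans (min_le_right _ _))) z
        (Metric.self_subset_cthickening _ hz) (by simpa using hw.trans (min_le_left _ _))
      exact le_of_eq_of_le (@dist_eq_norm (ℂ →L[ℝ] ℂ →L[ℝ] ℝ) _ _ _).symm this) hw
  have hL : Laplacian.laplacian φ z = fderiv ℝ (fderiv ℝ φ) z 1 1
      + fderiv ℝ (fderiv ℝ φ) z Complex.I Complex.I := by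
    rw [InnerProductSpace.laplacian_eq_iteratedFDeriv_complexPlane]
    simp [iteratedFDeriv_two_apply]
  rw [hL]
  rw [hb] at this
  convert this using 2
  rw [Complex.add_re, Complex.add_re, Complex.ofReal_re, re_two_mul_wirtingerDeriv]
  ring

theorem continuous_laplacian {φ : ℂ → ℝ} (hφ : ContDiff ℝ 2 φ) :
    Continuous (Laplacian.laplacian φ) := by
  have hc : Continuous (fderiv ℝ (fderiv ℝ φ)) :=
    (hφ.fderiv_right (m := 1) (by norm_num)).continuous_fderiv (by norm_num)
  rw [InnerProductSpace.laplacian_eq_iteratedFDeriv_complexPlane]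
  simp only [iteratedFDeriv_two_apply]
  fun_prop

theorem continuous_wirtingerDeriv {φ : ℂ → ℝ} (hφ : ContDiff ℝ 2 φ) :
    Continuous (wirtingerDeriv φ) := by
  have hc : Continuous (fderiv ℝ φ) := hφ.continuous_fderiv (by norm_num)
  unfold wirtingerDeriv
  fun_prop

/-! ### Fekete points and the contact set -/

theorem EReal.le_coe_sub_of_add_le {a : EReal} {b c : ℝ} (h : a + b ≤ c) :
    a ≤ ((c - b : ℝ) : EReal) := by
  induction a with
  | bot => exact bot_le
  | top => simp at h
  | coe a =>
    have h' : a + b ≤ c := by exact_mod_cast h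
    exact_mod_cast (by linarith : a ≤ c - b)

theorem circleAverage_sub_mul_normSq {h : ℂ → ℝ} {z : ℂ} {ρ : ℝ}
    (hh : InnerProductSpace.HarmonicOnNhd h (Metric.closedBall z |ρ|)) (a δ : ℝ) :
    Real.circleAverage (fun w => a + h w - δ * ‖w‖ ^ 2) z ρ
      = a + h z - δ * (‖z‖ ^ 2 + ρ ^ 2) := by
  set L : ℂ →L[ℝ] ℝ := (2 * δ) • (innerSL ℝ z) with hL
  have hLm : Real.circleAverage (fun w => L w) z ρ = L z := by
    have := L.circleAverage_comp_comm (f := fun w => w) (c := z) (R := ρ)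
      continuous_id.continuousOn.circleIntegrable'
    rw [(differentiable_id (𝕜 := ℂ)).diffContOnCl.circleAverage (f := fun w : ℂ => w)] at this
    exact this
  have hi1 : CircleIntegrable h z ρ :=
    (hh.continuousOn.mono Metric.sphere_subset_closedBall).circleIntegrable'
  have hi2 : ∀ g : ℂ → ℝ, Continuous g → CircleIntegrable g z ρ := fun g hg =>
    hg.continuousOn.circleIntegrable'
  have e : Real.circleAverage (fun w => a + h w - δ * ‖w‖ ^ 2) z ρ
      = Real.circleAverage (fun w => h w + ((a - δ * (ρ ^ 2 - ‖z‖ ^ 2)) - L w)) z ρ := by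
    refine Real.circleAverage_congr_sphere fun w hw => ?_
    have hw' : ‖w - z‖ = |ρ| := by simpa [dist_eq_norm] using hw
    have h1 := norm_sub_sq_real w z
    rw [hw', sq_abs, real_inner_comm] at h1
    simp only [hL, smul_apply, innerSL_apply_apply, smul_eq_mul]
    linear_combination δ * h1
  rw [e, Real.circleAverage_fun_add hi1 (hi2 _ (by fun_prop)), hh.circleAverage_eq,
    Real.circleAverage_fun_sub (hi2 _ (by fun_prop)) (hi2 _ (by fun_prop)), hLm,
    Real.circleAverage_const]
  simp only [hL, smul_apply, innerSL_apply_apply, smul_eq_mul, real_inner_self_eq_norm_sq]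
  ring

/-- Maximum principle for the class `L(ℂ)` on an unbounded closed set, against a harmonic function
that grows faster than `log |z|`. -/
theorem IsLogGrowthSubharmonic.le_of_le_frontier {u : ℂ → EReal} (hu : IsLogGrowthSubharmonic u)
    {h : ℂ → ℝ} {Ω : Set ℂ} (hΩ : IsClosed Ω)
    (hh : ∀ z ∈ Ω, InnerProductSpace.HarmonicAt h z)
    (hinf : Tendsto (fun z => h z - Real.log ‖z‖) (Bornology.cobounded ℂ) atTop)
    (hbd : ∀ z ∈ frontier Ω, u z ≤ (h z : EReal)) {z : ℂ} (hz : z ∈ Ω) : u z ≤ (h z : EReal) := by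
  obtain ⟨hu, C, hC⟩ := hu
  by_contra! hlt
  obtain ⟨t, ht1, ht2⟩ := EReal.lt_iff_exists_real_btwn.1 hlt
  have ht1' : h z < t := by exact_mod_cast ht1
  obtain ⟨R, hR0, hRz, hR⟩ : ∃ R : ℝ, 0 < R ∧ ‖z‖ < R ∧ ∀ w : ℂ, R ≤ ‖w‖ → u w ≤ (h w : EReal) := by
    have hev := hC.and (hinf.eventually_ge_atTop C)
    rw [← comap_norm_atTop, Filter.eventually_comap] at hev
    obtain ⟨R₁, hR₁⟩ := Filter.eventually_atTop.1 hev
    refine ⟨max R₁ (‖z‖ + 1), by positivity, by simp, fun w hw => ?_⟩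
    obtain ⟨h1, h2⟩ := hR₁ ‖w‖ ((le_max_left _ _).trans hw) w rfl
    refine h1.trans ?_
    exact_mod_cast (by linarith : Real.log ‖w‖ + C ≤ h w)
  set η := t - h z with hη
  have hηpos : 0 < η := by linarith
  obtain ⟨δ, hδ, hδR⟩ : ∃ δ : ℝ, 0 < δ ∧ δ * R ^ 2 < η :=
    ⟨η / (2 * R ^ 2), by positivity, by field_simp; linarith⟩
  -- Adding `δ |w|²` makes `u - h` strictly subharmonic, so that it has no interior maximum.
  set k : ℂ → ℝ := fun w => -h w + δ * ‖w‖ ^ 2 with hk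
  have hcont : ContinuousOn h Ω := fun w hw => (hh w hw).1.continuousAt.continuousWithinAt
  have hkc : ContinuousOn k Ω := by
    apply ContinuousOn.add hcont.neg
    fun_prop
  have hQ : IsCompact (Ω ∩ Metric.closedBall 0 R) := (isCompact_closedBall 0 R).inter_left hΩ
  have husc : UpperSemicontinuousOn (fun w => u w + (k w : EReal)) (Ω ∩ Metric.closedBall 0 R) := by
    refine UpperSemicontinuousOn.add' (hu.upperSemicontinuous.upperSemicontinuousOn _) ?_ ?_
    · exact ((continuous_coe_real_ereal.comp_continuousOn hkc).mono
        Set.inter_subset_left).upperSemicontinuousOn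
    · intro w _
      exact EReal.continuousAt_add (Or.inr (EReal.coe_ne_bot _)) (Or.inr (EReal.coe_ne_top _))
  have hzQ : z ∈ Ω ∩ Metric.closedBall 0 R := ⟨hz, by simpa using hRz.le⟩
  obtain ⟨p, ⟨hpΩ, hpR⟩, hmax⟩ := husc.exists_isMaxOn ⟨z, hzQ⟩ hQ
  have hge : (η : EReal) < u p + (k p : EReal) := by
    refine lt_of_lt_of_le ?_ (isMaxOn_iff.1 hmax z hzQ)
    have h1 : (η : EReal) ≤ ((t + k z : ℝ) : EReal) := by
      have : η ≤ t + k z := by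
        simp only [hk, hη]
        have : 0 ≤ δ * ‖z‖ ^ 2 := by positivity
        linarith
      exact_mod_cast this
    refine lt_of_le_of_lt h1 ?_
    rw [EReal.coe_add]
    exact EReal.add_lt_add_right_coe ht2 _
  have hnot : ¬ u p ≤ (h p : EReal) := by
    intro hle
    have h1 : u p + (k p : EReal) ≤ ((h p + k p : ℝ) : EReal) := by
      rw [EReal.coe_add]
      exact add_le_add hle le_rfl
    have h2 : η < h p + k p := by exact_mod_cast hge.trans_le h1
    have h3 : ‖p‖ ^ 2 ≤ R ^ 2 := by
      have : ‖p‖ ≤ R := by simpa using hpR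
      gcongr
    simp only [hk] at h2
    nlinarith
  have hpint : p ∈ interior Ω := by
    by_contra hcon
    exact hnot (hbd p ⟨subset_closure hpΩ, hcon⟩)
  have hpball : p ∈ Metric.ball (0 : ℂ) R := by
    by_contra hcon
    exact hnot (hR p (by simpa using hcon))
  obtain ⟨ρ, hρ, hρs⟩ := Metric.nhds_basis_closedBall.mem_iff.1
    (Filter.inter_mem (isOpen_interior.mem_nhds hpint) (Metric.isOpen_ball.mem_nhds hpball))
  have hupt : u p ≠ ⊤ := hu.ne_top p
  have hupb : u p ≠ ⊥ := by
    intro hb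
    exact hnot (by rw [hb]; exact bot_le)
  obtain ⟨m, hm⟩ : ∃ m : ℝ, u p = (m : EReal) := ⟨_, (EReal.coe_toReal hupt hupb).symm⟩
  have hsub : Metric.closedBall p ρ ⊆ Ω := fun w hw => interior_subset (hρs hw).1
  have hmaj : ∀ w ∈ Metric.closedBall p ρ,
      u w ≤ ((m + k p + h w - δ * ‖w‖ ^ 2 : ℝ) : EReal) := by
    intro w hw
    have h1 := isMaxOn_iff.1 hmax w ⟨hsub hw, Metric.ball_subset_closedBall (hρs hw).2⟩
    rw [hm, ← EReal.coe_add] at h1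
    have h2 := EReal.le_coe_sub_of_add_le h1
    convert! h2 using 2
    simp only [hk]; ring
  have hsc : IsClosed (Metric.sphere p ρ) := Metric.isClosed_sphere
  have hgc : ContinuousOn (fun w => m + k p + h w - δ * ‖w‖ ^ 2) (Metric.sphere p ρ) := by
    refine ContinuousOn.sub (ContinuousOn.add continuousOn_const
      (hcont.mono (Metric.sphere_subset_closedBall.trans hsub))) ?_
    fun_prop
  -- The sub-mean value inequality is tested on globally continuous majorants.
  obtain ⟨g, hg⟩ := ContinuousMap.exists_restrict_eq hsc ⟨_, hgc.domRestrict⟩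
  have hg' : ∀ w ∈ Metric.sphere p ρ, g w = m + k p + h w - δ * ‖w‖ ^ 2 := by
    intro w hw
    exact congrArg (fun f => f ⟨w, hw⟩) hg
  have hle := hu.le_circleAverage p ρ hρ g g.continuous (fun w hw => by
    rw [hg' w hw]
    exact hmaj w (Metric.sphere_subset_closedBall hw))
  have havg : Real.circleAverage g p ρ = m + k p + h p - δ * (‖p‖ ^ 2 + ρ ^ 2) := by
    rw [← circleAverage_sub_mul_normSq (h := h)]
    · refine Real.circleAverage_congr_sphere fun w hw => ?_
      rw [abs_of_pos hρ] at hw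
      exact hg' w hw
    · intro w hw
      rw [abs_of_pos hρ] at hw
      exact hh w (hsub hw)
  rw [havg, hm] at hle
  have hle' : m ≤ m + k p + h p - δ * (‖p‖ ^ 2 + ρ ^ 2) := by exact_mod_cast hle
  simp only [hk] at hle'
  have : 0 < δ * ρ ^ 2 := by positivity
  linarith

/-- If the weighted modulus `|f| e^{-nφ}` of an entire function has a global maximum at `x`, then it
stays comparable to that maximum on a disc of radius of order `1 / √n` about `x`. -/
theorem exists_schwarz_lower {φ : ℂ → ℝ} {C : ℝ} (hC : 0 < C) :
    ∃ s > 0, s ≤ 1 ∧ ∃ c₀ > 0, ∀ (n : ℕ), 1 ≤ n → ∀ (x lam : ℂ),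
      (∀ w : ℂ, ‖w‖ ≤ 1 → |φ (x + w) - φ x - (lam * w).re| ≤ C * ‖w‖ ^ 2) →
      ∀ f : ℂ → ℂ, Differentiable ℂ f → f x ≠ 0 →
      (∀ z, ‖f z‖ * Real.exp (-n * φ z) ≤ ‖f x‖ * Real.exp (-n * φ x)) →
      ∀ w : ℂ, ‖w‖ ≤ s / √n →
        c₀ * (‖f x‖ * Real.exp (-n * φ x)) ≤ ‖f (x + w)‖ * Real.exp (-n * φ (x + w)) := by
  set A := Real.exp C with hA
  have hA0 : 0 < A := Real.exp_pos _
  refine ⟨1 / (2 * (A + 2)), by positivity, ?_, 1 / 2 * Real.exp (-C), by positivity, ?_⟩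
  · rw [div_le_one (by positivity)]; linarith
  intro n hn x lam hT f hf hfx hmax w hw
  have hnR : (1 : ℝ) ≤ n := by exact_mod_cast hn
  have hn0 : (0 : ℝ) < n := by linarith
  have hsq : 0 < √(n : ℝ) := Real.sqrt_pos.2 hn0
  have hsq1 : 1 ≤ √(n : ℝ) := Real.one_le_sqrt.2 hnR
  have hsqsq : √(n : ℝ) ^ 2 = n := Real.sq_sqrt hn0.le
  set r := 1 / √(n : ℝ) with hr
  have hr0 : 0 < r := by positivity
  have hr1 : r ≤ 1 := by rw [hr, div_le_one hsq]; exact hsq1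
  have hnr : n * r ^ 2 = 1 := by
    rw [hr, div_pow, hsqsq]; field_simp
  -- On this scale `φ` is affine up to `O(1 / n)`; after removing the affine part, `f` becomes a
  -- bounded holomorphic function and the Schwarz lemma bounds its oscillation.
  set q : ℂ → ℂ := fun v => f (x + v) * Complex.exp (-(n * (lam * v))) / f x with hq
  have hqd : Differentiable ℂ q := by
    have h1 : Differentiable ℂ (fun v => f (x + v)) :=
      hf.comp ((differentiable_const x).add differentiable_id)
    have h2 : Differentiable ℂ (fun v => Complex.exp (-(n * (lam * v)))) := by fun_prop
    exact (h1.mul h2).div_const _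
  have hq0 : q 0 = 1 := by simp [hq, hfx]
  have hqn : ∀ v, ‖q v‖ = ‖f (x + v)‖ * Real.exp (-(n * (lam * v).re)) / ‖f x‖ := by
    intro v
    simp only [hq, norm_div, norm_mul, Complex.norm_exp]
    congr 3
    simp only [Complex.neg_re]
    rw [← Complex.ofReal_natCast, Complex.re_ofReal_mul]
  have hfx' : 0 < ‖f x‖ := norm_pos_iff.2 hfx
  have hqb : ∀ v : ℂ, ‖v‖ ≤ r → ‖q v‖ ≤ A := by
    intro v hv
    rw [hqn, div_le_iff₀ hfx']
    have h1 := hmax (x + v)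
    have h2 := (abs_le.1 (hT v (hv.trans hr1))).2
    have h3 : ‖f (x + v)‖ ≤ ‖f x‖ * Real.exp (n * (φ (x + v) - φ x)) := by
      have := mul_le_mul_of_nonneg_right h1 (Real.exp_pos (n * φ (x + v))).le
      rw [mul_assoc, ← Real.exp_add, mul_assoc, ← Real.exp_add] at this
      have e1 : -(n : ℝ) * φ (x + v) + n * φ (x + v) = 0 := by ring
      have e2 : -(n : ℝ) * φ x + n * φ (x + v) = n * (φ (x + v) - φ x) := by ring
      rwa [e1, e2, Real.exp_zero, mul_one] at this
    calc ‖f (x + v)‖ * Real.exp (-(n * (lam * v).re))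
        ≤ (‖f x‖ * Real.exp (n * (φ (x + v) - φ x))) * Real.exp (-(n * (lam * v).re)) := by gcongr
      _ = ‖f x‖ * Real.exp (n * (φ (x + v) - φ x - (lam * v).re)) := by
          rw [mul_assoc, ← Real.exp_add]; congr 2; ring
      _ ≤ ‖f x‖ * Real.exp C := by
          gcongr
          have h5 : C * ‖v‖ ^ 2 ≤ C * r ^ 2 := by gcongr
          calc (n : ℝ) * (φ (x + v) - φ x - (lam * v).re) ≤ n * (C * r ^ 2) := by
                gcongr; linarith
            _ = C := by linear_combination C * hnr
      _ = _ := by rw [hA]; ring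
  have hwr : ‖w‖ < r := by
    refine lt_of_le_of_lt hw ?_
    rw [hr]
    gcongr
    rw [div_lt_one (by positivity)]; linarith
  have hsch := Complex.dist_le_div_mul_dist_of_mapsTo_ball (f := q) (c := 0) (z := w)
    (R₁ := r) (R₂ := A + 2) hqd.differentiableOn (fun v hv => by
      rw [mem_ball_zero_iff] at hv
      rw [hq0, Metric.mem_closedBall, dist_eq_norm]
      have := hqb v hv.le
      have h1 : ‖q v - 1‖ ≤ ‖q v‖ + 1 := by simpa using norm_sub_le (q v) 1
      linarith) (by simpa using hwr)
  have hhalf : 1 / 2 ≤ ‖q w‖ := by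
    rw [hq0, dist_eq_norm, dist_zero_right] at hsch
    have h1 : (A + 2) / r * ‖w‖ ≤ 1 / 2 := by
      calc (A + 2) / r * ‖w‖ ≤ (A + 2) / r * (1 / (2 * (A + 2)) / √n) := by gcongr
        _ = 1 / 2 := by rw [hr]; field_simp
    have h2 : ‖(1 : ℂ)‖ - ‖q w‖ ≤ ‖1 - q w‖ := norm_sub_norm_le _ _
    rw [norm_one, norm_sub_rev] at h2
    linarith
  rw [hqn, le_div_iff₀ hfx'] at hhalf
  have h2 := (abs_le.1 (hT w (hwr.le.trans hr1))).2
  have h3 : n * (φ (x + w) - φ x - (lam * w).re) ≤ C := by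
    have h5 : C * ‖w‖ ^ 2 ≤ C * r ^ 2 := by have := hwr.le; gcongr
    calc (n : ℝ) * (φ (x + w) - φ x - (lam * w).re) ≤ n * (C * r ^ 2) := by
          gcongr; linarith
      _ = C := by linear_combination C * hnr
  calc 1 / 2 * Real.exp (-C) * (‖f x‖ * Real.exp (-n * φ x))
      = (1 / 2 * ‖f x‖) * Real.exp (-C + -n * φ x) := by rw [Real.exp_add]; ring
    _ ≤ (‖f (x + w)‖ * Real.exp (-(n * (lam * w).re))) * Real.exp (-C + -n * φ x) := by gcongr
    _ = ‖f (x + w)‖ * Real.exp (-(n * (lam * w).re) + (-C + -n * φ x)) := by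
        rw [mul_assoc, ← Real.exp_add]
    _ ≤ _ := by
        gcongr
        linarith

/-- The weighted Vandermonde product as a function of one of its points: every difference occurs
twice. -/
theorem prod_offDiag_update {ι : Type*} [Fintype ι] [DecidableEq ι] (φ : ℂ → ℝ) (n : ℝ)
    (x : ι → ℂ) (k : ι) :
    ∃ A : ℝ, ∀ z : ℂ, ∏ i, ((∏ j ∈ Finset.univ.erase i,
        ‖Function.update x k z i - Function.update x k z j‖) *
          Real.exp (-(2 * n * φ (Function.update x k z i))))
      = A * ((∏ j ∈ Finset.univ.erase k, ‖z - x j‖) * Real.exp (-n * φ z)) ^ 2 := by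
  refine ⟨∏ i ∈ Finset.univ.erase k, ((∏ j ∈ (Finset.univ.erase i).erase k, ‖x i - x j‖) *
    Real.exp (-(2 * n * φ (x i)))), fun z => ?_⟩
  rw [← Finset.mul_prod_erase Finset.univ _ (Finset.mem_univ k)]
  have h1 : ∀ i ∈ Finset.univ.erase k, (∏ j ∈ Finset.univ.erase i,
        ‖Function.update x k z i - Function.update x k z j‖) *
          Real.exp (-(2 * n * φ (Function.update x k z i)))
      = ‖z - x i‖ * ((∏ j ∈ (Finset.univ.erase i).erase k, ‖x i - x j‖) *
          Real.exp (-(2 * n * φ (x i)))) := by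
    intro i hi
    have hik : i ≠ k := Finset.ne_of_mem_erase hi
    have hmem : k ∈ Finset.univ.erase i := by simp [hik.symm]
    rw [← Finset.mul_prod_erase _ _ hmem, Function.update_of_ne hik, Function.update_self,
      norm_sub_rev, mul_assoc]
    congr 2
    refine Finset.prod_congr rfl fun j hj => ?_
    rw [Function.update_of_ne (Finset.ne_of_mem_erase hj)]
  rw [Finset.prod_congr rfl h1, Finset.prod_mul_distrib, Function.update_self]
  have h2 : ∏ j ∈ Finset.univ.erase k, ‖z - Function.update x k z j‖
      = ∏ j ∈ Finset.univ.erase k, ‖z - x j‖ :=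
    Finset.prod_congr rfl fun j hj => by
      rw [Function.update_of_ne (Finset.ne_of_mem_erase hj)]
  have h3 : Real.exp (-(2 * n * φ z)) = Real.exp (-n * φ z) ^ 2 := by
    rw [← Real.exp_nat_mul]; congr 1; push_cast; ring
  rw [h2, h3]
  ring

theorem tendsto_weight {φ : ℂ → ℝ} (hg : HasLogGrowth φ) :
    Tendsto (fun z => φ z - Real.log (1 + ‖z‖)) (Bornology.cobounded ℂ) atTop := by
  obtain ⟨ε, hε, hev⟩ := hg
  have h1 : Tendsto (fun z : ℂ => ε * Real.log ‖z‖ - Real.log 2) (Bornology.cobounded ℂ) atTop := by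
    refine tendsto_atTop_add_const_right _ _ (Tendsto.const_mul_atTop hε ?_)
    exact Real.tendsto_log_atTop.comp tendsto_norm_cobounded_atTop
  refine tendsto_atTop_mono' _ ?_ h1
  filter_upwards [hev, tendsto_norm_cobounded_atTop.eventually_ge_atTop 1] with z hz hz1
  have : Real.log (1 + ‖z‖) ≤ Real.log 2 + Real.log ‖z‖ := by
    rw [← Real.log_mul two_ne_zero (by linarith)]
    exact Real.log_le_log (by linarith) (by linarith)
  linarith

/-- Weighted Fekete points: a maximizer of the weighted Vandermonde product. Each point maximizes
the weighted modulus of the polynomial that vanishes at the others. -/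
theorem exists_fekete {φ : ℂ → ℝ} (hφ : Continuous φ) (hg : HasLogGrowth φ) {n : ℕ} (hn : 1 ≤ n) :
    ∃ x : Fin (n + 1) → ℂ, ∀ k, (∏ j ∈ Finset.univ.erase k, (x k - x j)) ≠ 0 ∧
      ∀ z, ‖∏ j ∈ Finset.univ.erase k, (z - x j)‖ * Real.exp (-n * φ z)
        ≤ ‖∏ j ∈ Finset.univ.erase k, (x k - x j)‖ * Real.exp (-n * φ (x k)) := by
  have hn0 : (0 : ℝ) < n := by exact_mod_cast hn
  set V : (Fin (n + 1) → ℂ) → ℝ := fun x => ∏ i, ((∏ j ∈ Finset.univ.erase i, ‖x i - x j‖) *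
    Real.exp (-(2 * n * φ (x i)))) with hV
  set W : ℂ → ℝ := fun z => Real.exp (-(2 * n * (φ z - Real.log (1 + ‖z‖)))) with hW
  have hVc : Continuous V := by
    rw [hV]
    fun_prop
  have hW0 : ∀ z, 0 ≤ W z := fun z => (Real.exp_pos _).le
  have hWlim : Tendsto W (Bornology.cobounded ℂ) (𝓝 0) := by
    refine Real.tendsto_exp_neg_atTop_nhds_zero.comp ?_
    exact (tendsto_weight hg).const_mul_atTop (by positivity)
  have hWc : Continuous W := by
    have : Continuous fun z : ℂ => Real.log (1 + ‖z‖) :=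
      Continuous.log (by fun_prop) (fun z => by positivity)
    rw [hW]
    fun_prop
  have hWeq : ∀ z, W z = (1 + ‖z‖) ^ (2 * n) * Real.exp (-(2 * n * φ z)) := by
    intro z
    have h1 : (1 + ‖z‖) ^ (2 * n) = Real.exp (2 * n * Real.log (1 + ‖z‖)) := by
      rw [mul_comm (2 * (n : ℝ)), Real.exp_mul, Real.exp_log (by positivity)]
      norm_cast
    rw [h1, ← Real.exp_add]
    exact congrArg Real.exp (by ring)
  have hVW : ∀ x, V x ≤ ∏ i, W (x i) := by
    intro x
    have h1 : V x ≤ ∏ i, ((∏ j ∈ Finset.univ.erase i, ((1 + ‖x i‖) * (1 + ‖x j‖))) *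
        Real.exp (-(2 * n * φ (x i)))) := by
      refine Finset.prod_le_prod (fun i _ => by positivity) fun i _ => ?_
      refine mul_le_mul_of_nonneg_right ?_ (Real.exp_pos _).le
      refine Finset.prod_le_prod (fun j _ => by positivity) fun j _ => ?_
      have := norm_sub_le (x i) (x j)
      nlinarith [norm_nonneg (x i), norm_nonneg (x j)]
    refine h1.trans (le_of_eq ?_)
    simp only [hWeq, Finset.prod_mul_distrib]
    congr 1
    have e1 : ∀ i : Fin (n + 1), ∏ j ∈ Finset.univ.erase i, (1 + ‖x i‖) = (1 + ‖x i‖) ^ n := by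
      intro i
      rw [Finset.prod_const, Finset.card_erase_of_mem (Finset.mem_univ i)]
      simp
    have e2 : ∏ i : Fin (n + 1), ∏ j ∈ Finset.univ.erase i, (1 + ‖x j‖)
        = ∏ j : Fin (n + 1), (1 + ‖x j‖) ^ n := by
      rw [Finset.prod_comm' (t' := Finset.univ) (s' := fun j => Finset.univ.erase j)]
      · exact Finset.prod_congr rfl fun j _ => e1 j
      · intro i j
        simp [ne_comm]
    rw [e2, ← Finset.prod_mul_distrib]
    refine Finset.prod_congr rfl fun i _ => ?_
    rw [e1, ← pow_add, two_mul]
  obtain ⟨B, hB1, hB⟩ : ∃ B : ℝ, 1 ≤ B ∧ ∀ z, W z ≤ B := by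
    obtain ⟨R, hR⟩ : ∃ R : ℝ, ∀ z : ℂ, R ≤ ‖z‖ → W z ≤ 1 := by
      have hev := hWlim.eventually (eventually_le_nhds zero_lt_one)
      rw [← comap_norm_atTop, Filter.eventually_comap] at hev
      obtain ⟨R₁, h⟩ := Filter.eventually_atTop.1 hev
      exact ⟨R₁, fun z hz => h _ hz z rfl⟩
    obtain ⟨B, hB⟩ := (isCompact_closedBall (0 : ℂ) R).bddAbove_image hWc.continuousOn
    refine ⟨max B 1, le_max_right _ _, fun z => ?_⟩
    rcases le_total ‖z‖ R with h | h
    · exact (hB ⟨z, by simpa using h, rfl⟩).trans (le_max_left _ _)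
    · exact (hR z h).trans (le_max_right _ _)
  -- Any configuration of distinct points makes the product positive.
  set x₀ : Fin (n + 1) → ℂ := fun i => (i : ℕ) with hx₀
  have hx₀pos : 0 < V x₀ := by
    refine Finset.prod_pos fun i _ => mul_pos (Finset.prod_pos fun j hj => ?_) (Real.exp_pos _)
    rw [norm_pos_iff, sub_ne_zero]
    intro h
    have : (i : ℕ) = j := by
      simpa [hx₀] using h
    exact (Finset.ne_of_mem_erase hj) (Fin.ext this.symm)
  obtain ⟨x, hx⟩ : ∃ x, ∀ y, V y ≤ V x := by
    refine hVc.exists_forall_ge' x₀ ?_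
    rw [← Metric.cobounded_eq_cocompact]
    obtain ⟨R, hR⟩ : ∃ R : ℝ, ∀ z : ℂ, R ≤ ‖z‖ → W z ≤ V x₀ / B ^ n := by
      have hev := hWlim.eventually (eventually_le_nhds (by positivity : 0 < V x₀ / B ^ n))
      rw [← comap_norm_atTop, Filter.eventually_comap] at hev
      obtain ⟨R₁, h⟩ := Filter.eventually_atTop.1 hev
      exact ⟨R₁, fun z hz => h _ hz z rfl⟩
    filter_upwards [tendsto_norm_cobounded_atTop.eventually_gt_atTop (max R 0)] with y hy
    obtain ⟨i, hi⟩ : ∃ i, R ≤ ‖y i‖ := by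
      by_contra! hcon
      refine absurd hy (not_lt.2 ((pi_norm_le_iff_of_nonneg (le_max_right _ _)).2 fun i => ?_))
      exact (hcon i).le.trans (le_max_left _ _)
    refine (hVW y).trans ?_
    rw [← Finset.mul_prod_erase Finset.univ _ (Finset.mem_univ i)]
    have h1 : ∏ j ∈ Finset.univ.erase i, W (y j) ≤ B ^ n := by
      calc ∏ j ∈ Finset.univ.erase i, W (y j) ≤ ∏ j ∈ Finset.univ.erase i, B :=
            Finset.prod_le_prod (fun j _ => hW0 _) fun j _ => hB _
        _ = B ^ n := by
            rw [Finset.prod_const, Finset.card_erase_of_mem (Finset.mem_univ i)]; simp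
    calc W (y i) * ∏ j ∈ Finset.univ.erase i, W (y j) ≤ (V x₀ / B ^ n) * B ^ n := by
          have := hR _ hi
          have h0 := hW0 (y i)
          have h3 : 0 ≤ ∏ j ∈ Finset.univ.erase i, W (y j) := Finset.prod_nonneg fun j _ => hW0 _
          gcongr
      _ = V x₀ := by field_simp
  have hxpos : 0 < V x := hx₀pos.trans_le (hx x₀)
  refine ⟨x, fun k => ?_⟩
  obtain ⟨A, hA⟩ := prod_offDiag_update φ n x k
  have hAx := hA (x k)
  rw [Function.update_eq_self] at hAx
  change V x = _ at hAx
  have hne : 0 < A ∧ (∏ j ∈ Finset.univ.erase k, ‖x k - x j‖) ≠ 0 := by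
    rw [hAx] at hxpos
    constructor
    · by_contra! hcon
      exact absurd hxpos (not_lt.2 (mul_nonpos_of_nonpos_of_nonneg hcon (sq_nonneg _)))
    · intro h0
      rw [h0] at hxpos
      simp at hxpos
  refine ⟨fun h0 => hne.2 ?_, fun z => ?_⟩
  · rw [← norm_prod, h0, norm_zero]
  · have h1 := hx (Function.update x k z)
    rw [hAx] at h1
    change ∏ i, _ ≤ _ at h1
    rw [hA z] at h1
    rw [norm_prod, norm_prod]
    have h2 := le_of_mul_le_mul_left h1 hne.1
    exact (pow_le_pow_iff_left₀ (by positivity) (by positivity) two_ne_zero).1 h2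

theorem harmonicAt_log_norm_eval {p : ℂ[X]} {z : ℂ} (hz : p.eval z ≠ 0) (A n : ℝ) :
    InnerProductSpace.HarmonicAt (fun w => (Real.log ‖p.eval w‖ + A) / n) z := by
  have h1 : InnerProductSpace.HarmonicAt (fun w => Real.log ‖p.eval w‖) z :=
    AnalyticAt.harmonicAt_log_norm (p.differentiable.analyticAt z) hz
  have h2 : InnerProductSpace.HarmonicAt (fun _ : ℂ => A) z := InnerProductSpace.harmonicAt_const _
  have h3 := (h1.add h2).const_smul (c := n⁻¹)
  convert! h3 using 2 with w
  simp [div_eq_inv_mul]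

open Polynomial in
/-- At every point of the contact set, one of the `n + 1` normalized Fekete polynomials reaches the
weight `e^{nφ}` up to a factor polynomial in `n`. This is where the equality `U_φ = φ` is used. -/
theorem exists_peak_polynomials {φ : ℂ → ℝ} (hφ : ContDiff ℝ 2 φ) (hg : HasLogGrowth φ) :
    ∃ c > 0, ∀ n : ℕ, 1 ≤ n → ∃ F : Fin (n + 1) → ℂ[X],
      (∀ j, (F j).natDegree ≤ n) ∧ (∀ j z, ‖(F j).eval z‖ ≤ Real.exp (n * φ z)) ∧
      ∀ ζ ∈ contactSet φ, ∃ j,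
        c / (n * (1 + ‖ζ‖)) * Real.exp (n * φ ζ) ≤ ‖(F j).eval ζ‖ := by
  obtain ⟨ε, hε, R, hR, hgrow⟩ := exists_growth hφ.continuous hg
  obtain ⟨D, hD, hquad⟩ := exists_quadratic_bound hφ (isCompact_closedBall (0 : ℂ) R)
  obtain ⟨s, hs, hs1, c₀, hc₀, hschwarz⟩ := exists_schwarz_lower (φ := φ) hD
  refine ⟨min c₀ (s * c₀ / R), by positivity, fun n hn => ?_⟩
  have hnR : (1 : ℝ) ≤ n := by exact_mod_cast hn
  have hn0 : (0 : ℝ) < n := by linarith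
  obtain ⟨x, hx⟩ := exists_fekete hφ.continuous hg hn
  set G : Fin (n + 1) → ℂ[X] := fun k => ∏ j ∈ Finset.univ.erase k, (X - C (x j)) with hG
  have hGe : ∀ k z, (G k).eval z = ∏ j ∈ Finset.univ.erase k, (z - x j) := by
    intro k z; simp [hG, eval_prod]
  have hGd : ∀ k, (G k).natDegree = n := by
    intro k
    simp only [hG, natDegree_finsetProd_X_sub_C_eq_card]
    rw [Finset.card_erase_of_mem (Finset.mem_univ k)]; simp
  set M : Fin (n + 1) → ℝ := fun k => ‖(G k).eval (x k)‖ * Real.exp (-n * φ (x k)) with hM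
  have hGx : ∀ k, (G k).eval (x k) ≠ 0 := fun k => by rw [hGe]; exact (hx k).1
  have hMpos : ∀ k, 0 < M k := fun k => mul_pos (norm_pos_iff.2 (hGx k)) (Real.exp_pos _)
  have hmax : ∀ k z, ‖(G k).eval z‖ * Real.exp (-n * φ z) ≤ M k := by
    intro k z
    simp only [hM, hGe]
    exact (hx k).2 z
  have hle : ∀ k z, ‖(G k).eval z‖ ≤ M k * Real.exp (n * φ z) := by
    intro k z
    have := mul_le_mul_of_nonneg_right (hmax k z) (Real.exp_pos (n * φ z)).le
    rw [mul_assoc, ← Real.exp_add] at this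
    simpa using this
  have hxR : ∀ k, ‖x k‖ ≤ R := by
    intro k
    by_contra! hcon
    have h1 := hgrow n (G k) (M k) (hGd k).le (fun w _ => hle k w) (x k) hcon.le
    have h2 : M k ≤ M k * Real.exp (-(n * ε * Real.log ‖x k‖)) := by
      have := mul_le_mul_of_nonneg_right h1 (Real.exp_pos (-n * φ (x k))).le
      have e : (n : ℝ) * φ (x k) + -n * φ (x k) = 0 := by ring
      rwa [mul_assoc (_ * _), ← Real.exp_add, e, Real.exp_zero, mul_one] at this
    have h3 : Real.exp (-(n * ε * Real.log ‖x k‖)) < 1 := by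
      rw [Real.exp_lt_one_iff]
      have : 0 < Real.log ‖x k‖ := Real.log_pos (by linarith)
      have : 0 < n * ε * Real.log ‖x k‖ := by positivity
      linarith
    have := hMpos k
    nlinarith
  have hnear : ∀ k z, ‖z - x k‖ ≤ s / √n →
      c₀ * M k * Real.exp (n * φ z) ≤ ‖(G k).eval z‖ := by
    intro k z hz
    have := hschwarz n hn (x k) (2 * wirtingerDeriv φ (x k)) (hquad (x k) (by simpa using hxR k))
      (fun w => (G k).eval w) (G k).differentiable (hGx k) (hmax k) (z - x k) hz
    rw [add_sub_cancel] at this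
    have := mul_le_mul_of_nonneg_right this (Real.exp_pos (n * φ z)).le
    have e : -(n : ℝ) * φ z + n * φ z = 0 := by ring
    rw [mul_assoc ‖_‖, ← Real.exp_add, e, Real.exp_zero, mul_one] at this
    exact this
  have hFe : ∀ k z, ‖(C (((M k)⁻¹ : ℝ) : ℂ) * G k).eval z‖ = ‖(G k).eval z‖ / M k := by
    intro k z
    rw [eval_mul, eval_C, norm_mul, Complex.norm_real, Real.norm_of_nonneg
      (inv_nonneg.2 (hMpos k).le), div_eq_inv_mul]
  refine ⟨fun k => C (((M k)⁻¹ : ℝ) : ℂ) * G k, fun k => ?_, fun k z => ?_, fun ζ hζ => ?_⟩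
  · exact (natDegree_C_mul_le _ _).trans (hGd k).le
  · rw [hFe, div_le_iff₀ (hMpos k), mul_comm]
    exact hle k z
  have hden : 1 ≤ n * (1 + ‖ζ‖) := by nlinarith [norm_nonneg ζ]
  by_cases hcase : ∃ k, ‖ζ - x k‖ ≤ s / √n
  · obtain ⟨k, hk⟩ := hcase
    refine ⟨k, ?_⟩
    rw [hFe, le_div_iff₀ (hMpos k)]
    refine le_trans ?_ (hnear k ζ hk)
    have h1 : min c₀ (s * c₀ / R) / (n * (1 + ‖ζ‖)) ≤ c₀ :=
      (div_le_self (by positivity) hden).trans (min_le_left _ _)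
    have := hMpos k
    calc _ ≤ c₀ * Real.exp (n * φ ζ) * M k := by gcongr
      _ = _ := by ring
  push Not at hcase
  -- Away from the Fekete points, `φ = U_φ` is compared with the potential `h` of all `n + 1` points.
  -- The degree `n + 1` over the divisor `n` makes `h` grow faster than `log |z|`.
  obtain ⟨k, hkmin⟩ := Finite.exists_min M
  refine ⟨k, ?_⟩
  set σ := s / √(n : ℝ) with hσ
  have hsq : 0 < √(n : ℝ) := Real.sqrt_pos.2 hn0
  have hσ0 : 0 < σ := by positivity
  set P : ℂ[X] := ∏ j, (X - C (x j)) with hP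
  have hPG : ∀ j z, P.eval z = (z - x j) * (G j).eval z := by
    intro j z
    rw [hGe, hP, eval_prod, ← Finset.mul_prod_erase Finset.univ _ (Finset.mem_univ j)]
    simp
  set h : ℂ → ℝ := fun z => (Real.log ‖P.eval z‖ + -Real.log (σ * c₀ * M k)) / n with hh
  set Ω : Set ℂ := {z | ∀ j, σ ≤ ‖z - x j‖} with hΩ
  have hMk := hMpos k
  have hPne : ∀ z ∈ Ω, P.eval z ≠ 0 := by
    intro z hz h0
    rw [hP, eval_prod, Finset.prod_eq_zero_iff] at h0
    obtain ⟨j, -, hj⟩ := h0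
    have := hz j
    simp only [eval_sub, eval_X, eval_C] at hj
    rw [hj, norm_zero] at this
    linarith
  have hΩc : IsClosed Ω := by
    have : Ω = ⋂ j, {z | σ ≤ ‖z - x j‖} := by ext; simp [hΩ]
    rw [this]
    exact isClosed_iInter fun j => isClosed_le continuous_const (by fun_prop)
  have hUh : φ ζ ≤ h ζ := by
    have hsup : equilibriumPotential φ ζ ≤ (h ζ : EReal) := by
      refine sSup_le ?_
      rintro t ⟨u, hu, huφ, rfl⟩
      refine hu.le_of_le_frontier hΩc (h := h) (fun z hz => harmonicAt_log_norm_eval (hPne z hz) _ _)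
        ?_ ?_ (fun j => (hcase j).le)
      · have h1 : Tendsto (fun z : ℂ => Real.log ‖z‖ / n -
            ((n + 1) * Real.log 2 + Real.log (σ * c₀ * M k)) / n) (Bornology.cobounded ℂ) atTop := by
          refine tendsto_atTop_add_const_right _ _ (Tendsto.atTop_div_const hn0 ?_)
          exact Real.tendsto_log_atTop.comp tendsto_norm_cobounded_atTop
        refine tendsto_atTop_mono' _ ?_ h1
        filter_upwards [tendsto_norm_cobounded_atTop.eventually_ge_atTop (2 * R)] with z hz
        have hzpos : 0 < ‖z‖ := by linarith
        have h2 : (‖z‖ / 2) ^ (n + 1) ≤ ‖P.eval z‖ := by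
          rw [hP, eval_prod, norm_prod]
          calc (‖z‖ / 2) ^ (n + 1) = ∏ j : Fin (n + 1), (‖z‖ / 2) := by simp [div_pow]
            _ ≤ _ := by
              refine Finset.prod_le_prod (fun j _ => by positivity) fun j _ => ?_
              simp only [eval_sub, eval_X, eval_C]
              have := norm_sub_norm_le z (x j)
              have := hxR j
              linarith
        have h3 := Real.log_le_log (by positivity) h2
        rw [Real.log_pow, Real.log_div hzpos.ne' two_ne_zero] at h3
        push_cast at h3
        simp only [hh]
        rw [← sub_div, le_sub_iff_add_le, div_add' _ _ _ hn0.ne']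
        refine div_le_div_of_nonneg_right ?_ hn0.le
        linarith
      · intro z hz
        have hzΩ : z ∈ Ω := hΩc.frontier_subset hz
        obtain ⟨j, hj⟩ : ∃ j, ‖z - x j‖ = σ := by
          by_contra! hcon
          have : z ∈ interior Ω := by
            refine mem_interior.2 ⟨⋂ j, {z | σ < ‖z - x j‖}, ?_, ?_, ?_⟩
            · intro w hw j
              exact (Set.mem_iInter.1 hw j).le
            · exact isOpen_iInter_of_finite fun j => isOpen_lt continuous_const (by fun_prop)
            · exact Set.mem_iInter.2 fun j => lt_of_le_of_ne (hzΩ j) (hcon j).symm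
          exact hz.2 this
        refine (huφ z).trans ?_
        have h1 : σ * c₀ * M k * Real.exp (n * φ z) ≤ ‖P.eval z‖ := by
          rw [hPG j, norm_mul, hj]
          have h2 := hnear j z hj.le
          have h3 := hkmin j
          have h4 : σ * c₀ * Real.exp (n * φ z) * M k ≤ σ * c₀ * Real.exp (n * φ z) * M j :=
            mul_le_mul_of_nonneg_left h3 (by positivity)
          calc σ * c₀ * M k * Real.exp (n * φ z) ≤ σ * (c₀ * M j * Real.exp (n * φ z)) := by
                linarith
            _ ≤ _ := by gcongr
        have h4 := Real.log_le_log (by positivity) h1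
        rw [Real.log_mul (by positivity) (Real.exp_pos _).ne', Real.log_exp] at h4
        have : φ z ≤ h z := by
          simp only [hh]
          rw [le_div_iff₀ hn0]
          linarith
        exact_mod_cast this
    rw [hζ] at hsup
    exact_mod_cast hsup
  simp only [hh] at hUh
  rw [le_div_iff₀ hn0] at hUh
  have hPζ : 0 < ‖P.eval ζ‖ := norm_pos_iff.2 (hPne ζ fun j => (hcase j).le)
  have h5 : σ * c₀ * M k * Real.exp (n * φ ζ) ≤ ‖P.eval ζ‖ := by
    rw [← Real.exp_log hPζ]
    have h6 : σ * c₀ * M k = Real.exp (Real.log (σ * c₀ * M k)) := by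
      rw [Real.exp_log (by positivity)]
    rw [h6, ← Real.exp_add]
    exact Real.exp_le_exp.2 (by linarith)
  rw [hPG k, norm_mul] at h5
  have h7 : ‖ζ - x k‖ ≤ R * (1 + ‖ζ‖) := by
    have := norm_sub_le ζ (x k)
    have := hxR k
    nlinarith [norm_nonneg ζ]
  rw [hFe, le_div_iff₀ (hMpos k)]
  have h8 : σ * c₀ * M k * Real.exp (n * φ ζ) ≤ R * (1 + ‖ζ‖) * ‖(G k).eval ζ‖ :=
    h5.trans (by gcongr)
  have h9 : s / n ≤ σ := by
    rw [hσ]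
    gcongr
    rw [Real.sqrt_le_left (by positivity)]
    nlinarith
  have hRp : 0 < R := by linarith
  calc min c₀ (s * c₀ / R) / (n * (1 + ‖ζ‖)) * Real.exp (n * φ ζ) * M k
      ≤ (s * c₀ / R) / (n * (1 + ‖ζ‖)) * Real.exp (n * φ ζ) * M k := by
        gcongr
        exact min_le_right _ _
    _ = (s / n) * c₀ * M k * Real.exp (n * φ ζ) / (R * (1 + ‖ζ‖)) := by field_simp
    _ ≤ σ * c₀ * M k * Real.exp (n * φ ζ) / (R * (1 + ‖ζ‖)) := by gcongr
    _ ≤ _ := by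
        rw [div_le_iff₀ (by positivity)]
        linarith

/-! ### Polynomial approximation of cut-off entire functions -/

/-- The half-open annulus `r < |ζ - z₀| ≤ 2r`. -/
def annulus (z₀ : ℂ) (r : ℝ) : Set ℂ := {ζ | r < ‖ζ - z₀‖ ∧ ‖ζ - z₀‖ ≤ 2 * r}

theorem annulus_subset_closedBall (z₀ : ℂ) (r : ℝ) :
    annulus z₀ r ⊆ Metric.closedBall z₀ (2 * r) := fun ζ hζ => by
  simpa [dist_eq_norm] using hζ.2

theorem measurableSet_annulus (z₀ : ℂ) (r : ℝ) : MeasurableSet (annulus z₀ r) := by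
  have h1 : IsOpen {z : ℂ | r < ‖z - z₀‖} := isOpen_lt continuous_const (by fun_prop)
  have h2 : IsClosed {z : ℂ | ‖z - z₀‖ ≤ 2 * r} := isClosed_le (by fun_prop) continuous_const
  exact h1.measurableSet.inter h2.measurableSet

theorem volume_annulus_ne_top (z₀ : ℂ) (r : ℝ) : volume (annulus z₀ r) ≠ ⊤ :=
  ((measure_mono (annulus_subset_closedBall z₀ r)).trans_lt
    (isCompact_closedBall _ _).measure_lt_top).ne

/-- The piecewise linear radial cut-off that is `1` on `|z - z₀| ≤ r` and `0` on
`|z - z₀| ≥ 2r`, written as an average of indicators of discs. -/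
def ramp (z₀ : ℂ) (r : ℝ) (z : ℂ) : ℝ :=
  r⁻¹ * ∫ ρ in r..(2 * r), (Set.Ioi ‖z - z₀‖).indicator (fun _ => (1 : ℝ)) ρ

theorem intervalIntegrable_indicator_one (t a b : ℝ) :
    IntervalIntegrable ((Set.Ioi t).indicator (fun _ => (1 : ℝ))) volume a b := by
  rw [intervalIntegrable_iff]
  exact (integrableOn_const (by simp)).indicator measurableSet_Ioi

theorem ramp_nonneg {r : ℝ} (hr : 0 < r) (z₀ z : ℂ) : 0 ≤ ramp z₀ r z := by
  refine mul_nonneg (inv_nonneg.2 hr.le) (intervalIntegral.integral_nonneg (by linarith) ?_)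
  exact fun ρ _ => Set.indicator_nonneg (fun _ _ => zero_le_one) ρ

theorem ramp_le_one {r : ℝ} (hr : 0 < r) (z₀ z : ℂ) : ramp z₀ r z ≤ 1 := by
  have h : ∫ ρ in r..(2 * r), (Set.Ioi ‖z - z₀‖).indicator (fun _ => (1 : ℝ)) ρ
      ≤ ∫ ρ in r..(2 * r), (1 : ℝ) :=
    intervalIntegral.integral_mono_on (by linarith) (intervalIntegrable_indicator_one _ _ _)
      (by simp) fun ρ _ => Set.indicator_le_self' (fun _ _ => zero_le_one) ρ
  rw [intervalIntegral.integral_const, smul_eq_mul, mul_one] at h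
  rw [ramp, inv_mul_le_iff₀ hr]
  linarith

theorem ramp_eq_one {r : ℝ} (hr : 0 < r) {z₀ z : ℂ} (hz : ‖z - z₀‖ ≤ r) : ramp z₀ r z = 1 := by
  have h : ∫ ρ in r..(2 * r), (Set.Ioi ‖z - z₀‖).indicator (fun _ => (1 : ℝ)) ρ
      = ∫ ρ in r..(2 * r), (1 : ℝ) := by
    refine intervalIntegral.integral_congr_ae (ae_of_all _ fun ρ hρ => ?_)
    rw [Set.uIoc_of_le (by linarith)] at hρ
    exact Set.indicator_of_mem (lt_of_le_of_lt hz hρ.1) _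
  rw [ramp, h, intervalIntegral.integral_const, smul_eq_mul, mul_one]
  field_simp
  ring

theorem ramp_eq_zero {r : ℝ} (hr : 0 < r) {z₀ z : ℂ} (hz : 2 * r ≤ ‖z - z₀‖) :
    ramp z₀ r z = 0 := by
  have h : ∫ ρ in r..(2 * r), (Set.Ioi ‖z - z₀‖).indicator (fun _ => (1 : ℝ)) ρ
      = ∫ ρ in r..(2 * r), (0 : ℝ) := by
    refine intervalIntegral.integral_congr_ae (ae_of_all _ fun ρ hρ => ?_)
    rw [Set.uIoc_of_le (by linarith)] at hρ
    exact Set.indicator_of_notMem (fun hm => by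
      have : ‖z - z₀‖ < ρ := hm
      linarith [hρ.2]) _
  rw [ramp, h]
  simp

/-- Cauchy's formula inside the circle, and its vanishing outside. -/
theorem circleAverage_cauchy {g : ℂ → ℂ} (hg : Differentiable ℂ g) {z₀ z : ℂ} {ρ : ℝ} (hρ : 0 < ρ)
    (hne : ρ ≠ ‖z - z₀‖) :
    Real.circleAverage (fun ζ => ((ζ - z₀) / (ζ - z)) • g ζ) z₀ ρ
      = (Set.Ioi ‖z - z₀‖).indicator (fun _ => (1 : ℝ)) ρ • g z := by
  rcases lt_or_gt_of_ne hne with h | h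
  · rw [Set.indicator_of_notMem (fun hm => absurd (Set.mem_Ioi.1 hm) (not_lt.2 h.le)), zero_smul]
    have hd : DiffContOnCl ℂ (fun ζ => ((ζ - z₀) / (ζ - z)) • g ζ) (Metric.ball z₀ |ρ|) := by
      refine DifferentiableOn.diffContOnCl ?_
      intro ζ hζ
      have hζ' : ‖ζ - z₀‖ ≤ ρ := by
        have := Metric.closure_ball_subset_closedBall hζ
        simpa [dist_eq_norm, abs_of_pos hρ] using this
      have hne : ζ - z ≠ 0 := by
        intro h0
        rw [sub_eq_zero.1 h0] at hζ'
        linarith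
      exact ((((differentiableAt_id).sub_const z₀).div ((differentiableAt_id).sub_const z)
        hne).smul (hg ζ)).differentiableWithinAt
    rw [hd.circleAverage]
    simp
  · rw [Set.indicator_of_mem (by exact h), one_smul]
    refine (hg.diffContOnCl).circleAverage_smul_div ?_
    simpa [dist_eq_norm, abs_of_pos hρ] using h

/-- The weight `(ζ - z₀) / (2πr |ζ - z₀|)`, for which the area integral over the annulus is the mean
of the Cauchy integrals over the circles of radius between `r` and `2r`. -/
def cauchyWeight (z₀ : ℂ) (r : ℝ) (ζ : ℂ) : ℂ := ((2 * Real.pi * r * ‖ζ - z₀‖)⁻¹ : ℝ) * (ζ - z₀)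

theorem norm_cauchyWeight_le {r : ℝ} (hr : 0 < r) (z₀ ζ : ℂ) :
    ‖cauchyWeight z₀ r ζ‖ ≤ (2 * Real.pi * r)⁻¹ := by
  have hpi := Real.pi_pos
  rw [cauchyWeight, norm_mul, Complex.norm_real, Real.norm_of_nonneg (by positivity)]
  rcases eq_or_ne ζ z₀ with rfl | h
  · simp; positivity
  · have : 0 < ‖ζ - z₀‖ := norm_pos_iff.2 (sub_ne_zero.2 h)
    refine le_of_eq ?_
    field_simp

theorem integrableOn_div_sub {S : Set ℂ} (hSm : MeasurableSet S) (hS : volume S ≠ ⊤) {f : ℂ → ℂ}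
    (hf : AEStronglyMeasurable f (volume.restrict S)) {B : ℝ} (hB : ∀ ζ ∈ S, ‖f ζ‖ ≤ B) (z : ℂ) :
    IntegrableOn (fun ζ => f ζ / (ζ - z)) S := by
  obtain ⟨C, -, hC⟩ := exists_integral_inv_dist_le S hS
  refine ((hC z).1.const_mul B).mono' (hf.div₀ (by fun_prop)) ?_
  filter_upwards [ae_restrict_mem hSm] with ζ hζ
  rw [norm_div, div_eq_mul_inv]
  gcongr
  exact hB ζ hζ

/-- Averaging Cauchy's formula over the radii of the annulus reproduces the cut-off function. -/
theorem integral_cauchyWeight {g : ℂ → ℂ} (hg : Differentiable ℂ g) {r : ℝ} (hr : 0 < r)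
    (z₀ z : ℂ) :
    ∫ ζ in annulus z₀ r, (cauchyWeight z₀ r ζ * g ζ) / (ζ - z) = ramp z₀ r z * g z := by
  have hpi := Real.pi_pos
  have hgc := hg.continuous
  have hm : Measurable fun ζ => (cauchyWeight z₀ r ζ * g ζ) / (ζ - z) := by
    unfold cauchyWeight
    have := hgc.measurable
    fun_prop
  obtain ⟨B, hB⟩ := IsCompact.exists_bound_of_continuousOn (isCompact_closedBall z₀ (2 * r))
    hgc.continuousOn
  have hint : IntegrableOn (fun ζ => (cauchyWeight z₀ r ζ * g ζ) / (ζ - z)) (annulus z₀ r) := by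
    refine integrableOn_div_sub (measurableSet_annulus _ _) (volume_annulus_ne_top _ _)
      (B := (2 * Real.pi * r)⁻¹ * B) ?_ ?_ z
    · unfold cauchyWeight
      have := hgc.measurable
      exact Measurable.aestronglyMeasurable (by fun_prop)
    · intro ζ hζ
      rw [norm_mul]
      exact mul_le_mul (norm_cauchyWeight_le hr _ _) (hB ζ (annulus_subset_closedBall _ _ hζ))
        (norm_nonneg _) (by positivity)
  have := (annulus_polar hm.stronglyMeasurable z₀ hr.le (by linarith : r ≤ 2 * r) hint).2
  rw [annulus, this]
  have hae : ∀ᵐ ρ : ℝ, ρ ∈ Set.uIoc r (2 * r) →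
      (2 * Real.pi * ρ) • Real.circleAverage (fun ζ => (cauchyWeight z₀ r ζ * g ζ) / (ζ - z)) z₀ ρ
        = (r⁻¹ * (Set.Ioi ‖z - z₀‖).indicator (fun _ => (1 : ℝ)) ρ) • g z := by
    have h0 : ∀ᵐ ρ : ℝ, ρ ≠ ‖z - z₀‖ := by simp [ae_iff]
    filter_upwards [h0] with ρ hne hρ
    rw [Set.uIoc_of_le (by linarith)] at hρ
    have hρ0 : 0 < ρ := hr.trans hρ.1
    have e : Real.circleAverage (fun ζ => (cauchyWeight z₀ r ζ * g ζ) / (ζ - z)) z₀ ρ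
        = Real.circleAverage (fun ζ => (2 * Real.pi * r * ρ)⁻¹ • (((ζ - z₀) / (ζ - z)) • g ζ))
          z₀ ρ := by
      refine Real.circleAverage_congr_sphere fun ζ hζ => ?_
      have hζ' : ‖ζ - z₀‖ = ρ := by simpa [dist_eq_norm, abs_of_pos hρ0] using hζ
      simp only [cauchyWeight, hζ', smul_eq_mul, Complex.real_smul, Complex.ofReal_inv]
      ring
    rw [e, Real.circleAverage_fun_smul, circleAverage_cauchy hg hρ0 hne, smul_smul, smul_smul]
    congr 1
    field_simp
  rw [intervalIntegral.integral_congr_ae hae, intervalIntegral.integral_smul_const,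
    intervalIntegral.integral_const_mul, ramp, Complex.real_smul]

/-- An integral of divided differences of a polynomial is a polynomial of no larger degree. The
quotient has the junk value `0` on the diagonal, which is a null set. -/
theorem exists_polynomial_integral_dividedDifference {S : Set ℂ}
    {T : Set ℂ} (hT : IsCompact T) (hST : S ⊆ T) {a : ℂ → ℂ} (ha : ContinuousOn a T) (P : ℂ[X]) :
    ∃ p : ℂ[X], p.natDegree ≤ P.natDegree ∧ ∀ z,
      IntegrableOn (fun ζ => a ζ * ((P.eval z - P.eval ζ) / (z - ζ))) S ∧
      p.eval z = ∫ ζ in S, a ζ * ((P.eval z - P.eval ζ) / (z - ζ)) := by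
  have hi : ∀ k : ℕ, IntegrableOn (fun ζ => a ζ * ζ ^ k) S := fun k =>
    ((ha.mul (continuous_pow k).continuousOn).integrableOn_compact hT).mono_set hST
  refine ⟨∑ m ∈ Finset.range (P.natDegree + 1), ∑ i ∈ Finset.range m,
    Polynomial.C (P.coeff m * ∫ ζ in S, a ζ * ζ ^ (m - 1 - i)) * Polynomial.X ^ i, ?_, fun z => ?_⟩
  · refine Polynomial.natDegree_sum_le_of_forall_le _ _ fun m hm => ?_
    refine Polynomial.natDegree_sum_le_of_forall_le _ _ fun i hi => ?_
    refine (Polynomial.natDegree_C_mul_X_pow_le _ _).trans ?_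
    rw [Finset.mem_range] at hm hi
    omega
  have hae : (fun ζ => ∑ m ∈ Finset.range (P.natDegree + 1), ∑ i ∈ Finset.range m,
      (P.coeff m * z ^ i) * (a ζ * ζ ^ (m - 1 - i)))
      =ᵐ[volume.restrict S] fun ζ => a ζ * ((P.eval z - P.eval ζ) / (z - ζ)) := by
    have h0 : ∀ᵐ ζ : ℂ, ζ ≠ z := by simp [ae_iff]
    filter_upwards [ae_restrict_of_ae h0] with ζ hζ
    have hne : z - ζ ≠ 0 := sub_ne_zero.2 hζ.symm
    rw [mul_div_assoc', eq_div_iff hne, Polynomial.eval_eq_sum_range, Polynomial.eval_eq_sum_range,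
      ← Finset.sum_sub_distrib, Finset.sum_mul, Finset.mul_sum]
    refine Finset.sum_congr rfl fun m _ => ?_
    rw [← mul_sub, ← geom_sum₂_mul, Finset.sum_mul, Finset.sum_mul, Finset.mul_sum, Finset.mul_sum]
    refine Finset.sum_congr rfl fun i _ => ?_
    ring
  have hint : ∀ m ∈ Finset.range (P.natDegree + 1), ∀ i ∈ Finset.range m,
      IntegrableOn (fun ζ => (P.coeff m * z ^ i) * (a ζ * ζ ^ (m - 1 - i))) S :=
    fun m _ i _ => (hi _).const_mul _
  constructor
  · refine Integrable.congr ?_ hae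
    exact integrable_finsetSum _ fun m hm => integrable_finsetSum _ fun i hi => hint m hm i hi
  · rw [← integral_congr_ae hae, integral_finsetSum _ fun m hm =>
      integrable_finsetSum _ fun i hi => hint m hm i hi, Polynomial.eval_finsetSum]
    refine Finset.sum_congr rfl fun m hm => ?_
    rw [integral_finsetSum _ fun i hi => hint m hm i hi, Polynomial.eval_finsetSum]
    refine Finset.sum_congr rfl fun i _ => ?_
    rw [integral_const_mul]
    simp
    ring

/-- A cut-off entire function is approximated by a polynomial: the Cauchy kernel `1 / (ζ - z)` is
replaced by `(1 - E_ζ(z)) / (ζ - z)`, where `E_ζ` is a combination of the `F j` with `E_ζ(ζ) = 1`.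
This is a polynomial in `z`, and the error is the integral of `E_ζ(z) / (ζ - z)`. -/
theorem exists_polynomial_approx {n : ℕ} {F : Fin (n + 1) → ℂ[X]}
    (hF : ∀ j, (F j).natDegree ≤ n) {g : ℂ → ℂ} (hg : Differentiable ℂ g) {z₀ : ℂ} {r : ℝ}
    (hr : 0 < r) (hpos : ∀ ζ : ℂ, r ≤ ‖ζ - z₀‖ → ‖ζ - z₀‖ ≤ 2 * r → ∃ j, (F j).eval ζ ≠ 0) :
    ∃ p : ℂ[X], p.natDegree ≤ n ∧ ∀ (z : ℂ) (B : ℝ),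
      (∀ ζ ∈ annulus z₀ r, ‖g ζ‖ * ∑ j, ‖(F j).eval ζ‖ * ‖(F j).eval z‖
        ≤ B * ∑ j, ‖(F j).eval ζ‖ ^ 2) →
      ‖p.eval z - ramp z₀ r z * g z‖
        ≤ (2 * Real.pi * r)⁻¹ * B * ∫ ζ in annulus z₀ r, ‖ζ - z‖⁻¹ := by
  have hpi := Real.pi_pos
  have hgc := hg.continuous
  set T : Set ℂ := {ζ | r ≤ ‖ζ - z₀‖ ∧ ‖ζ - z₀‖ ≤ 2 * r} with hT
  have hTc : IsCompact T := by
    refine (isCompact_closedBall z₀ (2 * r)).of_isClosed_subset ?_ ?_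
    · have h1 : IsClosed {z : ℂ | r ≤ ‖z - z₀‖} := isClosed_le continuous_const (by fun_prop)
      have h2 : IsClosed {z : ℂ | ‖z - z₀‖ ≤ 2 * r} := isClosed_le (by fun_prop) continuous_const
      exact h1.inter h2
    · intro ζ hζ
      simpa [dist_eq_norm] using hζ.2
  have hAT : annulus z₀ r ⊆ T := fun ζ hζ => ⟨hζ.1.le, hζ.2⟩
  set S : ℂ → ℝ := fun ζ => ∑ j, ‖(F j).eval ζ‖ ^ 2 with hS
  have hSpos : ∀ ζ ∈ T, 0 < S ζ := by
    intro ζ hζ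
    obtain ⟨j, hj⟩ := hpos ζ hζ.1 hζ.2
    refine Finset.sum_pos' (fun i _ => by positivity) ⟨j, Finset.mem_univ j, ?_⟩
    have := norm_pos_iff.2 hj
    positivity
  have hev : ∀ P : ℂ[X], Continuous fun ζ : ℂ => P.eval ζ := fun P => P.continuous
  have hSc : Continuous S := by
    rw [hS]
    exact continuous_finsetSum _ fun j _ => ((hev (F j)).norm.pow 2)
  -- The coefficients of `E_ζ` in the `F j`, chosen with least `ℓ²` norm.
  set b : Fin (n + 1) → ℂ → ℂ := fun j ζ => conj ((F j).eval ζ) / (S ζ : ℂ) with hb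
  have hbc : ∀ j, ContinuousOn (b j) T := by
    intro j
    refine ContinuousOn.div (Complex.continuous_conj.comp (hev (F j))).continuousOn
      (Complex.continuous_ofReal.comp hSc).continuousOn fun ζ hζ => ?_
    exact_mod_cast (hSpos ζ hζ).ne'
  have hb1 : ∀ ζ ∈ T, ∑ j, b j ζ * (F j).eval ζ = 1 := by
    intro ζ hζ
    have h0 : (S ζ : ℂ) ≠ 0 := by exact_mod_cast (hSpos ζ hζ).ne'
    have h1 : ∀ j, b j ζ * (F j).eval ζ = ((‖(F j).eval ζ‖ ^ 2 : ℝ) : ℂ) / S ζ := by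
      intro j
      simp only [hb]
      rw [div_mul_eq_mul_div, Complex.conj_mul']
      push_cast
      ring
    simp only [h1]
    rw [← Finset.sum_div, ← Complex.ofReal_sum, div_self h0]
  have hwc : ContinuousOn (fun ζ => cauchyWeight z₀ r ζ * g ζ) T := by
    unfold cauchyWeight
    refine ContinuousOn.mul (ContinuousOn.mul (Complex.continuous_ofReal.comp_continuousOn
      (ContinuousOn.inv₀ (by fun_prop) ?_)) (by fun_prop)) hgc.continuousOn
    intro ζ hζ
    have : 0 < ‖ζ - z₀‖ := hr.trans_le hζ.1
    positivity
  choose q hqd hq using fun j => exists_polynomial_integral_dividedDifference hTc hAT (hwc.mul (hbc j)) (F j)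
  refine ⟨∑ j, q j, Polynomial.natDegree_sum_le_of_forall_le _ _
    fun j _ => (hqd j).trans (hF j), fun z B hB => ?_⟩
  set E : ℂ → ℂ := fun ζ => ∑ j, b j ζ * (F j).eval z with hE
  have hEc : ContinuousOn E T :=
    continuousOn_finsetSum _ fun j _ => (hbc j).mul continuousOn_const
  have hint : ∀ f : ℂ → ℂ, ContinuousOn f T →
      IntegrableOn (fun ζ => f ζ / (ζ - z)) (annulus z₀ r) := by
    intro f hf
    obtain ⟨D, hD⟩ := IsCompact.exists_bound_of_continuousOn hTc hf
    exact integrableOn_div_sub (measurableSet_annulus _ _) (volume_annulus_ne_top _ _)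
      ((hf.mono hAT).aestronglyMeasurable (measurableSet_annulus _ _))
      (fun ζ hζ => hD ζ (hAT hζ)) z
  have hsum : (∑ j, q j).eval z = ramp z₀ r z * g z
      - ∫ ζ in annulus z₀ r, (cauchyWeight z₀ r ζ * g ζ * E ζ) / (ζ - z) := by
    rw [← integral_cauchyWeight hg hr, ← integral_sub (hint _ hwc)
      (hint (fun ζ => cauchyWeight z₀ r ζ * g ζ * E ζ) (hwc.mul hEc)),
      Polynomial.eval_finsetSum]
    rw [Finset.sum_congr rfl fun j _ => (hq j z).2, ← integral_finsetSum _ fun j _ => (hq j z).1]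
    refine setIntegral_congr_fun (measurableSet_annulus _ _) fun ζ hζ => ?_
    have h1 := hb1 ζ (hAT hζ)
    have h2 : ∀ j, cauchyWeight z₀ r ζ * g ζ * b j ζ * (((F j).eval z - (F j).eval ζ) / (z - ζ))
        = cauchyWeight z₀ r ζ * g ζ / (ζ - z) *
          (b j ζ * (F j).eval ζ - b j ζ * (F j).eval z) := by
      intro j
      rw [← neg_sub ζ z, ← neg_sub ((F j).eval ζ) _, neg_div_neg_eq]
      ring
    simp only [Pi.mul_apply, h2]
    rw [← Finset.mul_sum, Finset.sum_sub_distrib, h1]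
    simp only [hE]
    ring
  rw [hsum, sub_sub_cancel_left, norm_neg]
  obtain ⟨_, _, hC⟩ := exists_integral_inv_dist_le _ (volume_annulus_ne_top z₀ r)
  rw [← integral_const_mul]
  refine norm_integral_le_of_norm_le ((hC z).1.const_mul _) ?_
  filter_upwards [ae_restrict_mem (measurableSet_annulus z₀ r)] with ζ hζ
  rw [norm_div, div_eq_mul_inv, mul_assoc (cauchyWeight _ _ _), norm_mul (cauchyWeight _ _ _)]
  have hS0 := hSpos ζ (hAT hζ)
  have h3 : ‖g ζ * E ζ‖ ≤ B := by
    have h4 : ‖E ζ‖ ≤ (∑ j, ‖(F j).eval ζ‖ * ‖(F j).eval z‖) / S ζ := by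
      rw [Finset.sum_div]
      refine (norm_sum_le _ _).trans (Finset.sum_le_sum fun j _ => le_of_eq ?_)
      simp only [hb, norm_mul, norm_div, Complex.norm_conj, Complex.norm_real,
        Real.norm_of_nonneg hS0.le]
      ring
    rw [norm_mul]
    calc ‖g ζ‖ * ‖E ζ‖ ≤ ‖g ζ‖ * ((∑ j, ‖(F j).eval ζ‖ * ‖(F j).eval z‖) / S ζ) := by gcongr
      _ ≤ B := by
        rw [mul_div_assoc', div_le_iff₀ hS0]
        exact hB ζ hζ
  have h5 := norm_cauchyWeight_le hr z₀ ζ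
  gcongr

/-! ### The upper bound for weighted jets -/

/-- The squared norm of `L²(e^{-2nφ})`. -/
def weightedNormSq (φ : ℂ → ℝ) (n : ℕ) (f : ℂ → ℂ) : ℝ :=
  ∫ z, ‖f z‖ ^ 2 * Real.exp (-2 * n * φ z)

/-- The Taylor coefficient of order `k` at `z` of `f e^{-nH}`, where `H` is holomorphic with
`H(z) = φ(z)` and `H'(z) = 2 ∂φ/∂z`. Only `k = 0` and `k = 1` are meaningful; larger `k` give the
same value as `k = 1`. -/
def jet (φ : ℂ → ℝ) (n : ℕ) (z : ℂ) (k : ℕ) (f : ℂ → ℂ) : ℂ :=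
  (if k = 0 then f z else deriv f z - 2 * n * wirtingerDeriv φ z * f z) *
    (Real.exp (-(n * φ z)) : ℂ)

theorem jet_add {φ : ℂ → ℝ} {n : ℕ} {z : ℂ} (k : ℕ) {f g : ℂ → ℂ} (hf : DifferentiableAt ℂ f z)
    (hg : DifferentiableAt ℂ g z) :
    jet φ n z k (fun w => f w + g w) = jet φ n z k f + jet φ n z k g := by
  unfold jet
  split_ifs
  · ring
  · rw [deriv_fun_add hf hg]; ring

/-- The holomorphic quadratic polynomial with real part `φ(z) + dφ(w) + Re (b w²)`. -/
def holoTaylor (φ : ℂ → ℝ) (z b w : ℂ) : ℂ := φ z + (2 * wirtingerDeriv φ z * w + b * w ^ 2)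

theorem hasDerivAt_exp_holoTaylor (φ : ℂ → ℝ) (z b : ℂ) (t : ℂ) :
    HasDerivAt (fun w => Complex.exp (t * holoTaylor φ z b w))
      (Complex.exp (t * φ z) * (t * (2 * wirtingerDeriv φ z))) 0 := by
  have h1 : HasDerivAt (fun w : ℂ => t * holoTaylor φ z b w) (t * (2 * wirtingerDeriv φ z)) 0 := by
    unfold holoTaylor
    have h2 : HasDerivAt (fun w : ℂ => 2 * wirtingerDeriv φ z * w) (2 * wirtingerDeriv φ z) 0 := by
      simpa using (hasDerivAt_id (0 : ℂ)).const_mul (2 * wirtingerDeriv φ z)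
    have h3 : HasDerivAt (fun w : ℂ => b * w ^ 2) 0 0 := by
      simpa using (hasDerivAt_pow 2 (0 : ℂ)).const_mul b
    simpa using ((h2.add h3).const_add (φ z : ℂ)).const_mul t
  simpa [holoTaylor] using h1.cexp

theorem differentiable_exp_holoTaylor (φ : ℂ → ℝ) (z b : ℂ) (t : ℂ) :
    Differentiable ℂ (fun w => Complex.exp (t * holoTaylor φ z b w)) := by
  unfold holoTaylor
  fun_prop

theorem norm_exp_holoTaylor (φ : ℂ → ℝ) (z b w : ℂ) (t : ℝ) :
    ‖Complex.exp (t * holoTaylor φ z b w)‖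
      = Real.exp (t * (φ z + (2 * wirtingerDeriv φ z * w + b * w ^ 2)).re) := by
  rw [Complex.norm_exp, Complex.re_ofReal_mul, holoTaylor]

theorem exists_forall_one_add_mul_exp_neg_le {η : ℝ} (hη : 0 < η) :
    ∃ T : ℝ, 0 < T ∧ ∀ t, T ≤ t → (1 + t) * Real.exp (-t) ≤ η := by
  have h1 := Real.tendsto_pow_mul_exp_neg_atTop_nhds_zero 1
  have h0 := Real.tendsto_pow_mul_exp_neg_atTop_nhds_zero 0
  have h : Tendsto (fun t : ℝ => (1 + t) * Real.exp (-t)) atTop (𝓝 0) := by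
    have := h0.add h1
    simp only [add_zero, pow_zero, pow_one] at this
    refine this.congr fun t => by ring
  obtain ⟨T, hT⟩ := eventually_atTop.1 (h.eventually (eventually_le_nhds hη))
  exact ⟨max T 1, by positivity, fun t ht => hT t ((le_max_left _ _).trans ht)⟩

/-- The weighted jets of an entire function are bounded by its weighted `L²` norm on a disc where
`φ` lies below a holomorphic quadratic polynomial plus `a / (2n) * |w|²`. -/
theorem jet_le_local {φ : ℂ → ℝ} (hφ : Continuous φ) {z b : ℂ} {n : ℕ} {a r : ℝ} (ha : 0 < a)
    (hr : 0 ≤ r)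
    (hT : ∀ w : ℂ, ‖w‖ ≤ r → n * (φ (z + w) - (φ z + (2 * wirtingerDeriv φ z * w + b * w ^ 2)).re)
      ≤ a / 2 * ‖w‖ ^ 2) {f : ℂ → ℂ} (hf : Differentiable ℂ f) :
    ‖jet φ n z 0 f‖ ^ 2 * (Real.pi / a * (1 - Real.exp (-a * r ^ 2)))
      + ‖jet φ n z 1 f‖ ^ 2 * (Real.pi / a ^ 2 * (1 - (1 + a * r ^ 2) * Real.exp (-a * r ^ 2)))
      ≤ ∫ w in Metric.closedBall z r, ‖f w‖ ^ 2 * Real.exp (-2 * n * φ w) := by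
  set q : ℂ → ℂ := fun w => f (z + w) * Complex.exp (((-n : ℝ) : ℂ) * holoTaylor φ z b w) with hq
  have hfz : Differentiable ℂ fun w => f (z + w) :=
    hf.comp ((differentiable_const z).add differentiable_id)
  have hqd : Differentiable ℂ q := hfz.mul (differentiable_exp_holoTaylor φ z b _)
  have hexp : Complex.exp (((-n : ℝ) : ℂ) * φ z) = (Real.exp (-(n * φ z)) : ℂ) := by
    push_cast; congr 1; ring
  have hq0 : q 0 = jet φ n z 0 f := by
    simp only [hq, jet, if_true, add_zero]
    rw [← hexp]
    simp [holoTaylor]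
  have hq1 : deriv q 0 = jet φ n z 1 f := by
    have h1 : HasDerivAt (fun w => f (z + w)) (deriv f z) 0 := by
      have : HasDerivAt f (deriv f z) (z + 0) := by
        rw [add_zero]; exact (hf z).hasDerivAt
      simpa using this.comp_const_add z 0
    have := (h1.mul (hasDerivAt_exp_holoTaylor φ z b ((-n : ℝ) : ℂ))).deriv
    have e : deriv q 0 = _ := this
    rw [e, hexp, jet, if_neg one_ne_zero]
    have h2 : Complex.exp (((-n : ℝ) : ℂ) * holoTaylor φ z b 0) = (Real.exp (-(n * φ z)) : ℂ) := by
      rw [← hexp]; simp [holoTaylor]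
    rw [h2]
    simp only [add_zero]
    push_cast
    ring
  rw [← hq0, ← hq1]
  refine (jet_le_gauss_integral hqd ha hr).trans ?_
  have hpre : (fun w => z + w) ⁻¹' Metric.closedBall z r = Metric.closedBall 0 r := by
    ext w; simp
  have htr := (measurePreserving_add_left (volume : Measure ℂ) z).setIntegral_preimage_emb
    (measurableEmbedding_addLeft z) (fun w => ‖f w‖ ^ 2 * Real.exp (-2 * n * φ w))
    (Metric.closedBall z r)
  rw [hpre] at htr
  rw [← htr]
  have hqc := hqd.continuous
  have hfc := hf.continuous
  refine setIntegral_mono_on ?_ ?_ measurableSet_closedBall fun w hw => ?_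
  · exact ContinuousOn.integrableOn_compact (isCompact_closedBall _ _) (by fun_prop)
  · exact ContinuousOn.integrableOn_compact (isCompact_closedBall _ _) (by fun_prop)
  · have hw' : ‖w‖ ≤ r := by simpa using hw
    have h1 := hT w hw'
    simp only [hq, norm_mul, mul_pow, norm_exp_holoTaylor]
    rw [mul_assoc]
    refine mul_le_mul_of_nonneg_left ?_ (by positivity)
    rw [← Real.exp_nat_mul, ← Real.exp_add]
    refine Real.exp_le_exp.2 ?_
    push_cast
    linarith

theorem exists_laplacian_bounds {φ : ℂ → ℝ} (hφ : ContDiff ℝ 2 φ) {K : Set ℂ} (hK : IsCompact K)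
    (hpos : ∀ z ∈ K, 0 < Laplacian.laplacian φ z) :
    ∃ m > 0, ∃ M > 0, ∀ z ∈ K, m ≤ Laplacian.laplacian φ z / 2 ∧ Laplacian.laplacian φ z / 2 ≤ M := by
  have hc := (continuous_laplacian hφ).div_const 2
  rcases K.eq_empty_or_nonempty with rfl | hne
  · exact ⟨1, one_pos, 1, one_pos, fun z hz => absurd hz (Set.notMem_empty z)⟩
  obtain ⟨x, hx, hmin⟩ := hK.exists_isMinOn hne hc.continuousOn
  obtain ⟨y, hy, hmax⟩ := hK.exists_isMaxOn hne hc.continuousOn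
  exact ⟨_, half_pos (hpos x hx), _, half_pos (hpos y hy), fun z hz =>
    ⟨isMinOn_iff.1 hmin z hz, isMaxOn_iff.1 hmax z hz⟩⟩

/-- Sharp upper bound for the weighted jets by the weighted `L²` norm on a small disc, uniformly on
compact sets where `Δφ > 0`. -/
theorem exists_jet_upper {φ : ℂ → ℝ} (hφ : ContDiff ℝ 2 φ) {K : Set ℂ} (hK : IsCompact K)
    (hpos : ∀ z ∈ K, 0 < Laplacian.laplacian φ z) {δ r₁ : ℝ} (hδ : 0 < δ) (hr₁ : 0 < r₁) :
    ∃ r > 0, r ≤ r₁ ∧ ∃ N : ℕ, 1 ≤ N ∧ ∀ n ≥ N, ∀ z ∈ K, ∀ f : ℂ → ℂ, Differentiable ℂ f →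
      ‖jet φ n z 0 f‖ ^ 2 * (Real.pi / (Laplacian.laplacian φ z / 2 * n))
        + ‖jet φ n z 1 f‖ ^ 2 * (Real.pi / (Laplacian.laplacian φ z / 2 * n) ^ 2)
      ≤ (1 + δ) * ∫ w in Metric.closedBall z r, ‖f w‖ ^ 2 * Real.exp (-2 * n * φ w) := by
  obtain ⟨m, hm, M, -, hb⟩ := exists_laplacian_bounds hφ hK hpos
  set θ := min 1 (δ / 6) with hθ
  have hθ0 : 0 < θ := by positivity
  have hθ1 : θ ≤ 1 := min_le_left _ _
  have hθδ : θ ≤ δ / 6 := min_le_right _ _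
  obtain ⟨r₂, hr₂, htay⟩ := uniform_taylor hφ hK (κ := θ * m / 2) (by positivity)
  set r := min r₁ r₂ with hr
  have hr0 : 0 < r := by positivity
  obtain ⟨T, hT0, hT⟩ := exists_forall_one_add_mul_exp_neg_le
    (η := δ / 2 / (1 + δ)) (by positivity)
  obtain ⟨N, hN⟩ := exists_nat_ge (T / (m * r ^ 2))
  refine ⟨r, hr0, min_le_left _ _, max N 1, le_max_right _ _, fun n hn z hz f hf => ?_⟩
  have hn1 : (1 : ℝ) ≤ n := by exact_mod_cast (le_max_right _ _).trans hn
  have hnN : (N : ℝ) ≤ n := by exact_mod_cast (le_max_left _ _).trans hn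
  have hn0 : (0 : ℝ) < n := by linarith
  set c := Laplacian.laplacian φ z / 2 with hc
  obtain ⟨hmc, -⟩ := hb z hz
  have hc0 : 0 < c := hm.trans_le hmc
  obtain ⟨b, hbt⟩ := htay z hz
  -- The Gaussian rate `n Δφ / 2`, enlarged by a factor `1 + θ` to absorb the Taylor error.
  set a := n * (c * (1 + θ)) with ha
  have ha0 : 0 < a := by positivity
  have hloc := jet_le_local hφ.continuous (z := z) (b := b) (n := n) (a := a) (r := r) ha0 hr0.le
    (fun w hw => by
      have h1 := (abs_le.1 (hbt w (hw.trans (min_le_right _ _)))).2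
      have h2 : φ (z + w) - (φ z + (2 * wirtingerDeriv φ z * w + b * w ^ 2)).re
          ≤ c * (1 + θ) / 2 * ‖w‖ ^ 2 := by
        have h3 : θ * m / 2 * ‖w‖ ^ 2 ≤ θ * c / 2 * ‖w‖ ^ 2 := by gcongr
        have h4 : Laplacian.laplacian φ z / 4 = c / 2 := by rw [hc]; ring
        rw [h4] at h1
        linarith
      calc _ ≤ n * (c * (1 + θ) / 2 * ‖w‖ ^ 2) := by gcongr
        _ = _ := by rw [ha]; ring) hf
  set I := ∫ w in Metric.closedBall z r, ‖f w‖ ^ 2 * Real.exp (-2 * n * φ w) with hI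
  have hTa : T ≤ a * r ^ 2 := by
    have h1 : T ≤ n * (m * r ^ 2) := by
      have := hN.trans hnN
      rwa [div_le_iff₀ (by positivity)] at this
    have h2 : n * (m * r ^ 2) ≤ a * r ^ 2 := by
      rw [ha]
      have h3 : m ≤ c * (1 + θ) := by nlinarith
      have : n * (m * r ^ 2) ≤ n * (c * (1 + θ) * r ^ 2) := by gcongr
      linarith
    linarith
  have hE := hT _ hTa
  set E := (1 + a * r ^ 2) * Real.exp (-(a * r ^ 2)) with hEdef
  have hE1 : Real.exp (-(a * r ^ 2)) ≤ E := by
    rw [hEdef]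
    have : 0 ≤ a * r ^ 2 * Real.exp (-(a * r ^ 2)) := by positivity
    linarith
  have hpi := Real.pi_pos
  have hkey : (1 + θ) ^ 2 ≤ (1 + δ) * (1 - E) := by
    have h1 : (1 + δ) * E ≤ δ / 2 := by
      calc (1 + δ) * E ≤ (1 + δ) * (δ / 2 / (1 + δ)) := by gcongr
        _ = δ / 2 := by field_simp
    nlinarith
  have hkey1 : 1 + θ ≤ (1 + δ) * (1 - E) := by nlinarith
  have h0 : Real.pi / (c * n) ≤ (1 + δ) * (Real.pi / a * (1 - Real.exp (-a * r ^ 2))) := by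
    have e : Real.pi / (c * n) = Real.pi / a * (1 + θ) := by rw [ha]; field_simp
    rw [e, mul_left_comm]
    refine mul_le_mul_of_nonneg_left (hkey1.trans ?_) (by positivity)
    rw [neg_mul]
    gcongr
  have h1 : Real.pi / (c * n) ^ 2
      ≤ (1 + δ) * (Real.pi / a ^ 2 * (1 - (1 + a * r ^ 2) * Real.exp (-a * r ^ 2))) := by
    have e : Real.pi / (c * n) ^ 2 = Real.pi / a ^ 2 * (1 + θ) ^ 2 := by rw [ha]; field_simp
    rw [e, mul_left_comm]
    refine mul_le_mul_of_nonneg_left (hkey.trans ?_) (by positivity)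
    rw [neg_mul]
  calc _ ≤ ‖jet φ n z 0 f‖ ^ 2 * ((1 + δ) * (Real.pi / a * (1 - Real.exp (-a * r ^ 2))))
        + ‖jet φ n z 1 f‖ ^ 2 * ((1 + δ) * (Real.pi / a ^ 2 *
          (1 - (1 + a * r ^ 2) * Real.exp (-a * r ^ 2)))) := by gcongr
    _ = (1 + δ) * (‖jet φ n z 0 f‖ ^ 2 * (Real.pi / a * (1 - Real.exp (-a * r ^ 2)))
      + ‖jet φ n z 1 f‖ ^ 2 * (Real.pi / a ^ 2 *
        (1 - (1 + a * r ^ 2) * Real.exp (-a * r ^ 2)))) := by ring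
    _ ≤ _ := by gcongr

/-! ### The lower bound for weighted jets -/

/-- The entire function `(ζ - z)^k e^{nH(ζ - z)}` with `H` the holomorphic Taylor polynomial
`holoTaylor φ z b`: its weighted modulus is nearly a Gaussian centred at `z`. -/
def peakSection (φ : ℂ → ℝ) (n : ℕ) (z b : ℂ) (k : ℕ) (ζ : ℂ) : ℂ :=
  (ζ - z) ^ k * Complex.exp ((n : ℝ) * holoTaylor φ z b (ζ - z))

theorem differentiable_peakSection (φ : ℂ → ℝ) (n : ℕ) (z b : ℂ) (k : ℕ) :
    Differentiable ℂ (peakSection φ n z b k) := by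
  have h : Differentiable ℂ fun ζ : ℂ => ζ - z := by fun_prop
  exact (h.pow k).mul ((differentiable_exp_holoTaylor φ z b _).comp h)

theorem jet_peakSection (φ : ℂ → ℝ) (n : ℕ) (z b : ℂ) {k : ℕ} (hk : k ≤ 1) :
    jet φ n z k (peakSection φ n z b k) = 1 := by
  have hexp : Complex.exp (((n : ℝ) : ℂ) * φ z) * (Real.exp (-(n * φ z)) : ℂ) = 1 := by
    rw [Complex.ofReal_exp, ← Complex.exp_add]
    simp
  have h0 : Complex.exp (((n : ℝ) : ℂ) * holoTaylor φ z b 0) = Complex.exp (((n : ℝ) : ℂ) * φ z) := by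
    simp [holoTaylor]
  interval_cases k
  · simp only [jet, peakSection, if_true, pow_zero, one_mul, sub_self]
    rw [h0, hexp]
  · have hd : HasDerivAt (peakSection φ n z b 1) (Complex.exp (((n : ℝ) : ℂ) * φ z)) z := by
      have h1 : HasDerivAt (fun ζ : ℂ => ζ - z) 1 z := (hasDerivAt_id z).sub_const z
      have h2 : HasDerivAt (fun w => Complex.exp (((n : ℝ) : ℂ) * holoTaylor φ z b w))
          (Complex.exp (((n : ℝ) : ℂ) * φ z) * (((n : ℝ) : ℂ) * (2 * wirtingerDeriv φ z))) (z - z) := by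
        rw [sub_self]; exact hasDerivAt_exp_holoTaylor φ z b _
      have h3 := h1.mul (HasDerivAt.comp (h := fun ζ : ℂ => ζ - z) z h2 h1)
      have e : peakSection φ n z b 1 = (fun ζ : ℂ => ζ - z) * ((fun w => Complex.exp (((n : ℝ) : ℂ) *
          holoTaylor φ z b w)) ∘ fun ζ => ζ - z) := by
        funext ζ
        simp [peakSection]
      rw [e]
      refine h3.congr_deriv ?_
      rw [Function.comp_apply, sub_self, h0]
      ring
    have hz : peakSection φ n z b 1 z = 0 := by simp [peakSection]
    rw [jet, if_neg one_ne_zero, hd.deriv, hz, mul_zero, sub_zero, hexp]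

theorem norm_peakSection_le {φ : ℂ → ℝ} {z b : ℂ} {c κ : ℝ} {ζ : ℂ}
    (hT : φ z + (2 * wirtingerDeriv φ z * (ζ - z) + b * (ζ - z) ^ 2).re
      ≤ φ ζ - (c / 2 - κ) * ‖ζ - z‖ ^ 2) (n k : ℕ) :
    ‖peakSection φ n z b k ζ‖
      ≤ ‖ζ - z‖ ^ k * Real.exp (n * φ ζ - n * (c / 2 - κ) * ‖ζ - z‖ ^ 2) := by
  rw [peakSection, norm_mul, norm_pow, norm_exp_holoTaylor]
  refine mul_le_mul_of_nonneg_left (Real.exp_le_exp.2 ?_) (by positivity)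
  have hn : (0 : ℝ) ≤ n := n.cast_nonneg
  have := mul_le_mul_of_nonneg_left hT hn
  rw [Complex.add_re, Complex.ofReal_re]
  linarith

theorem sum_mul_le_of_le {ι : Type*} [Fintype ι] [Nonempty ι] {t : ι → ℝ} (ht : ∀ i, 0 ≤ t i) {a : ℝ}
    (h : ∃ i, a ≤ t i) :
    a * ∑ i, t i ≤ Fintype.card ι * ∑ i, t i ^ 2 := by
  obtain ⟨i₀, hi₀⟩ := h
  obtain ⟨m, hm⟩ := Finite.exists_max t
  have h1 : ∀ i, a * t i ≤ ∑ i, t i ^ 2 := by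
    intro i
    calc a * t i ≤ t m * t m := mul_le_mul (hi₀.trans (hm _)) (hm i) (ht i) (ht m)
      _ = t m ^ 2 := by ring
      _ ≤ _ := Finset.single_le_sum (f := fun i => t i ^ 2) (fun i _ => sq_nonneg _)
        (Finset.mem_univ m)
  rw [Finset.mul_sum]
  calc ∑ i, a * t i ≤ ∑ _i : ι, ∑ i, t i ^ 2 := Finset.sum_le_sum fun i _ => h1 i
    _ = _ := by simp

/-- The cut-off peak sections at points of a compact subset of the bulk are exponentially close to
polynomials of degree at most `n`. -/
theorem exists_polynomial_near_peakSection {φ : ℂ → ℝ} (hφ : ContDiff ℝ 2 φ) (hg : HasLogGrowth φ)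
    {K : Set ℂ} (hK : IsCompact K) (hKb : K ⊆ bulk φ) {κ : ℝ} (hκ : 0 < κ)
    (hκ' : ∀ z ∈ K, 4 * κ ≤ Laplacian.laplacian φ z / 2) :
    ∃ r > 0, ∃ C > 0, ∃ η > 0, ∃ N : ℕ, ∀ n ≥ N, ∀ z₀ ∈ K, ∃ b : ℂ,
      (∀ ζ : ℂ, ‖ζ - z₀‖ ≤ 2 * r →
        φ z₀ + (2 * wirtingerDeriv φ z₀ * (ζ - z₀) + b * (ζ - z₀) ^ 2).re
          ≤ φ ζ - (Laplacian.laplacian φ z₀ / 2 / 2 - κ) * ‖ζ - z₀‖ ^ 2) ∧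
      ∀ k ≤ 1, ∃ p : ℂ[X], p.natDegree ≤ n ∧ ∀ z,
        ‖p.eval z - ramp z₀ r z * peakSection φ n z₀ b k z‖
          ≤ C * (n + 1) ^ 2 * Real.exp (-(n * η)) * ((1 + ‖z‖) ^ 2)⁻¹ * Real.exp (n * φ z) := by
  obtain ⟨r₁, hr₁, hthick⟩ := hK.exists_cthickening_subset_open isOpen_interior hKb
  obtain ⟨r₂, hr₂, htay⟩ := uniform_taylor hφ hK hκ
  obtain ⟨c₁, hc₁, hpeak⟩ := exists_peak_polynomials hφ hg
  obtain ⟨C₁, hC₁, R, hR, N, hdecay⟩ := exists_decay hφ.continuous hg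
  set r := min r₁ r₂ / 2 with hr
  have hr0 : 0 < r := by positivity
  have h2r₁ : 2 * r ≤ r₁ := by rw [hr]; linarith [min_le_left r₁ r₂]
  have h2r₂ : 2 * r ≤ r₂ := by rw [hr]; linarith [min_le_right r₁ r₂]
  obtain ⟨D, hD⟩ : ∃ D : ℝ, ∀ z ∈ K, ‖z‖ ≤ D := by
    obtain ⟨D, hD⟩ := hK.bddAbove_image continuous_norm.continuousOn
    exact ⟨D, fun z hz => hD ⟨z, hz, rfl⟩⟩
  set D' := |D| + 2 * r with hD'
  have hD'0 : 0 < D' := by positivity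
  obtain ⟨C₂, hC₂, hI⟩ := exists_integral_inv_dist_le (Metric.closedBall (0 : ℂ) D')
    (isCompact_closedBall _ _).measure_lt_top.ne
  have hpi := Real.pi_pos
  set C₃ := (1 + 2 * r) * C₁ * (1 + D') / c₁ with hC₃
  have hC₃0 : 0 < C₃ := by positivity
  refine ⟨r, hr0, (2 * Real.pi * r)⁻¹ * C₃ * (C₂ + 1), by positivity, κ * r ^ 2, by positivity,
    max N 1, fun n hn z₀ hz₀ => ?_⟩
  have hn1 : 1 ≤ n := (le_max_right _ _).trans hn
  have hn1R : (1 : ℝ) ≤ n := by exact_mod_cast hn1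
  obtain ⟨F, hFd, hFle, hFpeak⟩ := hpeak n hn1
  obtain ⟨b, hb⟩ := htay z₀ hz₀
  have hT : ∀ ζ : ℂ, ‖ζ - z₀‖ ≤ 2 * r →
        φ z₀ + (2 * wirtingerDeriv φ z₀ * (ζ - z₀) + b * (ζ - z₀) ^ 2).re
          ≤ φ ζ - (Laplacian.laplacian φ z₀ / 2 / 2 - κ) * ‖ζ - z₀‖ ^ 2 := by
    intro ζ hζ
    have := (abs_le.1 (hb (ζ - z₀) (hζ.trans h2r₂))).1
    rw [add_sub_cancel, Complex.add_re, Complex.ofReal_re] at this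
    linarith
  refine ⟨b, hT, fun k hk => ?_⟩
  have hcontact : ∀ ζ : ℂ, ‖ζ - z₀‖ ≤ 2 * r → ζ ∈ contactSet φ := by
    intro ζ hζ
    have h1 : ζ ∈ Metric.cthickening r₁ K :=
      Metric.mem_cthickening_of_dist_le _ z₀ _ _ hz₀ (by rw [dist_eq_norm]; linarith)
    exact (interior_subset (hthick h1)).1
  have hnorm : ∀ ζ : ℂ, ‖ζ - z₀‖ ≤ 2 * r → ‖ζ‖ ≤ D' := by
    intro ζ hζ
    have h1 : ‖ζ‖ ≤ ‖ζ - z₀‖ + ‖z₀‖ := by simpa using norm_add_le (ζ - z₀) z₀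
    have h2 := (hD z₀ hz₀).trans (le_abs_self D)
    rw [hD']; linarith
  obtain ⟨p, hpd, hp⟩ := exists_polynomial_approx hFd (differentiable_peakSection φ n z₀ b k) hr0
    (fun ζ _ hζ => by
      obtain ⟨j, hj⟩ := hFpeak ζ (hcontact ζ hζ)
      refine ⟨j, fun h0 => ?_⟩
      rw [h0, norm_zero] at hj
      have : 0 < c₁ / (n * (1 + ‖ζ‖)) * Real.exp (n * φ ζ) := by positivity
      linarith)
  refine ⟨p, hpd, fun z => ?_⟩
  set T := ((1 + ‖z‖) ^ 2)⁻¹ * Real.exp (n * φ z) with hTdef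
  have hT0 : 0 < T := by positivity
  have hFz : ∀ j, ‖(F j).eval z‖ ≤ C₁ * T := by
    intro j
    have := hdecay n ((le_max_left _ _).trans hn) (F j) 1 (hFd j)
      (fun w _ => by rw [one_mul]; exact hFle j w) z
    rw [hTdef]
    linarith
  -- On the annulus the peak section is smaller than `e^{nφ}` by the factor `e^{-nκr²}`, while
  -- `E_ζ(z)` costs only `e^{n(φ(z) - φ(ζ))}` times a power of `n`.
  have hmain := hp z (C₃ * (n + 1) ^ 2 * Real.exp (-(n * (κ * r ^ 2))) * T) (fun ζ hζ => by
    obtain ⟨hζ1, hζ2⟩ := hζ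
    set a := c₁ / (n * (1 + ‖ζ‖)) * Real.exp (n * φ ζ) with ha
    have ha0 : 0 < a := by positivity
    have hsum := sum_mul_le_of_le (t := fun j => ‖(F j).eval ζ‖) (fun j => norm_nonneg _)
      (hFpeak ζ (hcontact ζ hζ2))
    simp only [Fintype.card_fin] at hsum
    have h1 : ∑ j, ‖(F j).eval ζ‖ * ‖(F j).eval z‖ ≤ (∑ j, ‖(F j).eval ζ‖) * (C₁ * T) := by
      rw [Finset.sum_mul]
      exact Finset.sum_le_sum fun j _ => mul_le_mul_of_nonneg_left (hFz j) (norm_nonneg _)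
    have h2 : ∑ j, ‖(F j).eval ζ‖ ≤ ((n + 1 : ℕ) : ℝ) * (∑ j, ‖(F j).eval ζ‖ ^ 2) / a := by
      rw [le_div_iff₀ ha0]; linarith
    have h3 : ‖peakSection φ n z₀ b k ζ‖
        ≤ (1 + 2 * r) * (Real.exp (n * φ ζ) * Real.exp (-(n * (κ * r ^ 2)))) := by
      refine (norm_peakSection_le (hT ζ hζ2) n k).trans ?_
      rw [← Real.exp_add]
      refine mul_le_mul ?_ (Real.exp_le_exp.2 ?_) (Real.exp_pos _).le (by positivity)
      · interval_cases k
        · simp; exact hr0.le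
        · simp only [pow_one]; linarith
      · have h4 := hκ' z₀ hz₀
        have h5 : κ * r ^ 2 ≤ (Laplacian.laplacian φ z₀ / 2 / 2 - κ) * ‖ζ - z₀‖ ^ 2 := by
          have : κ ≤ Laplacian.laplacian φ z₀ / 2 / 2 - κ := by linarith
          exact mul_le_mul this (by gcongr) (by positivity) (hκ.le.trans this)
        nlinarith
    set S := ∑ j, ‖(F j).eval ζ‖ ^ 2 with hS
    have hS0 : 0 ≤ S := Finset.sum_nonneg fun j _ => by positivity
    have h6 : 1 + ‖ζ‖ ≤ 1 + D' := by linarith [hnorm ζ hζ2]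
    calc ‖peakSection φ n z₀ b k ζ‖ * ∑ j, ‖(F j).eval ζ‖ * ‖(F j).eval z‖
        ≤ ((1 + 2 * r) * (Real.exp (n * φ ζ) * Real.exp (-(n * (κ * r ^ 2))))) *
          ((((n + 1 : ℕ) : ℝ) * S / a) * (C₁ * T)) := by
          refine mul_le_mul h3 (h1.trans ?_) (Finset.sum_nonneg fun j _ => by positivity)
            (by positivity)
          gcongr
      _ = ((1 + 2 * r) * C₁ * (1 + ‖ζ‖) / c₁) * ((n + 1) * n) *
            Real.exp (-(n * (κ * r ^ 2))) * T * S := by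
          rw [ha]
          push_cast
          field_simp
      _ ≤ C₃ * (n + 1) ^ 2 * Real.exp (-(n * (κ * r ^ 2))) * T * S := by
          rw [hC₃]
          gcongr
          nlinarith)
  refine hmain.trans ?_
  have hann : annulus z₀ r ⊆ Metric.closedBall (0 : ℂ) D' := fun ζ hζ => by
    simpa using hnorm ζ hζ.2
  have h7 : ∫ ζ in annulus z₀ r, ‖ζ - z‖⁻¹ ≤ C₂ + 1 := by
    refine le_trans (setIntegral_mono_set (hI z).1 (ae_of_all _ fun ζ => by positivity)
      hann.eventuallyLE) ?_
    linarith [(hI z).2]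
  calc (2 * Real.pi * r)⁻¹ * (C₃ * (n + 1) ^ 2 * Real.exp (-(n * (κ * r ^ 2))) * T) *
        ∫ ζ in annulus z₀ r, ‖ζ - z‖⁻¹
      ≤ (2 * Real.pi * r)⁻¹ * (C₃ * (n + 1) ^ 2 * Real.exp (-(n * (κ * r ^ 2))) * T) *
        (C₂ + 1) := by gcongr
    _ = _ := by rw [hTdef]; ring

theorem integrable_inv_one_add_norm_sq_sq :
    Integrable (fun z : ℂ => (((1 + ‖z‖) ^ 2)⁻¹) ^ 2) := by
  have h := integrable_one_add_norm (E := ℂ) (μ := volume) (r := 4)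
    (by rw [Complex.finrank_real_complex]; norm_num)
  refine h.congr (ae_of_all _ fun z => ?_)
  have h0 : (0 : ℝ) ≤ 1 + ‖z‖ := by positivity
  simp only
  have h4 : (1 + ‖z‖) ^ (4 : ℝ) = (1 + ‖z‖) ^ 4 := by
    rw [← Real.rpow_natCast]
    norm_num
  rw [Real.rpow_neg h0, h4, inv_pow, ← pow_mul]

theorem sq_mul_exp_le_of_norm_le {φ : ℂ → ℝ} {n : ℕ} {x z : ℂ} {A : ℝ}
    (h : ‖x‖ ≤ A * Real.exp (n * φ z)) : ‖x‖ ^ 2 * Real.exp (-2 * n * φ z) ≤ A ^ 2 := by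
  have h1 : ‖x‖ ^ 2 ≤ (A * Real.exp (n * φ z)) ^ 2 := by gcongr
  have h2 : Real.exp (n * φ z) ^ 2 * Real.exp (-2 * n * φ z) = 1 := by
    rw [← Real.exp_nat_mul, ← Real.exp_add, Real.exp_eq_one_iff]
    push_cast
    ring
  calc ‖x‖ ^ 2 * Real.exp (-2 * n * φ z)
      ≤ (A * Real.exp (n * φ z)) ^ 2 * Real.exp (-2 * n * φ z) := by gcongr
    _ = A ^ 2 := by rw [mul_pow, mul_assoc, h2, mul_one]

/-- For large `n` all polynomials of degree at most `n` have finite weighted norm. -/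
theorem exists_integrable_weighted {φ : ℂ → ℝ} (hφ : Continuous φ) (hg : HasLogGrowth φ) :
    ∃ N : ℕ, ∀ n ≥ N, ∀ p : ℂ[X], p.natDegree ≤ n →
      Integrable fun z => ‖p.eval z‖ ^ 2 * Real.exp (-2 * n * φ z) := by
  obtain ⟨C, hC, R, hR, N, h⟩ := exists_decay hφ hg
  refine ⟨N, fun n hn p hp => ?_⟩
  obtain ⟨M, hM⟩ := IsCompact.exists_bound_of_continuousOn (isCompact_closedBall (0 : ℂ) R)
    (f := fun z => p.eval z * (Real.exp (-(n * φ z)) : ℂ)) (by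
      have := p.continuous
      exact Continuous.continuousOn (by fun_prop))
  have hdec := h n hn p M hp fun w hw => by
    have := hM w (by simpa using hw)
    rw [norm_mul, Complex.norm_real, Real.norm_of_nonneg (Real.exp_pos _).le] at this
    have h2 := mul_le_mul_of_nonneg_right this (Real.exp_pos (n * φ w)).le
    rwa [mul_assoc, ← Real.exp_add, neg_add_cancel, Real.exp_zero, mul_one] at h2
  refine (integrable_inv_one_add_norm_sq_sq.const_mul ((M * C) ^ 2)).mono' ?_
    (ae_of_all _ fun z => ?_)
  · have := p.continuous
    exact Continuous.aestronglyMeasurable (by fun_prop)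
  · rw [Real.norm_of_nonneg (by positivity), ← mul_pow]
    exact sq_mul_exp_le_of_norm_le (by rw [mul_assoc M C]; exact hdec z)

theorem exists_forall_pow_mul_exp_le (A : ℝ) {η x : ℝ} (hη : 0 < η) (hx : 0 < x) :
    ∃ N : ℕ, ∀ n ≥ N, A * (((n : ℝ) + 1) ^ 6 * Real.exp (-(2 * (n * η)))) ≤ x := by
  have h1 := (Real.tendsto_pow_mul_exp_neg_atTop_nhds_zero 6).comp
    ((tendsto_atTop_add_const_right _ (1 : ℝ) tendsto_natCast_atTop_atTop).const_mul_atTop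
      (by positivity : 0 < 2 * η))
  have h2 : Tendsto (fun n : ℕ => A * (((n : ℝ) + 1) ^ 6 * Real.exp (-(2 * (n * η))))) atTop
      (𝓝 0) := by
    have := h1.const_mul (A * Real.exp (2 * η) / (2 * η) ^ 6)
    rw [mul_zero] at this
    refine this.congr fun n => ?_
    have e : Real.exp (-(2 * (n * η))) = Real.exp (2 * η) * Real.exp (-(2 * η * (n + 1))) := by
      rw [← Real.exp_add]; congr 1; ring
    simp only [Function.comp]
    rw [e, mul_pow]
    field_simp
  obtain ⟨N, hN⟩ := eventually_atTop.1 (h2.eventually (eventually_le_nhds hx))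
  exact ⟨N, hN⟩

theorem one_add_sq_le {a b θ : ℝ} (hθ : 0 < θ) :
    (a + b) ^ 2 ≤ (1 + θ) * a ^ 2 + (1 + 1 / θ) * b ^ 2 := by
  have h : 0 ≤ (θ * a - b) ^ 2 / θ := by positivity
  have e : (1 + θ) * a ^ 2 + (1 + 1 / θ) * b ^ 2 - (a + b) ^ 2 = (θ * a - b) ^ 2 / θ := by
    field_simp
    ring
  linarith

theorem mul_pi_div_pow_le {θ x a : ℝ} (hθ0 : 0 < θ) (hθ1 : θ ≤ 1 / 16) (hx : 0 < x)
    (ha : x * (1 - θ) ≤ a) {k : ℕ} (hk : k ≤ 1) :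
    (1 + θ) * (Real.pi / a ^ (k + 1)) ≤ Real.pi / x ^ (k + 1) * (1 + 8 * θ) := by
  have hθ2 : 0 < 1 - θ := by linarith
  have ha0 : 0 < a := (mul_pos hx hθ2).trans_le ha
  have hpi := Real.pi_pos
  have h5 : (1 - θ) ^ 2 ≤ (1 - θ) ^ (k + 1) :=
    pow_le_pow_of_le_one hθ2.le (by linarith) (by omega)
  have h3 : x ^ (k + 1) * (1 - θ) ^ 2 ≤ a ^ (k + 1) :=
    calc x ^ (k + 1) * (1 - θ) ^ 2 ≤ x ^ (k + 1) * (1 - θ) ^ (k + 1) := by gcongr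
      _ = (x * (1 - θ)) ^ (k + 1) := (mul_pow _ _ _).symm
      _ ≤ _ := by gcongr
  have h7 : 1 + θ ≤ (1 + 8 * θ) * (1 - θ) ^ 2 := by
    have h8 : 0 ≤ θ * (5 - 15 * θ + 8 * θ ^ 2) :=
      mul_nonneg hθ0.le (by linarith [sq_nonneg θ])
    linarith
  rw [mul_div_assoc', div_mul_eq_mul_div, div_le_div_iff₀ (by positivity) (by positivity)]
  calc (1 + θ) * Real.pi * x ^ (k + 1)
      ≤ (1 + 8 * θ) * (1 - θ) ^ 2 * Real.pi * x ^ (k + 1) := by gcongr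
    _ = Real.pi * (1 + 8 * θ) * (x ^ (k + 1) * (1 - θ) ^ 2) := by ring
    _ ≤ _ := by gcongr

theorem one_sub_mul_one_add_le (δ : ℝ) :
    (1 - δ) * (1 + 3 * δ / 4) ≤ (1 - δ / 8) ^ 2 := by
  linarith [sq_nonneg δ]

theorem setIntegral_gauss_sub_le {a r : ℝ} (ha : 0 < a) (hr : 0 ≤ r) {k : ℕ} (hk : k ≤ 1)
    (z₀ : ℂ) : ∫ z in Metric.closedBall z₀ r, ‖z - z₀‖ ^ (2 * k) * Real.exp (-a * ‖z - z₀‖ ^ 2)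
      ≤ Real.pi / a ^ (k + 1) := by
  have hpre : (fun w => z₀ + w) ⁻¹' Metric.closedBall z₀ r = Metric.closedBall 0 r := by
    ext w; simp
  have htr := (measurePreserving_add_left (volume : Measure ℂ) z₀).setIntegral_preimage_emb
    (measurableEmbedding_addLeft z₀)
    (fun z => ‖z - z₀‖ ^ (2 * k) * Real.exp (-a * ‖z - z₀‖ ^ 2)) (Metric.closedBall z₀ r)
  rw [hpre] at htr
  rw [← htr]
  simp only [add_sub_cancel_left]
  exact gauss_integral_le ha hr k hk

set_option maxHeartbeats 1000000 in
/-- The upper bound for the jets is attained to leading order, for each `k` separately, by a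
polynomial of degree at most `n`. -/
theorem exists_jet_lower {φ : ℂ → ℝ} (hφ : ContDiff ℝ 2 φ) (hg : HasLogGrowth φ)
    {K : Set ℂ} (hK : IsCompact K) (hKb : K ⊆ bulk φ) {δ : ℝ} (hδ : 0 < δ) (hδ1 : δ ≤ 1) :
    ∃ N : ℕ, ∀ n ≥ N, ∀ z₀ ∈ K, ∀ k ≤ 1, ∃ p : ℂ[X], p.natDegree ≤ n ∧
      jet φ n z₀ k (fun w => p.eval w) ≠ 0 ∧
      (1 - δ) * weightedNormSq φ n (fun w => p.eval w)
        ≤ ‖jet φ n z₀ k (fun w => p.eval w)‖ ^ 2 *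
          (Real.pi / (Laplacian.laplacian φ z₀ / 2 * n) ^ (k + 1)) := by
  have hpos : ∀ z ∈ K, 0 < Laplacian.laplacian φ z := fun z hz => (interior_subset (hKb hz)).2
  obtain ⟨m, hm, M, hM, hb⟩ := exists_laplacian_bounds hφ hK hpos
  set θ := δ / 16 with hθ
  have hθ0 : 0 < θ := by positivity
  have hθ1 : θ ≤ 1 / 16 := by rw [hθ]; linarith
  set κ := θ * m / 2 with hκ
  have hκ0 : 0 < κ := by positivity
  obtain ⟨r, hr, C, hC, η, hη, N₁, happ⟩ := exists_polynomial_near_peakSection hφ hg hK hKb hκ0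
    (fun z hz => by have := (hb z hz).1; rw [hκ]; nlinarith)
  obtain ⟨r', hr', hr'r, N₂, hN₂, hup⟩ := exists_jet_upper hφ hK hpos one_pos hr
  set J := ∫ z : ℂ, (((1 + ‖z‖) ^ 2)⁻¹) ^ 2 with hJ
  have hJ0 : 0 ≤ J := integral_nonneg fun z => by positivity
  have hpi := Real.pi_pos
  obtain ⟨N₃, hN₃⟩ := exists_forall_pow_mul_exp_le (C ^ 2 * J * (M + 1) ^ 2 / Real.pi) hη
    (x := min ((δ / 8) ^ 2 / 2) (δ / 4 / (1 + 1 / θ))) (by positivity)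
  refine ⟨max N₁ (max N₂ N₃), fun n hn z₀ hz₀ k hk => ?_⟩
  have hn1 := (le_max_left _ _).trans hn
  have hn2 := ((le_max_left _ _).trans (le_max_right _ _)).trans hn
  have hn3 := ((le_max_right _ _).trans (le_max_right _ _)).trans hn
  have hnR : (1 : ℝ) ≤ n := by exact_mod_cast hN₂.trans hn2
  have hn0 : (0 : ℝ) < n := by linarith
  set c := Laplacian.laplacian φ z₀ / 2 with hc
  obtain ⟨hmc, hcM⟩ := hb z₀ hz₀
  have hc0 : 0 < c := hm.trans_le hmc
  obtain ⟨b, hT, hpk⟩ := happ n hn1 z₀ hz₀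
  obtain ⟨p, hpd, hp⟩ := hpk k hk
  set g := peakSection φ n z₀ b k with hgdef
  set ε := C * (n + 1) ^ 2 * Real.exp (-(n * η)) with hε
  have hε0 : 0 < ε := by positivity
  set Λ := Real.pi / (c * n) ^ (k + 1) with hΛ
  have hΛ0 : 0 < Λ := by positivity
  set X := ε ^ 2 * J * (M + 1) ^ 2 * (n + 1) ^ 2 / Real.pi with hX
  have hXe : X = C ^ 2 * J * (M + 1) ^ 2 / Real.pi *
      (((n : ℝ) + 1) ^ 6 * Real.exp (-(2 * (n * η)))) := by
    have : Real.exp (-(2 * (n * η))) = Real.exp (-(n * η)) ^ 2 := by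
      rw [← Real.exp_nat_mul]; congr 1; push_cast; ring
    rw [hX, hε, this]
    ring
  have hXle := hN₃ n hn3
  rw [← hXe] at hXle
  have hX1 : X ≤ (δ / 8) ^ 2 / 2 := hXle.trans (min_le_left _ _)
  have hX2 : (1 + 1 / θ) * X ≤ δ / 4 := by
    have h1 := hXle.trans (min_le_right _ _)
    rw [le_div_iff₀ (by positivity)] at h1
    linarith
  have hεX : ε ^ 2 * J ≤ X * Λ := by
    have hY : (c * n) ^ (k + 1) ≤ ((M + 1) * (n + 1)) ^ 2 := by
      have h1 : c * n ≤ (M + 1) * (n + 1) := by gcongr <;> linarith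
      have h2 : 1 ≤ (M + 1) * ((n : ℝ) + 1) := by nlinarith
      calc (c * n) ^ (k + 1) ≤ ((M + 1) * (n + 1)) ^ (k + 1) := by gcongr
        _ ≤ _ := pow_le_pow_right₀ h2 (by omega)
    have e : X * Λ = ε ^ 2 * J * (((M + 1) * (n + 1)) ^ 2 / (c * n) ^ (k + 1)) := by
      rw [hX, hΛ]; field_simp
    rw [e]
    refine le_mul_of_one_le_right (by positivity) ?_
    rwa [one_le_div (by positivity)]
  have hgd : Differentiable ℂ g := differentiable_peakSection φ n z₀ b k
  have hgc := hgd.continuous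
  have hpc := p.continuous
  refine ⟨p, hpd, ?_⟩
  -- The error `p - g` has a small jet, by the upper bound for jets, because it is small in `L²` of a disc.
  have hf : Differentiable ℂ fun w => p.eval w - g w := p.differentiable.sub hgd
  have hball : ∫ w in Metric.closedBall z₀ r', ‖p.eval w - g w‖ ^ 2 * Real.exp (-2 * n * φ w)
      ≤ ε ^ 2 * J := by
    have hφc := hφ.continuous
    calc _ ≤ ∫ w in Metric.closedBall z₀ r', ε ^ 2 * (((1 + ‖w‖) ^ 2)⁻¹) ^ 2 := by
          refine setIntegral_mono_on ?_ (integrable_inv_one_add_norm_sq_sq.const_mul _).integrableOn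
            measurableSet_closedBall fun w hw => ?_
          · exact ContinuousOn.integrableOn_compact (isCompact_closedBall _ _)
              (Continuous.continuousOn (by fun_prop))
          · rw [← mul_pow]
            refine sq_mul_exp_le_of_norm_le ?_
            have h1 := hp w
            rw [ramp_eq_one hr (by
              have : ‖w - z₀‖ ≤ r' := by simpa [dist_eq_norm] using hw
              linarith), Complex.ofReal_one, one_mul] at h1
            exact h1
      _ ≤ ∫ w, ε ^ 2 * (((1 + ‖w‖) ^ 2)⁻¹) ^ 2 :=
          setIntegral_le_integral (integrable_inv_one_add_norm_sq_sq.const_mul _)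
            (ae_of_all _ fun w => by positivity)
      _ = ε ^ 2 * J := by rw [integral_const_mul]
  have hjf : ‖jet φ n z₀ k (fun w => p.eval w - g w)‖ ≤ δ / 8 := by
    have h1 := hup n hn2 z₀ hz₀ _ hf
    have h2 : ‖jet φ n z₀ k (fun w => p.eval w - g w)‖ ^ 2 * Λ ≤ 2 * (X * Λ) := by
      refine le_trans ?_ (h1.trans (by linarith [hball, hεX]))
      rw [hΛ]
      interval_cases k
      · simp only [zero_add, pow_one]
        exact le_add_of_nonneg_right (by positivity)
      · exact le_add_of_nonneg_left (by positivity)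
    have h3 : ‖jet φ n z₀ k (fun w => p.eval w - g w)‖ ^ 2 ≤ 2 * X := by
      rw [← mul_assoc] at h2
      exact le_of_mul_le_mul_right h2 hΛ0
    refine abs_le_of_sq_le_sq' ?_ (by positivity) |>.2
    linarith
  have hjp : jet φ n z₀ k (fun w => p.eval w)
      = 1 + jet φ n z₀ k (fun w => p.eval w - g w) := by
    rw [← jet_peakSection φ n z₀ b hk, ← jet_add k (hgd z₀) (hf z₀)]
    simp [hgdef]
  have hjlow : 1 - δ / 8 ≤ ‖jet φ n z₀ k (fun w => p.eval w)‖ := by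
    rw [hjp]
    have := norm_sub_norm_le (1 : ℂ) (-jet φ n z₀ k (fun w => p.eval w - g w))
    rw [norm_neg, norm_one, sub_neg_eq_add] at this
    linarith
  refine ⟨fun h0 => by rw [h0, norm_zero] at hjlow; linarith, ?_⟩
  -- The norm of `p` is that of the cut-off Gaussian up to a small error.
  set a := n * (c - 2 * κ) with ha
  have hcκ : c * (1 - θ) ≤ c - 2 * κ := by rw [hκ]; nlinarith
  have hcκ0 : 0 < c * (1 - θ) := mul_pos hc0 (by linarith)
  have ha0 : 0 < a := mul_pos hn0 (hcκ0.trans_le hcκ)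
  set G : ℂ → ℝ := fun w => ‖w‖ ^ (2 * k) * Real.exp (-a * ‖w‖ ^ 2) with hG
  have hGc : Continuous G := by rw [hG]; fun_prop
  set ind : ℂ → ℝ := (Metric.closedBall z₀ (2 * r)).indicator fun z => G (z - z₀) with hind
  have hindi : Integrable ind := by
    refine (ContinuousOn.integrableOn_compact (isCompact_closedBall _ _)
      (Continuous.continuousOn ?_)).integrable_indicator measurableSet_closedBall
    exact hGc.comp (continuous_id.sub continuous_const)
  have hindI : ∫ z, ind z ≤ Real.pi / a ^ (k + 1) := by
    rw [hind, integral_indicator measurableSet_closedBall]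
    exact setIntegral_gauss_sub_le ha0 (by positivity) hk z₀
  have hpt : ∀ z, ‖p.eval z‖ ^ 2 * Real.exp (-2 * n * φ z)
      ≤ (1 + θ) * ind z + (1 + 1 / θ) * ε ^ 2 * (((1 + ‖z‖) ^ 2)⁻¹) ^ 2 := by
    intro z
    have h1 : ‖p.eval z‖ ≤ ‖(ramp z₀ r z : ℂ) * g z‖ + ‖p.eval z - ramp z₀ r z * g z‖ := by
      have := norm_add_le ((ramp z₀ r z : ℂ) * g z) (p.eval z - ramp z₀ r z * g z)
      simpa using this
    have h2 : ‖p.eval z‖ ^ 2 ≤ (1 + θ) * ‖(ramp z₀ r z : ℂ) * g z‖ ^ 2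
        + (1 + 1 / θ) * ‖p.eval z - ramp z₀ r z * g z‖ ^ 2 :=
      le_trans (by gcongr) (one_add_sq_le hθ0)
    have h3 : ‖p.eval z - ramp z₀ r z * g z‖ ^ 2 * Real.exp (-2 * n * φ z)
        ≤ ε ^ 2 * (((1 + ‖z‖) ^ 2)⁻¹) ^ 2 := by
      rw [← mul_pow]
      exact sq_mul_exp_le_of_norm_le (hp z)
    have h4 : ‖(ramp z₀ r z : ℂ) * g z‖ ^ 2 * Real.exp (-2 * n * φ z) ≤ ind z := by
      by_cases hz : ‖z - z₀‖ ≤ 2 * r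
      · rw [hind, Set.indicator_of_mem (by simpa [dist_eq_norm] using hz)]
        have h5 : ‖(ramp z₀ r z : ℂ) * g z‖
            ≤ (‖z - z₀‖ ^ k * Real.exp (-(n * (c / 2 - κ) * ‖z - z₀‖ ^ 2))) *
              Real.exp (n * φ z) := by
          rw [norm_mul, Complex.norm_real, Real.norm_of_nonneg (ramp_nonneg hr _ _)]
          refine (mul_le_of_le_one_left (norm_nonneg _) (ramp_le_one hr _ _)).trans ?_
          refine (norm_peakSection_le (hT z hz) n k).trans (le_of_eq ?_)
          rw [mul_assoc (‖z - z₀‖ ^ k), ← Real.exp_add]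
          congr 2
          ring
        refine (sq_mul_exp_le_of_norm_le h5).trans (le_of_eq ?_)
        rw [hG, mul_pow, ← Real.exp_nat_mul, ← pow_mul, mul_comm k 2]
        simp only
        congr 2
        rw [ha]
        push_cast
        ring
      · rw [hind, Set.indicator_of_notMem (by simpa [dist_eq_norm] using hz),
          ramp_eq_zero hr (le_of_not_ge hz)]
        simp
    calc _ ≤ ((1 + θ) * ‖(ramp z₀ r z : ℂ) * g z‖ ^ 2
          + (1 + 1 / θ) * ‖p.eval z - ramp z₀ r z * g z‖ ^ 2) * Real.exp (-2 * n * φ z) := by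
          gcongr
      _ = (1 + θ) * (‖(ramp z₀ r z : ℂ) * g z‖ ^ 2 * Real.exp (-2 * n * φ z)) + (1 + 1 / θ) *
          (‖p.eval z - ramp z₀ r z * g z‖ ^ 2 * Real.exp (-2 * n * φ z)) := by ring
      _ ≤ (1 + θ) * ind z + (1 + 1 / θ) * (ε ^ 2 * (((1 + ‖z‖) ^ 2)⁻¹) ^ 2) := by gcongr
      _ = _ := by ring
  have hN : weightedNormSq φ n (fun w => p.eval w) ≤ Λ * (1 + 3 * δ / 4) := by
    have h1 : weightedNormSq φ n (fun w => p.eval w)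
        ≤ (1 + θ) * (Real.pi / a ^ (k + 1)) + (1 + 1 / θ) * ε ^ 2 * J := by
      rw [weightedNormSq]
      refine le_trans (integral_mono_of_nonneg (ae_of_all _ fun z => by positivity)
        ((hindi.const_mul _).add (integrable_inv_one_add_norm_sq_sq.const_mul _))
        (ae_of_all _ hpt)) ?_
      simp only [Pi.add_apply]
      rw [integral_add (hindi.const_mul _) (integrable_inv_one_add_norm_sq_sq.const_mul _),
        integral_const_mul, integral_const_mul]
      gcongr
    have h2 : (1 + θ) * (Real.pi / a ^ (k + 1)) ≤ Λ * (1 + 8 * θ) := by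
      refine mul_pi_div_pow_le hθ0 hθ1 (mul_pos hc0 hn0) ?_ hk
      calc c * n * (1 - θ) = n * (c * (1 - θ)) := by ring
        _ ≤ a := mul_le_mul_of_nonneg_left hcκ hn0.le
    have h9 : (1 + 1 / θ) * ε ^ 2 * J ≤ Λ * (δ / 4) := by
      calc (1 + 1 / θ) * ε ^ 2 * J = (1 + 1 / θ) * (ε ^ 2 * J) := by ring
        _ ≤ (1 + 1 / θ) * (X * Λ) := by gcongr
        _ = Λ * ((1 + 1 / θ) * X) := by ring
        _ ≤ _ := by gcongr
    have h10 : 8 * θ = δ / 2 := by rw [hθ]; ring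
    rw [h10] at h2
    linarith
  have hsq : (1 - δ / 8) ^ 2 ≤ ‖jet φ n z₀ k (fun w => p.eval w)‖ ^ 2 :=
    pow_le_pow_left₀ (by linarith) hjlow 2
  calc (1 - δ) * weightedNormSq φ n (fun w => p.eval w) ≤ (1 - δ) * (Λ * (1 + 3 * δ / 4)) :=
        mul_le_mul_of_nonneg_left hN (by linarith)
    _ = ((1 - δ) * (1 + 3 * δ / 4)) * Λ := by ring
    _ ≤ (1 - δ / 8) ^ 2 * Λ := mul_le_mul_of_nonneg_right
        (one_sub_mul_one_add_le δ) hΛ0.le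
    _ ≤ _ := mul_le_mul_of_nonneg_right hsq hΛ0.le

/-! ### Orthonormal bases and Gram matrices -/

theorem weightedInner_self (φ : ℂ → ℝ) (n : ℕ) (p : ℂ[X]) :
    weightedInner φ n p p = (weightedNormSq φ n (fun z => p.eval z) : ℂ) := by
  rw [weightedInner, weightedNormSq, ← integral_complex_ofReal]
  refine integral_congr_ae (ae_of_all _ fun z => ?_)
  simp only
  rw [Complex.mul_conj, Complex.normSq_eq_norm_sq]
  push_cast
  rfl

theorem conj_weightedInner (φ : ℂ → ℝ) (n : ℕ) (f g : ℂ[X]) :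
    conj (weightedInner φ n f g) = weightedInner φ n g f := by
  rw [weightedInner, weightedInner, ← integral_conj]
  refine integral_congr_ae (ae_of_all _ fun z => ?_)
  simp only [map_mul, Complex.conj_conj, Complex.conj_ofReal]
  ring

theorem integrable_weightedInner {φ : ℂ → ℝ} (hφ : Continuous φ) {n : ℕ} {f g : ℂ[X]}
    (hf : Integrable fun z => ‖f.eval z‖ ^ 2 * Real.exp (-2 * n * φ z))
    (hg : Integrable fun z => ‖g.eval z‖ ^ 2 * Real.exp (-2 * n * φ z)) :
    Integrable fun z => f.eval z * conj (g.eval z) * (Real.exp (-2 * n * φ z) : ℂ) := by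
  refine (hf.add hg).mono' ?_ (ae_of_all _ fun z => ?_)
  · have h1 := f.continuous
    have h2 := g.continuous
    exact Continuous.aestronglyMeasurable (by fun_prop)
  · rw [norm_mul, norm_mul, Complex.norm_real, Real.norm_of_nonneg (Real.exp_pos _).le,
      RCLike.norm_conj, Pi.add_apply, ← add_mul]
    gcongr
    nlinarith [sq_nonneg (‖f.eval z‖ - ‖g.eval z‖), sq_nonneg ‖f.eval z‖, sq_nonneg ‖g.eval z‖]

theorem weightedInner_add_left {φ : ℂ → ℝ} (hφ : Continuous φ) {n : ℕ} {f g h : ℂ[X]}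
    (hf : Integrable fun z => ‖f.eval z‖ ^ 2 * Real.exp (-2 * n * φ z))
    (hg : Integrable fun z => ‖g.eval z‖ ^ 2 * Real.exp (-2 * n * φ z))
    (hh : Integrable fun z => ‖h.eval z‖ ^ 2 * Real.exp (-2 * n * φ z)) :
    weightedInner φ n (f + g) h = weightedInner φ n f h + weightedInner φ n g h := by
  rw [weightedInner, weightedInner, weightedInner, ← integral_add
    (integrable_weightedInner hφ hf hh) (integrable_weightedInner hφ hg hh)]
  refine integral_congr_ae (ae_of_all _ fun z => ?_)
  simp only [Polynomial.eval_add]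
  ring

theorem weightedInner_smul_left (φ : ℂ → ℝ) (n : ℕ) (c : ℂ) (f g : ℂ[X]) :
    weightedInner φ n (c • f) g = c * weightedInner φ n f g := by
  rw [weightedInner, weightedInner, ← integral_const_mul]
  refine integral_congr_ae (ae_of_all _ fun z => ?_)
  simp only [Polynomial.eval_smul, smul_eq_mul]
  ring

theorem eq_zero_of_weightedNormSq_eq_zero {φ : ℂ → ℝ} (hφ : Continuous φ) {n : ℕ} {p : ℂ[X]}
    (hp : Integrable fun z => ‖p.eval z‖ ^ 2 * Real.exp (-2 * n * φ z))
    (h : weightedNormSq φ n (fun z => p.eval z) = 0) : p = 0 := by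
  have hc : Continuous fun z => ‖p.eval z‖ ^ 2 * Real.exp (-2 * n * φ z) := by
    have := p.continuous
    fun_prop
  rw [weightedNormSq, integral_eq_zero_iff_of_nonneg (fun z => by positivity) hp,
    Continuous.ae_eq_iff_eq volume hc continuous_zero] at h
  refine Polynomial.funext fun z => ?_
  have := congrFun h z
  simpa [Real.exp_ne_zero] using this

/-- The weighted inner product on polynomials of degree at most `n`, with the arguments swapped
because `inner` is conjugate-linear in its first argument. -/
abbrev weightedInnerCore {φ : ℂ → ℝ} (hφ : Continuous φ) {n : ℕ}
    (hint : ∀ p : ℂ[X], p.natDegree ≤ n →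
      Integrable fun z => ‖p.eval z‖ ^ 2 * Real.exp (-2 * n * φ z)) :
    InnerProductSpace.Core ℂ (Polynomial.degreeLE ℂ n) where
  inner f g := weightedInner φ n g f
  conj_inner_symm f g := conj_weightedInner φ n _ _
  re_inner_nonneg f := by
    rw [weightedInner_self]
    exact integral_nonneg fun z => by positivity
  add_left f g h := by
    have hd : ∀ p : Polynomial.degreeLE ℂ n, (p : ℂ[X]).natDegree ≤ n := fun p =>
      Polynomial.natDegree_le_iff_degree_le.2 (Polynomial.mem_degreeLE.1 p.2)
    rw [← conj_weightedInner, ← conj_weightedInner φ n f, ← conj_weightedInner φ n g, ← map_add,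
      ← weightedInner_add_left hφ (hint _ (hd f)) (hint _ (hd g)) (hint _ (hd h))]
    rfl
  smul_left f g r := by
    rw [← conj_weightedInner, ← conj_weightedInner φ n f, ← map_mul, ← weightedInner_smul_left]
    rfl
  definite f h := by
    rw [weightedInner_self] at h
    exact Subtype.ext (eq_zero_of_weightedNormSq_eq_zero hφ
      (hint _ (Polynomial.natDegree_le_iff_degree_le.2 (Polynomial.mem_degreeLE.1 f.2)))
      (by exact_mod_cast h))

theorem finrank_degreeLE (n : ℕ) : Module.finrank ℂ (Polynomial.degreeLE ℂ n) = n + 1 := by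
  rw [← Polynomial.degreeLT_succ_eq_degreeLE]
  simpa using (Polynomial.degreeLTEquiv ℂ (n + 1)).finrank_eq

theorem exists_isWeightedOrthonormalBasis {φ : ℂ → ℝ} (hφ : Continuous φ) {n : ℕ}
    (hint : ∀ p : ℂ[X], p.natDegree ≤ n →
      Integrable fun z => ‖p.eval z‖ ^ 2 * Real.exp (-2 * n * φ z)) :
    ∃ Q : Fin (n + 1) → ℂ[X], IsWeightedOrthonormalBasis φ n Q := by
  let _ := (weightedInnerCore hφ hint).toNormedAddCommGroup
  let _ := InnerProductSpace.ofCore (weightedInnerCore hφ hint).toCore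
  have hfr := finrank_degreeLE n
  have : FiniteDimensional ℂ (Polynomial.degreeLE ℂ n) :=
    Module.finite_of_finrank_pos (by omega)
  let b := (stdOrthonormalBasis ℂ (Polynomial.degreeLE ℂ n)).reindex (finCongr hfr)
  refine ⟨fun j => (b j : ℂ[X]), fun j =>
    Polynomial.natDegree_le_iff_degree_le.2 (Polynomial.mem_degreeLE.1 (b j).2), fun i j => ?_⟩
  have := orthonormal_iff_ite.1 b.orthonormal j i
  simp only [eq_comm (a := j)] at this
  exact this

/-- Parseval's identity, and spanning by dimension count. -/
theorem IsWeightedOrthonormalBasis.weightedNormSq_sum {φ : ℂ → ℝ} (hφ : Continuous φ) {n : ℕ}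
    (hint : ∀ p : ℂ[X], p.natDegree ≤ n →
      Integrable fun z => ‖p.eval z‖ ^ 2 * Real.exp (-2 * n * φ z))
    {P : Fin (n + 1) → ℂ[X]} (hP : IsWeightedOrthonormalBasis φ n P) :
    (∀ a : Fin (n + 1) → ℂ,
      weightedNormSq φ n (fun z => (∑ j, a j • P j).eval z) = ∑ j, ‖a j‖ ^ 2) ∧
    ∀ p : ℂ[X], p.natDegree ≤ n → ∃ a : Fin (n + 1) → ℂ, p = ∑ j, a j • P j := by
  let _ := (weightedInnerCore hφ hint).toNormedAddCommGroup
  let _ := InnerProductSpace.ofCore (weightedInnerCore hφ hint).toCore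
  have hfr := finrank_degreeLE n
  have : FiniteDimensional ℂ (Polynomial.degreeLE ℂ n) :=
    Module.finite_of_finrank_pos (by omega)
  let v : Fin (n + 1) → Polynomial.degreeLE ℂ n := fun j =>
    ⟨P j, Polynomial.mem_degreeLE.2 (Polynomial.natDegree_le_iff_degree_le.1 (hP.natDegree_le j))⟩
  have hv : Orthonormal ℂ v := by
    refine orthonormal_iff_ite.2 fun i j => ?_
    simp only [eq_comm (a := i)]
    exact hP.orthonormal j i
  have hsum : ∀ a : Fin (n + 1) → ℂ,
      ((∑ j, a j • v j : Polynomial.degreeLE ℂ n) : ℂ[X]) = ∑ j, a j • P j := fun a => by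
    simp [v]
  refine ⟨fun a => ?_, fun p hp => ?_⟩
  · have h1 := hv.inner_sum a a Finset.univ
    have h2 : (inner ℂ (∑ j, a j • v j) (∑ j, a j • v j) : ℂ)
        = weightedInner φ n (∑ j, a j • P j) (∑ j, a j • P j) := by
      rw [← hsum]; rfl
    rw [h2, weightedInner_self] at h1
    have h3 : ∀ j, conj (a j) * a j = ((‖a j‖ ^ 2 : ℝ) : ℂ) := fun j => by
      rw [mul_comm, Complex.mul_conj, Complex.normSq_eq_norm_sq]
    simp only [h3] at h1
    exact_mod_cast h1
  · have hspan := hv.linearIndependent.span_eq_top_of_card_eq_finrank'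
      (by rw [hfr, Fintype.card_fin])
    have hmem : (⟨p, Polynomial.mem_degreeLE.2 (Polynomial.natDegree_le_iff_degree_le.1 hp)⟩ :
        Polynomial.degreeLE ℂ n) ∈ Submodule.span ℂ (Set.range v) := by
      rw [hspan]; trivial
    obtain ⟨a, ha⟩ := (Submodule.mem_span_range_iff_exists_fun ℂ).1 hmem
    refine ⟨a, ?_⟩
    rw [← hsum, ha]

theorem norm_sq_sum_mul_le {ι : Type*} (s : Finset ι) (a b : ι → ℂ) :
    ‖∑ j ∈ s, a j * b j‖ ^ 2 ≤ (∑ j ∈ s, ‖b j‖ ^ 2) * ∑ j ∈ s, ‖a j‖ ^ 2 := by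
  have h1 : ‖∑ j ∈ s, a j * b j‖ ≤ ∑ j ∈ s, ‖b j‖ * ‖a j‖ :=
    (norm_sum_le _ _).trans (Finset.sum_le_sum fun j _ => by rw [norm_mul, mul_comm])
  exact (pow_le_pow_left₀ (norm_nonneg _) h1 2).trans (Finset.sum_mul_sq_le_sq_mul_sq _ _ _)

/-- The squared norm of a functional is at most the sum of its squared values on an orthonormal
basis. -/
theorem IsWeightedOrthonormalBasis.norm_sq_le {φ : ℂ → ℝ} (hφ : Continuous φ) {n : ℕ}
    (hint : ∀ p : ℂ[X], p.natDegree ≤ n →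
      Integrable fun z => ‖p.eval z‖ ^ 2 * Real.exp (-2 * n * φ z))
    {P : Fin (n + 1) → ℂ[X]} (hP : IsWeightedOrthonormalBasis φ n P) (ℓ : ℂ[X] →ₗ[ℂ] ℂ)
    {p : ℂ[X]} (hp : p.natDegree ≤ n) :
    ‖ℓ p‖ ^ 2 ≤ (∑ j, ‖ℓ (P j)‖ ^ 2) * weightedNormSq φ n (fun z => p.eval z) := by
  obtain ⟨hN, hE⟩ := hP.weightedNormSq_sum hφ hint
  obtain ⟨a, rfl⟩ := hE p hp
  rw [hN, map_sum]
  simp only [map_smul, smul_eq_mul]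
  exact norm_sq_sum_mul_le _ _ _

/-- The squared norm of a functional is at least the sum of its squared values on an orthonormal
basis. -/
theorem IsWeightedOrthonormalBasis.sum_norm_sq_le {φ : ℂ → ℝ} (hφ : Continuous φ) {n : ℕ}
    (hint : ∀ p : ℂ[X], p.natDegree ≤ n →
      Integrable fun z => ‖p.eval z‖ ^ 2 * Real.exp (-2 * n * φ z))
    {P : Fin (n + 1) → ℂ[X]} (hP : IsWeightedOrthonormalBasis φ n P) (ℓ : ℂ[X] →ₗ[ℂ] ℂ)
    {C : ℝ} (hC : 0 ≤ C) (h : ∀ p : ℂ[X], p.natDegree ≤ n →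
      ‖ℓ p‖ ^ 2 ≤ C * weightedNormSq φ n (fun z => p.eval z)) :
    ∑ j, ‖ℓ (P j)‖ ^ 2 ≤ C := by
  obtain ⟨hN, -⟩ := hP.weightedNormSq_sum hφ hint
  -- Test the bound on the element representing `ℓ`.
  have h1 := h (∑ j, conj (ℓ (P j)) • P j) (Polynomial.natDegree_sum_le_of_forall_le _ _ fun j _ =>
    (Polynomial.natDegree_smul_le _ _).trans (hP.natDegree_le j))
  rw [hN, map_sum] at h1
  have h2 : ∀ j, ℓ (conj (ℓ (P j)) • P j) = ((‖ℓ (P j)‖ ^ 2 : ℝ) : ℂ) := fun j => by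
    rw [map_smul, smul_eq_mul, mul_comm, Complex.mul_conj, Complex.normSq_eq_norm_sq]
  simp only [h2, RCLike.norm_conj] at h1
  rw [← Complex.ofReal_sum, Complex.norm_real, Real.norm_of_nonneg (by positivity), sq] at h1
  rcases (show 0 ≤ ∑ j, ‖ℓ (P j)‖ ^ 2 by positivity).eq_or_lt with h0 | h0
  · rwa [← h0]
  · exact le_of_mul_le_mul_right h1 h0

theorem norm_sq_add_eq (x y : ℂ) :
    ‖x + y‖ ^ 2 = ‖x‖ ^ 2 + ‖y‖ ^ 2 + 2 * (y * conj x).re := by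
  rw [← Complex.normSq_eq_norm_sq, Complex.normSq_add, Complex.normSq_eq_norm_sq,
    Complex.normSq_eq_norm_sq, ← Complex.conj_re (y * conj x)]
  simp [mul_comm]

/-- If `(ℓ₀, ℓ₁)` is bounded by `1 + δ` and each `ℓₖ` nearly attains the norm `1`, then the Gram
matrix of the two functionals is close to the identity. -/
theorem IsWeightedOrthonormalBasis.gram_bounds {φ : ℂ → ℝ} (hφ : Continuous φ) {n : ℕ}
    (hint : ∀ p : ℂ[X], p.natDegree ≤ n →
      Integrable fun z => ‖p.eval z‖ ^ 2 * Real.exp (-2 * n * φ z))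
    {P : Fin (n + 1) → ℂ[X]} (hP : IsWeightedOrthonormalBasis φ n P) (ℓ : ℕ → ℂ[X] →ₗ[ℂ] ℂ)
    {δ : ℝ} (hδ : 0 ≤ δ)
    (hup : ∀ p : ℂ[X], p.natDegree ≤ n →
      ‖ℓ 0 p‖ ^ 2 + ‖ℓ 1 p‖ ^ 2 ≤ (1 + δ) * weightedNormSq φ n (fun z => p.eval z))
    (hlow : ∀ k ≤ 1, ∃ p : ℂ[X], p.natDegree ≤ n ∧ ℓ k p ≠ 0 ∧
      (1 - δ) * weightedNormSq φ n (fun z => p.eval z) ≤ ‖ℓ k p‖ ^ 2) :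
    (∀ k ≤ 1, |∑ j, ‖ℓ k (P j)‖ ^ 2 - 1| ≤ δ) ∧
      ‖∑ j, ℓ 1 (P j) * conj (ℓ 0 (P j))‖ ≤ 2 * δ := by
  have hlow' : ∀ k ≤ 1, 1 - δ ≤ ∑ j, ‖ℓ k (P j)‖ ^ 2 := fun k hk => by
    obtain ⟨p, hp, h0, h⟩ := hlow k hk
    have h1 := hP.norm_sq_le hφ hint (ℓ k) hp
    have h2 : 0 ≤ weightedNormSq φ n (fun z => p.eval z) :=
      integral_nonneg fun z => by positivity
    have h3 : 0 < weightedNormSq φ n (fun z => p.eval z) := by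
      refine h2.lt_of_ne fun h4 => h0 ?_
      rw [← h4, mul_zero] at h1
      exact norm_eq_zero.1 (pow_eq_zero_iff two_ne_zero |>.1 (le_antisymm h1 (by positivity)))
    exact le_of_mul_le_mul_right (h.trans h1) h3
  refine ⟨fun k hk => abs_le.2 ⟨by linarith [hlow' k hk], ?_⟩, ?_⟩
  · have := hP.sum_norm_sq_le hφ hint (ℓ k) (C := 1 + δ) (by linarith) fun p hp => by
      have := hup p hp
      interval_cases k <;> nlinarith [sq_nonneg ‖ℓ 0 p‖, sq_nonneg ‖ℓ 1 p‖]
    linarith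
  · set s := ∑ j, ℓ 1 (P j) * conj (ℓ 0 (P j)) with hs
    -- Turn the off-diagonal entry positive by a phase, and test on the sum of the functionals.
    obtain ⟨u, hu, hus⟩ := Complex.exists_norm_mul_eq_self s
    have hu2 : conj u * u = 1 := by
      rw [mul_comm, Complex.mul_conj, Complex.normSq_eq_norm_sq, hu]; norm_num
    have h1 := hP.sum_norm_sq_le hφ hint (ℓ 0 + conj u • ℓ 1) (C := 2 * (1 + δ)) (by linarith)
      fun p hp => by
        have h2 := hup p hp
        have h3 : ‖(ℓ 0 + conj u • ℓ 1) p‖ ≤ ‖ℓ 0 p‖ + ‖ℓ 1 p‖ := by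
          refine (norm_add_le _ _).trans ?_
          simp [hu]
        have h4 : ‖(ℓ 0 + conj u • ℓ 1) p‖ ^ 2 ≤ (‖ℓ 0 p‖ + ‖ℓ 1 p‖) ^ 2 := by gcongr
        nlinarith [sq_nonneg (‖ℓ 0 p‖ - ‖ℓ 1 p‖)]
    have h2 : ∑ j, ‖(ℓ 0 + conj u • ℓ 1) (P j)‖ ^ 2
        = ∑ j, ‖ℓ 0 (P j)‖ ^ 2 + ∑ j, ‖ℓ 1 (P j)‖ ^ 2 + 2 * (conj u * s).re := by
      rw [hs, Finset.mul_sum, Complex.re_sum, Finset.mul_sum, ← Finset.sum_add_distrib,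
        ← Finset.sum_add_distrib]
      refine Finset.sum_congr rfl fun j _ => ?_
      have h5 : (ℓ 0 + conj u • ℓ 1) (P j) = ℓ 0 (P j) + conj u * ℓ 1 (P j) := rfl
      rw [h5, norm_sq_add_eq, norm_mul, RCLike.norm_conj, hu, one_mul, mul_assoc]
    have h3 : conj u * s = (‖s‖ : ℂ) := by
      conv_lhs => rw [← hus]
      rw [← mul_assoc, hu2, one_mul]
    rw [h2, h3, Complex.ofReal_re] at h1
    linarith [hlow' 0 zero_le_one, hlow' 1 le_rfl]

/-- The conjugate polynomials `z ↦ conj (P j (conj z))` are again an orthonormal basis when the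
weight is symmetric in the real axis. -/
theorem IsWeightedOrthonormalBasis.map_conj {φ : ℂ → ℝ} (hφ : ∀ z, φ (conj z) = φ z) {n : ℕ}
    {P : Fin (n + 1) → ℂ[X]} (hP : IsWeightedOrthonormalBasis φ n P) :
    IsWeightedOrthonormalBasis φ n fun j => (P j).map (starRingEnd ℂ) := by
  refine ⟨fun j => Polynomial.natDegree_map_le.trans (hP.natDegree_le j), fun i j => ?_⟩
  have hev : ∀ (p : ℂ[X]) z, (p.map (starRingEnd ℂ)).eval z = conj (p.eval (conj z)) := fun p z => by
    have := Polynomial.hom_eval₂ p (RingHom.id ℂ) (starRingEnd ℂ) (conj z)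
    rw [Polynomial.eval_map, Polynomial.eval, this, Complex.conj_conj, RingHom.comp_id]
  have hmp : MeasurePreserving (fun z : ℂ => conj z) :=
    Complex.conjLIE.measurePreserving
  have h1 := hmp.integral_comp Complex.conjLIE.toHomeomorph.measurableEmbedding
    (fun z => conj ((P i).eval z) * (P j).eval z * (Real.exp (-2 * n * φ z) : ℂ))
  have h2 : weightedInner φ n ((P i).map (starRingEnd ℂ)) ((P j).map (starRingEnd ℂ))
      = weightedInner φ n (P j) (P i) := by
    rw [weightedInner, weightedInner]
    simp only [hev, Complex.conj_conj]
    simp only [hφ] at h1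
    rw [h1]
    refine integral_congr_ae (ae_of_all _ fun z => ?_)
    simp only
    ring
  rw [h2, hP.orthonormal]
  simp only [eq_comm]

/-- For a weight symmetric in the real axis, the mixed kernel is real on the real diagonal. -/
theorem bergmanKernel10_im {φ : ℂ → ℝ} (hφ : Continuous φ) (hsymm : ∀ z, φ (conj z) = φ z) {n : ℕ}
    (hint : ∀ p : ℂ[X], p.natDegree ≤ n →
      Integrable fun z => ‖p.eval z‖ ^ 2 * Real.exp (-2 * n * φ z))
    {P : Fin (n + 1) → ℂ[X]} (hP : IsWeightedOrthonormalBasis φ n P) (x : ℝ) :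
    (bergmanKernel10 P x x).im = 0 := by
  have hQ := hP.map_conj hsymm
  have hev : ∀ p : ℂ[X], (p.map (starRingEnd ℂ)).eval (x : ℂ) = conj (p.eval (x : ℂ)) := fun p => by
    have := Polynomial.hom_eval₂ p (RingHom.id ℂ) (starRingEnd ℂ) (x : ℂ)
    rw [Polynomial.eval_map, Polynomial.eval, this, Complex.conj_ofReal, RingHom.comp_id]
  -- The norm of `p ↦ p(x) + c p'(x)` can be computed in `P` and in its conjugate, where `c`
  -- turns into `conj c`. Comparing `c = i` with `c = -i` gives the claim.
  have key : ∀ c : ℂ, ∑ j, ‖(P j).eval (x : ℂ) + c * (P j).derivative.eval (x : ℂ)‖ ^ 2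
      ≤ ∑ j, ‖(P j).eval (x : ℂ) + conj c * (P j).derivative.eval (x : ℂ)‖ ^ 2 := fun c => by
    set ℓ : ℂ[X] →ₗ[ℂ] ℂ := Polynomial.leval (x : ℂ) +
      c • (Polynomial.leval (x : ℂ)).comp Polynomial.derivative with hℓ
    have h1 := hP.sum_norm_sq_le hφ hint ℓ (Finset.sum_nonneg fun j _ => sq_nonneg _)
      fun p hp => hQ.norm_sq_le hφ hint ℓ hp
    have h2 : ∀ p, ℓ p = p.eval (x : ℂ) + c * p.derivative.eval (x : ℂ) := fun p => rfl
    simp only [h2, Polynomial.derivative_map, hev] at h1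
    refine h1.trans (le_of_eq (Finset.sum_congr rfl fun j _ => ?_))
    rw [← RCLike.norm_conj ((P j).eval (x : ℂ) + _)]
    simp
  have hsum : ∀ c : ℂ, ∑ j, ‖(P j).eval (x : ℂ) + c * (P j).derivative.eval (x : ℂ)‖ ^ 2
      = ∑ j, ‖(P j).eval (x : ℂ)‖ ^ 2 + ∑ j, ‖c * (P j).derivative.eval (x : ℂ)‖ ^ 2
        + 2 * (c * bergmanKernel10 P x x).re := fun c => by
    rw [bergmanKernel10, Finset.mul_sum, Complex.re_sum, Finset.mul_sum, ← Finset.sum_add_distrib,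
      ← Finset.sum_add_distrib]
    refine Finset.sum_congr rfl fun j _ => ?_
    rw [norm_sq_add_eq, mul_assoc]
  have h1 := key Complex.I
  have h2 := key (-Complex.I)
  rw [hsum, hsum] at h1 h2
  simp at h1 h2
  linarith

/-! ### Kernels in terms of weighted jets -/

/-- The weighted jet of order `k` at `z` as a functional on polynomials. -/
def jetFunctional (φ : ℂ → ℝ) (n : ℕ) (z : ℂ) (k : ℕ) : ℂ[X] →ₗ[ℂ] ℂ where
  toFun p := jet φ n z k fun w => p.eval w
  map_add' p q := by
    rw [← jet_add k (p.differentiable z) (q.differentiable z)]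
    simp only [Polynomial.eval_add]
  map_smul' c p := by
    simp only [jet, Polynomial.eval_smul, RingHom.id_apply, smul_eq_mul]
    split_ifs
    · ring
    · rw [deriv_const_mul _ (p.differentiable z)]
      ring

theorem jetFunctional_zero (φ : ℂ → ℝ) (n : ℕ) (z : ℂ) (p : ℂ[X]) :
    jetFunctional φ n z 0 p = p.eval z * (Real.exp (-(n * φ z)) : ℂ) := by
  simp [jetFunctional, jet]

theorem jetFunctional_one (φ : ℂ → ℝ) (n : ℕ) (z : ℂ) (p : ℂ[X]) :
    jetFunctional φ n z 1 p = (p.derivative.eval z - 2 * n * wirtingerDeriv φ z * p.eval z) *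
      (Real.exp (-(n * φ z)) : ℂ) := by
  simp [jetFunctional, jet]

theorem conj_wirtingerDeriv (φ : ℂ → ℝ) (z : ℂ) :
    conj (wirtingerDeriv φ z) = wirtingerDerivBar φ z := by
  simp only [wirtingerDeriv, wirtingerDerivBar, map_mul, map_sub, map_div₀, map_one,
    Complex.conj_ofNat, Complex.conj_ofReal, Complex.conj_I]
  ring

theorem ofReal_exp_mul_exp (φ : ℂ → ℝ) (n : ℕ) (z : ℂ) :
    (Real.exp (-2 * n * φ z) : ℂ)
      = (Real.exp (-(n * φ z)) : ℂ) * (Real.exp (-(n * φ z)) : ℂ) := by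
  rw [← Complex.ofReal_mul, ← Real.exp_add]
  congr 2
  ring

theorem bergmanKernel_mul_exp (φ : ℂ → ℝ) {n : ℕ} (P : Fin (n + 1) → ℂ[X]) (z : ℂ) :
    bergmanKernel P z z * (Real.exp (-2 * n * φ z) : ℂ)
      = ∑ j, jetFunctional φ n z 0 (P j) * conj (jetFunctional φ n z 0 (P j)) := by
  rw [bergmanKernel, Finset.sum_mul]
  refine Finset.sum_congr rfl fun j _ => ?_
  rw [ofReal_exp_mul_exp]
  simp only [jetFunctional_zero, map_mul, Complex.conj_ofReal]
  ring

theorem bergmanKernel10_mul_exp (φ : ℂ → ℝ) {n : ℕ} (P : Fin (n + 1) → ℂ[X]) (z : ℂ) :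
    bergmanKernel10 P z z * (Real.exp (-2 * n * φ z) : ℂ)
      = ∑ j, jetFunctional φ n z 1 (P j) * conj (jetFunctional φ n z 0 (P j))
        + 2 * n * wirtingerDeriv φ z *
          ∑ j, jetFunctional φ n z 0 (P j) * conj (jetFunctional φ n z 0 (P j)) := by
  rw [bergmanKernel10, Finset.sum_mul, Finset.mul_sum, ← Finset.sum_add_distrib]
  refine Finset.sum_congr rfl fun j _ => ?_
  rw [ofReal_exp_mul_exp]
  simp only [jetFunctional_zero, jetFunctional_one, map_mul, Complex.conj_ofReal]
  ring

theorem bergmanKernel11_mul_exp (φ : ℂ → ℝ) {n : ℕ} (P : Fin (n + 1) → ℂ[X]) (z : ℂ) :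
    bergmanKernel11 P z z * (Real.exp (-2 * n * φ z) : ℂ)
      = ∑ j, jetFunctional φ n z 1 (P j) * conj (jetFunctional φ n z 1 (P j))
        + 2 * n * (wirtingerDeriv φ z *
            conj (∑ j, jetFunctional φ n z 1 (P j) * conj (jetFunctional φ n z 0 (P j)))
          + wirtingerDerivBar φ z *
            ∑ j, jetFunctional φ n z 1 (P j) * conj (jetFunctional φ n z 0 (P j)))
        + 4 * n ^ 2 * (wirtingerDeriv φ z * wirtingerDerivBar φ z) *
          ∑ j, jetFunctional φ n z 0 (P j) * conj (jetFunctional φ n z 0 (P j)) := by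
  rw [bergmanKernel11, Finset.sum_mul, map_sum, Finset.mul_sum, Finset.mul_sum,
    ← Finset.sum_add_distrib, Finset.mul_sum, ← Finset.sum_add_distrib, Finset.mul_sum,
    ← Finset.sum_add_distrib]
  refine Finset.sum_congr rfl fun j _ => ?_
  rw [ofReal_exp_mul_exp]
  simp only [jetFunctional_zero, jetFunctional_one, map_mul, map_sub, Complex.conj_ofReal,
    Complex.conj_conj, conj_wirtingerDeriv, map_natCast, Complex.conj_ofNat]
  ring

/-- Uniform asymptotics of the Gram matrix of the weighted jets: with `t = n Δφ / 2`, its entries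
are `t / π`, `0` and `t ^ 2 / π` to leading order. -/
theorem exists_gram_asymptotics {φ : ℂ → ℝ} (hφ : ContDiff ℝ 2 φ) (hg : HasLogGrowth φ)
    {K : Set ℂ} (hK : IsCompact K) (hKb : K ⊆ bulk φ) {δ : ℝ} (hδ : 0 < δ) (hδ1 : δ ≤ 1) :
    ∃ N : ℕ, 1 ≤ N ∧ ∀ n ≥ N, ∀ P : Fin (n + 1) → ℂ[X], IsWeightedOrthonormalBasis φ n P →
      ∀ z ∈ K, ∃ s₀ s₁ : ℝ, ∃ s : ℂ, |s₀ - 1| ≤ δ ∧ |s₁ - 1| ≤ δ ∧ ‖s‖ ≤ 2 * δ ∧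
        ∑ j, jetFunctional φ n z 0 (P j) * conj (jetFunctional φ n z 0 (P j))
          = ((s₀ * (Laplacian.laplacian φ z / 2 * n / Real.pi) : ℝ) : ℂ) ∧
        ∑ j, jetFunctional φ n z 1 (P j) * conj (jetFunctional φ n z 0 (P j))
          = s * ((Laplacian.laplacian φ z / 2 * n * √(Laplacian.laplacian φ z / 2 * n) /
              Real.pi : ℝ) : ℂ) ∧
        ∑ j, jetFunctional φ n z 1 (P j) * conj (jetFunctional φ n z 1 (P j))
          = ((s₁ * ((Laplacian.laplacian φ z / 2 * n) ^ 2 / Real.pi) : ℝ) : ℂ) := by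
  have hpos : ∀ z ∈ K, 0 < Laplacian.laplacian φ z := fun z hz => (interior_subset (hKb hz)).2
  obtain ⟨N₁, hint⟩ := exists_integrable_weighted hφ.continuous hg
  obtain ⟨N₂, hlow⟩ := exists_jet_lower hφ hg hK hKb hδ hδ1
  obtain ⟨r, -, -, N₃, hN₃, hup⟩ := exists_jet_upper hφ hK hpos hδ one_pos
  refine ⟨max N₁ (max N₂ N₃), hN₃.trans ((le_max_right _ _).trans (le_max_right _ _)),
    fun n hn P hP z hz => ?_⟩
  have hint' := hint n ((le_max_left _ _).trans hn)
  have hlow' := hlow n (((le_max_left _ _).trans (le_max_right _ _)).trans hn) z hz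
  have hn3 := ((le_max_right _ _).trans (le_max_right _ _)).trans hn
  have hup' := hup n hn3 z hz
  have hn0 : (0 : ℝ) < n := by exact_mod_cast hN₃.trans hn3
  set t := Laplacian.laplacian φ z / 2 * n with ht
  have ht0 : 0 < t := mul_pos (half_pos (hpos z hz)) hn0
  have hpi := Real.pi_pos
  set ℓ : ℕ → ℂ[X] →ₗ[ℂ] ℂ := fun k =>
    (√(Real.pi / t ^ (k + 1)) : ℂ) • jetFunctional φ n z k with hℓ
  have hℓn : ∀ k p, ‖ℓ k p‖ ^ 2
      = ‖jet φ n z k fun w => p.eval w‖ ^ 2 * (Real.pi / t ^ (k + 1)) := fun k p => by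
    have : ℓ k p = (√(Real.pi / t ^ (k + 1)) : ℂ) * jet φ n z k fun w => p.eval w := rfl
    rw [this, norm_mul, Complex.norm_real, Real.norm_of_nonneg (Real.sqrt_nonneg _), mul_pow,
      Real.sq_sqrt (by positivity), mul_comm]
  have hgram := hP.gram_bounds hφ.continuous hint' ℓ hδ.le (fun p hp => ?_) fun k hk => ?_
  · obtain ⟨hd, ho⟩ := hgram
    have hdiag : ∀ k, ∑ j, jetFunctional φ n z k (P j) * conj (jetFunctional φ n z k (P j))
        = (((∑ j, ‖ℓ k (P j)‖ ^ 2) * (t ^ (k + 1) / Real.pi) : ℝ) : ℂ) := fun k => by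
      rw [Finset.sum_mul, Complex.ofReal_sum]
      refine Finset.sum_congr rfl fun j _ => ?_
      rw [Complex.mul_conj, Complex.normSq_eq_norm_sq, hℓn]
      congr 1
      have : jetFunctional φ n z k (P j) = jet φ n z k fun w => (P j).eval w := rfl
      rw [this]
      field_simp
    refine ⟨_, _, _, hd 0 zero_le_one, hd 1 le_rfl, ho, ?_, ?_, ?_⟩
    · rw [hdiag 0, zero_add, pow_one]
    · rw [Finset.sum_mul]
      refine Finset.sum_congr rfl fun j _ => ?_
      simp only [hℓ, LinearMap.smul_apply, smul_eq_mul, map_mul, Complex.conj_ofReal]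
      have h1 : √(Real.pi / t ^ (1 + 1)) * √(Real.pi / t ^ (0 + 1)) * (t * √t / Real.pi) = 1 := by
        have h2 : √t ^ 2 = t := Real.sq_sqrt ht0.le
        have h3 : √Real.pi ^ 2 = Real.pi := Real.sq_sqrt hpi.le
        have h4 : 0 < √t := Real.sqrt_pos.2 ht0
        rw [Real.sqrt_div hpi.le, Real.sqrt_div hpi.le, Real.sqrt_sq ht0.le, zero_add, pow_one]
        field_simp
        exact h3
      have h5 : ((√(Real.pi / t ^ (1 + 1)) * √(Real.pi / t ^ (0 + 1)) * (t * √t / Real.pi) : ℝ)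
          : ℂ) = 1 := by rw [h1, Complex.ofReal_one]
      rw [Complex.ofReal_mul, Complex.ofReal_mul] at h5
      calc _ = jetFunctional φ n z 1 (P j) * conj (jetFunctional φ n z 0 (P j)) * 1 := by ring
        _ = _ := by rw [← h5]; ring
    · rw [hdiag 1]
  · have h1 := hup' (fun w => p.eval w) p.differentiable
    simp only [hℓn, zero_add, pow_one]
    refine h1.trans (mul_le_mul_of_nonneg_left ?_ (by linarith))
    exact setIntegral_le_integral (hint' p hp) (ae_of_all _ fun w => by positivity)
  · obtain ⟨p, hpd, hp0, hp⟩ := hlow' k hk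
    refine ⟨p, hpd, fun h0 => hp0 ?_, by rw [hℓn]; exact hp⟩
    have h1 := hℓn k p
    rw [h0, norm_zero, zero_pow two_ne_zero, eq_comm, mul_eq_zero] at h1
    rcases h1 with h1 | h1
    · simpa using h1
    · exact absurd h1 (by positivity)

/-! ### Error estimates -/

theorem mul_sqrt_div_sq {c x : ℝ} (hx : 0 < x) (hc : 0 ≤ c) :
    c * x * √(c * x) / Real.pi = c * √c / (Real.pi * √x) * x ^ 2 := by
  have h1 : √x ^ 2 = x := Real.sq_sqrt hx.le
  have h2 : 0 < √x := Real.sqrt_pos.2 hx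
  rw [Real.sqrt_mul hc]
  field_simp
  rw [h1]
  ring

theorem mul_sqrt_div_le {c x M : ℝ} (hx : 1 ≤ x) (hc : 0 ≤ c) (hM : 1 ≤ M) (hcM : c ≤ M) :
    |c * √c / (Real.pi * √x)| ≤ M ^ 2 := by
  have h1 : 1 ≤ √x := Real.one_le_sqrt.2 hx
  have h2 : √c ≤ M := by
    rw [Real.sqrt_le_left (by linarith)]
    nlinarith
  have h3 : 1 ≤ Real.pi := by linarith [Real.pi_gt_three]
  rw [abs_of_nonneg (by positivity)]
  calc c * √c / (Real.pi * √x) ≤ c * √c := div_le_self (by positivity) (by nlinarith)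
    _ ≤ M * M := by gcongr
    _ = M ^ 2 := by ring

theorem norm_sub_one_mul_le {s₀ c M δ : ℝ} (hs : |s₀ - 1| ≤ δ) (hc : 0 ≤ c) (hcM : c ≤ M) :
    ‖(((s₀ - 1) * (c / Real.pi) : ℝ) : ℂ)‖ ≤ δ * M := by
  have h3 : 1 ≤ Real.pi := by linarith [Real.pi_gt_three]
  rw [Complex.norm_real, Real.norm_eq_abs, abs_mul, abs_of_nonneg (show 0 ≤ c / Real.pi by positivity)]
  gcongr
  · exact (abs_nonneg _).trans hs
  · exact (div_le_self hc h3).trans hcM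

/-- The error in the limit of `n⁻² K₁₀ e^{-2nφ}`, with `x = n`, `c = Δφ / 2` and `w = ∂φ/∂z`. -/
theorem dist_kernel10_le {c M D δ s₀ x : ℝ} {s w : ℂ} (hx : 1 ≤ x) (hc : 0 ≤ c) (hM : 1 ≤ M)
    (hcM : c ≤ M) (hD : 1 ≤ D) (hw : ‖w‖ ≤ D) (hs₀ : |s₀ - 1| ≤ δ) (hs : ‖s‖ ≤ 2 * δ) :
    ‖(1 / Real.pi : ℂ) * (2 * c : ℝ) * w -
      (s * ((c * x * √(c * x) / Real.pi : ℝ) : ℂ)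
        + 2 * x * w * ((s₀ * (c * x / Real.pi) : ℝ) : ℂ)) / (x : ℂ) ^ 2‖ ≤ δ * (14 * (M * D) ^ 2) := by
  have hx0 : 0 < x := by linarith
  have hδ : 0 ≤ δ := (abs_nonneg _).trans hs₀
  have hxC : (x : ℂ) ≠ 0 := by exact_mod_cast hx0.ne'
  have hpC : (Real.pi : ℂ) ≠ 0 := by exact_mod_cast Real.pi_ne_zero
  set A := c * √c / (Real.pi * √x) with hA
  have hAM : |A| ≤ M ^ 2 := mul_sqrt_div_le hx hc hM hcM
  have e : (1 / Real.pi : ℂ) * (2 * c : ℝ) * w -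
      (s * ((c * x * √(c * x) / Real.pi : ℝ) : ℂ)
        + 2 * x * w * ((s₀ * (c * x / Real.pi) : ℝ) : ℂ)) / (x : ℂ) ^ 2
      = -(s * (A : ℝ) + 2 * w * (((s₀ - 1) * (c / Real.pi) : ℝ) : ℂ)) := by
    rw [mul_sqrt_div_sq hx0 hc, ← hA]
    push_cast
    field_simp
    ring
  rw [e, norm_neg]
  have h1 : ‖s * (A : ℂ)‖ ≤ 2 * δ * M ^ 2 := by
    rw [norm_mul, Complex.norm_real, Real.norm_eq_abs]
    gcongr
  have h2 : ‖2 * w * (((s₀ - 1) * (c / Real.pi) : ℝ) : ℂ)‖ ≤ 2 * D * (δ * M) := by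
    rw [norm_mul, norm_mul, Complex.norm_ofNat]
    gcongr
    exact norm_sub_one_mul_le hs₀ hc hcM
  have hMD1 : M ^ 2 ≤ (M * D) ^ 2 := by
    gcongr; nlinarith
  have hMD2 : D * M ≤ (M * D) ^ 2 := by
    have : 1 ≤ M * D := by nlinarith
    nlinarith
  refine (norm_add_le _ _).trans ((add_le_add h1 h2).trans ?_)
  have h3 := mul_le_mul_of_nonneg_left hMD1 hδ
  have h4 := mul_le_mul_of_nonneg_left hMD2 hδ
  have h5 : 0 ≤ δ * (M * D) ^ 2 := by positivity
  linarith

/-- The error in the limit of `n⁻³ K₁₁ e^{-2nφ}`, with `x = n`, `c = Δφ / 2` and `w = ∂φ/∂z`. -/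
theorem dist_kernel11_le {c M D δ s₀ s₁ x : ℝ} {s w : ℂ} (hx : 1 ≤ x) (hc : 0 ≤ c) (hM : 1 ≤ M)
    (hcM : c ≤ M) (hD : 1 ≤ D) (hw : ‖w‖ ≤ D) (hδ1 : δ ≤ 1) (hs₀ : |s₀ - 1| ≤ δ)
    (hs₁ : |s₁ - 1| ≤ δ) (hs : ‖s‖ ≤ 2 * δ) (hxδ : 1 / x ≤ δ) :
    ‖(1 / Real.pi : ℂ) * (2 * c : ℝ) * (2 * w * conj w) -
      (((s₁ * ((c * x) ^ 2 / Real.pi) : ℝ) : ℂ)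
        + 2 * x * (w * conj (s * ((c * x * √(c * x) / Real.pi : ℝ) : ℂ))
          + conj w * (s * ((c * x * √(c * x) / Real.pi : ℝ) : ℂ)))
        + 4 * x ^ 2 * (w * conj w) * ((s₀ * (c * x / Real.pi) : ℝ) : ℂ)) / (x : ℂ) ^ 3‖
      ≤ δ * (14 * (M * D) ^ 2) := by
  have hx0 : 0 < x := by linarith
  have hδ : 0 ≤ δ := (abs_nonneg _).trans hs₀
  have hxC : (x : ℂ) ≠ 0 := by exact_mod_cast hx0.ne'
  have hpC : (Real.pi : ℂ) ≠ 0 := by exact_mod_cast Real.pi_ne_zero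
  have hpi : 1 ≤ Real.pi := by linarith [Real.pi_gt_three]
  set A := c * √c / (Real.pi * √x) with hA
  have hAM : |A| ≤ M ^ 2 := mul_sqrt_div_le hx hc hM hcM
  have e : (1 / Real.pi : ℂ) * (2 * c : ℝ) * (2 * w * conj w) -
      (((s₁ * ((c * x) ^ 2 / Real.pi) : ℝ) : ℂ)
        + 2 * x * (w * conj (s * ((c * x * √(c * x) / Real.pi : ℝ) : ℂ))
          + conj w * (s * ((c * x * √(c * x) / Real.pi : ℝ) : ℂ)))
        + 4 * x ^ 2 * (w * conj w) * ((s₀ * (c * x / Real.pi) : ℝ) : ℂ)) / (x : ℂ) ^ 3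
      = -(((s₁ * (c ^ 2 / Real.pi) * (1 / x) : ℝ) : ℂ)
        + 2 * (w * conj s + conj w * s) * (A : ℝ)
        + 4 * (w * conj w) * (((s₀ - 1) * (c / Real.pi) : ℝ) : ℂ)) := by
    rw [mul_sqrt_div_sq hx0 hc, ← hA, map_mul, Complex.conj_ofReal]
    push_cast
    field_simp
    ring
  rw [e, norm_neg]
  have h1 : ‖((s₁ * (c ^ 2 / Real.pi) * (1 / x) : ℝ) : ℂ)‖ ≤ 2 * M ^ 2 * δ := by
    have h3 : |s₁| ≤ 2 := by
      have := abs_le.1 hs₁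
      exact abs_le.2 ⟨by linarith, by linarith⟩
    have h4 : c ^ 2 / Real.pi ≤ M ^ 2 :=
      (div_le_self (by positivity) hpi).trans (by gcongr)
    rw [Complex.norm_real, Real.norm_eq_abs, abs_mul, abs_mul,
      abs_of_nonneg (show 0 ≤ c ^ 2 / Real.pi by positivity),
      abs_of_nonneg (show 0 ≤ 1 / x by positivity)]
    gcongr
  have h2 : ‖2 * (w * conj s + conj w * s) * (A : ℂ)‖ ≤ 2 * (D * (2 * δ) + D * (2 * δ)) * M ^ 2 := by
    rw [norm_mul, norm_mul, Complex.norm_real, Real.norm_eq_abs, Complex.norm_ofNat]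
    gcongr
    refine (norm_add_le _ _).trans ?_
    rw [norm_mul, norm_mul, RCLike.norm_conj, RCLike.norm_conj]
    gcongr
  have h3 : ‖4 * (w * conj w) * (((s₀ - 1) * (c / Real.pi) : ℝ) : ℂ)‖
      ≤ 4 * (D * D) * (δ * M) := by
    rw [norm_mul, norm_mul, norm_mul, RCLike.norm_conj, Complex.norm_ofNat]
    gcongr
    exact norm_sub_one_mul_le hs₀ hc hcM
  have hMD1 : M ^ 2 ≤ (M * D) ^ 2 := by
    gcongr; nlinarith
  have hMD2 : D * M ^ 2 ≤ (M * D) ^ 2 := by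
    have : D ≤ D ^ 2 := by nlinarith
    rw [mul_pow, mul_comm]
    gcongr
  have hMD3 : D * D * M ≤ (M * D) ^ 2 := by
    have : M ≤ M ^ 2 := by nlinarith
    calc D * D * M ≤ D * D * M ^ 2 := by gcongr
      _ = _ := by ring
  refine (norm_add₃_le).trans ((add_le_add_three h1 h2 h3).trans ?_)
  have h5 := mul_le_mul_of_nonneg_left hMD1 hδ
  have h6 := mul_le_mul_of_nonneg_left hMD2 hδ
  have h7 := mul_le_mul_of_nonneg_left hMD3 hδ
  linarith

theorem abs_sqrt_sub_sqrt_le (a b : ℝ) : |√a - √b| ≤ √|a - b| := by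
  wlog h : b ≤ a generalizing a b
  · rw [abs_sub_comm, abs_sub_comm a]
    exact this b a (le_of_not_ge h)
  rw [abs_of_nonneg (sub_nonneg.2 (Real.sqrt_le_sqrt h)), abs_of_nonneg (sub_nonneg.2 h),
    sub_le_iff_le_add]
  refine Real.sqrt_le_iff.2 ⟨by positivity, ?_⟩
  have h1 : b ≤ √b ^ 2 := by
    rcases le_total 0 b with h0 | h0
    · rw [Real.sq_sqrt h0]
    · exact h0.trans (sq_nonneg _)
  have h2 : √(a - b) ^ 2 = a - b := Real.sq_sqrt (sub_nonneg.2 h)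
  nlinarith [mul_nonneg (Real.sqrt_nonneg (a - b)) (Real.sqrt_nonneg b)]

/-- The ratio in the third limit, in terms of the normalized Gram matrix. -/
theorem sqrt_gram_ratio {c x s₀ Q E k k₁₀ k₁₁ : ℝ} (hc : 0 < c) (hx : 0 < x) (hs₀ : 0 < s₀)
    (hE : 0 < E) (hk : k * E = s₀ * (c * x / Real.pi))
    (hdet : (k₁₁ * k - k₁₀ ^ 2) * E ^ 2 = Q * (c * x) ^ 3 / Real.pi ^ 2) :
    1 / √x * (√(k₁₁ * k - k₁₀ ^ 2) / k) = √(Q * c / s₀ ^ 2) := by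
  have hpi := Real.pi_pos
  have hk' : k = s₀ * (c * x / (Real.pi * E)) := by
    field_simp at hk ⊢
    linarith
  have hx2 : 0 < √x := Real.sqrt_pos.2 hx
  have h1 : k₁₁ * k - k₁₀ ^ 2 = (c * x / (Real.pi * E)) ^ 2 * (Q * c * x) := by
    have : k₁₁ * k - k₁₀ ^ 2 = (k₁₁ * k - k₁₀ ^ 2) * E ^ 2 / E ^ 2 := by field_simp
    rw [this, hdet]
    field_simp
  rw [h1, Real.sqrt_mul (by positivity), Real.sqrt_sq (by positivity), Real.sqrt_mul' _ hx.le, hk',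
    Real.sqrt_div' _ (by positivity), Real.sqrt_sq hs₀.le]
  field_simp

theorem abs_gram_ratio_sub_le {c M δ s₀ s₁ σ : ℝ} (hc : 0 ≤ c) (hcM : c ≤ M) (hδ : δ ≤ 1 / 2)
    (hs₀ : |s₀ - 1| ≤ δ) (hs₁ : |s₁ - 1| ≤ δ) (hσ0 : 0 ≤ σ) (hσ : σ ≤ 2 * δ) :
    |c - (s₁ * s₀ - σ ^ 2) * c / s₀ ^ 2| ≤ 20 * M * δ := by
  have hδ0 : 0 ≤ δ := (abs_nonneg _).trans hs₀
  have h0 := abs_le.1 hs₀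
  have h1 := abs_le.1 hs₁
  have hpos : 0 < s₀ := by linarith
  have e : c - (s₁ * s₀ - σ ^ 2) * c / s₀ ^ 2 = c * ((s₀ * (s₀ - s₁) + σ ^ 2) / s₀ ^ 2) := by
    field_simp
    ring
  have h2 : |(s₀ * (s₀ - s₁) + σ ^ 2) / s₀ ^ 2| ≤ 20 * δ := by
    rw [abs_div, abs_of_pos (show 0 < s₀ ^ 2 by positivity), div_le_iff₀ (by positivity)]
    have h3 : |s₀ * (s₀ - s₁)| ≤ 3 / 2 * (2 * δ) := by
      rw [abs_mul, abs_of_pos hpos]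
      gcongr
      · linarith
      · exact abs_le.2 ⟨by linarith, by linarith⟩
    have h4 : |σ ^ 2| ≤ 2 * δ := by
      rw [abs_of_nonneg (by positivity)]
      nlinarith
    have h5 : 1 / 4 ≤ s₀ ^ 2 := by nlinarith
    have h6 := mul_le_mul_of_nonneg_left h5 hδ0
    linarith [abs_add_le (s₀ * (s₀ - s₁)) (σ ^ 2)]
  have hM : 0 ≤ M := hc.trans hcM
  rw [e, abs_mul, abs_of_nonneg hc]
  calc c * |(s₀ * (s₀ - s₁) + σ ^ 2) / s₀ ^ 2| ≤ M * (20 * δ) := by gcongr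
    _ = _ := by ring

/-! ### Uniform limits -/

theorem tendstoUniformlyOn_kernels {φ : ℂ → ℝ} (hφ : ContDiff ℝ 2 φ) (hg : HasLogGrowth φ)
    {P : (n : ℕ) → Fin (n + 1) → ℂ[X]} (hP : ∀ᶠ n : ℕ in atTop, IsWeightedOrthonormalBasis φ n (P n))
    {K : Set ℂ} (hK : IsCompact K) (hKb : K ⊆ bulk φ) :
    TendstoUniformlyOn
      (fun (n : ℕ) (z : ℂ) =>
        bergmanKernel10 (P n) z z * (Real.exp (-2 * n * φ z) : ℂ) / (n : ℂ) ^ 2)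
      (fun z => (1 / Real.pi : ℂ) * (Laplacian.laplacian φ z : ℂ) * wirtingerDeriv φ z)
      atTop K ∧
    TendstoUniformlyOn
      (fun (n : ℕ) (z : ℂ) =>
        bergmanKernel11 (P n) z z * (Real.exp (-2 * n * φ z) : ℂ) / (n : ℂ) ^ 3)
      (fun z => (1 / Real.pi : ℂ) * (Laplacian.laplacian φ z : ℂ) *
        (2 * wirtingerDeriv φ z * wirtingerDerivBar φ z))
      atTop K := by
  have hpos : ∀ z ∈ K, 0 < Laplacian.laplacian φ z := fun z hz => (interior_subset (hKb hz)).2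
  obtain ⟨m, hm, M₀, hM₀, hb⟩ := exists_laplacian_bounds hφ hK hpos
  obtain ⟨D₀, hD₀⟩ := hK.exists_bound_of_continuousOn (continuous_wirtingerDeriv hφ).continuousOn
  set M := max M₀ 1
  set D := max D₀ 1
  have hM : 1 ≤ M := le_max_right _ _
  have hD : 1 ≤ D := le_max_right _ _
  -- One choice of `δ` makes both errors smaller than a given `ε`.
  have key : ∀ ε > 0, ∀ᶠ n : ℕ in atTop, ∀ z ∈ K,
      dist ((1 / Real.pi : ℂ) * (Laplacian.laplacian φ z : ℂ) * wirtingerDeriv φ z)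
        (bergmanKernel10 (P n) z z * (Real.exp (-2 * n * φ z) : ℂ) / (n : ℂ) ^ 2) < ε ∧
      dist ((1 / Real.pi : ℂ) * (Laplacian.laplacian φ z : ℂ) *
          (2 * wirtingerDeriv φ z * wirtingerDerivBar φ z))
        (bergmanKernel11 (P n) z z * (Real.exp (-2 * n * φ z) : ℂ) / (n : ℂ) ^ 3) < ε := by
    intro ε hε
    have hB : 0 < 14 * (M * D) ^ 2 := by positivity
    set δ := min 1 (ε / (2 * (14 * (M * D) ^ 2))) with hδ
    have hδ0 : 0 < δ := by positivity
    have hδ1 : δ ≤ 1 := min_le_left _ _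
    have hδε : δ * (14 * (M * D) ^ 2) < ε := by
      have h1 : δ * (2 * (14 * (M * D) ^ 2)) ≤ ε := by
        rw [← le_div_iff₀ (by positivity)]
        exact min_le_right _ _
      have h2 := mul_pos hδ0 hB
      linarith
    obtain ⟨N, hN1, hN⟩ := exists_gram_asymptotics hφ hg hK hKb hδ0 hδ1
    filter_upwards [hP, eventually_ge_atTop N,
      tendsto_natCast_atTop_atTop.eventually_ge_atTop (1 / δ)] with n hPn hn hnδ z hz
    obtain ⟨s₀, s₁, s, h0, h1, hs, e0, es, e1⟩ := hN n hn (P n) hPn z hz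
    have hnR : (1 : ℝ) ≤ n := by exact_mod_cast hN1.trans hn
    have hxδ : 1 / (n : ℝ) ≤ δ := by
      rw [div_le_iff₀ (by linarith), mul_comm]
      rwa [div_le_iff₀ hδ0] at hnδ
    obtain ⟨hmc, hcM⟩ := hb z hz
    have hc0 : 0 ≤ Laplacian.laplacian φ z / 2 := (hm.trans_le hmc).le
    have hcM' := hcM.trans (le_max_left M₀ 1)
    have hw := (hD₀ z hz).trans (le_max_left D₀ 1)
    have h2c : (Laplacian.laplacian φ z : ℂ) = ((2 * (Laplacian.laplacian φ z / 2) : ℝ) : ℂ) := by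
      congr 1; ring
    constructor
    · rw [dist_eq_norm, bergmanKernel10_mul_exp, e0, es, h2c]
      have := dist_kernel10_le (x := n) hnR hc0 hM hcM' hD hw h0 hs
      exact lt_of_le_of_lt (by simpa only [Complex.ofReal_natCast] using this) hδε
    · rw [dist_eq_norm, bergmanKernel11_mul_exp, e0, es, e1, h2c, ← conj_wirtingerDeriv]
      have := dist_kernel11_le (x := n) hnR hc0 hM hcM' hD hw hδ1 h0 h1 hs hxδ
      exact lt_of_le_of_lt (by simpa only [Complex.ofReal_natCast] using this) hδε
  exact ⟨Metric.tendstoUniformlyOn_iff.2 fun ε hε =>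
      (key ε hε).mono fun n hn z hz => (hn z hz).1,
    Metric.tendstoUniformlyOn_iff.2 fun ε hε => (key ε hε).mono fun n hn z hz => (hn z hz).2⟩

theorem bergmanKernel_im {n : ℕ} (P : Fin (n + 1) → ℂ[X]) (z : ℂ) :
    (bergmanKernel P z z).im = 0 := by
  simp [bergmanKernel, Complex.mul_conj]

theorem bergmanKernel11_im {n : ℕ} (P : Fin (n + 1) → ℂ[X]) (z : ℂ) :
    (bergmanKernel11 P z z).im = 0 := by
  simp [bergmanKernel11, Complex.mul_conj]

/-- The determinant `K K₁₁ - |K₁₀|²` is the Gram determinant of the weighted jets: the passage from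
derivatives to jets is unimodular. -/
theorem kernel_det_eq {φ : ℂ → ℝ} {n : ℕ} {P : Fin (n + 1) → ℂ[X]} {z : ℂ} {s₀ s₁ c : ℝ} {s : ℂ}
    (hc : 0 ≤ c)
    (e0 : ∑ j, jetFunctional φ n z 0 (P j) * conj (jetFunctional φ n z 0 (P j))
      = ((s₀ * (c * n / Real.pi) : ℝ) : ℂ))
    (es : ∑ j, jetFunctional φ n z 1 (P j) * conj (jetFunctional φ n z 0 (P j))
      = s * ((c * n * √(c * n) / Real.pi : ℝ) : ℂ))
    (e1 : ∑ j, jetFunctional φ n z 1 (P j) * conj (jetFunctional φ n z 1 (P j))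
      = ((s₁ * ((c * n) ^ 2 / Real.pi) : ℝ) : ℂ))
    (h10 : (bergmanKernel10 P z z).im = 0) :
    ((bergmanKernel11 P z z).re * (bergmanKernel P z z).re - (bergmanKernel10 P z z).re ^ 2) *
      Real.exp (-2 * n * φ z) ^ 2 = (s₁ * s₀ - ‖s‖ ^ 2) * (c * n) ^ 3 / Real.pi ^ 2 := by
  have k0 : ((bergmanKernel P z z).re : ℂ) = bergmanKernel P z z :=
    Complex.ext (by simp) (by simp [bergmanKernel_im])
  have k1 : ((bergmanKernel11 P z z).re : ℂ) = bergmanKernel11 P z z :=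
    Complex.ext (by simp) (by simp [bergmanKernel11_im])
  have k10 : ((bergmanKernel10 P z z).re : ℂ) = bergmanKernel10 P z z :=
    Complex.ext (by simp) (by simp [h10])
  have k10c : conj (bergmanKernel10 P z z) = bergmanKernel10 P z z := by
    rw [← k10, Complex.conj_ofReal]
  have hE := bergmanKernel_mul_exp φ P z
  have hE10 := bergmanKernel10_mul_exp φ P z
  have hE11 := bergmanKernel11_mul_exp φ P z
  have hE10c := congrArg conj hE10
  rw [e0] at hE
  rw [e0, es] at hE10 hE10c
  rw [e0, es, e1] at hE11
  simp only [map_mul, map_add, k10c, Complex.conj_ofReal, conj_wirtingerDeriv, map_natCast,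
    Complex.conj_ofNat] at hE10c hE11
  have hsq : ((√(c * n) : ℝ) : ℂ) ^ 2 = ((c * n : ℝ) : ℂ) := by
    rw [← Complex.ofReal_pow, Real.sq_sqrt (by positivity)]
  have hss : s * conj s = ((‖s‖ ^ 2 : ℝ) : ℂ) := by
    rw [Complex.mul_conj, Complex.normSq_eq_norm_sq]
  have : (((bergmanKernel11 P z z).re * (bergmanKernel P z z).re
      - (bergmanKernel10 P z z).re ^ 2 : ℝ) : ℂ) * (Real.exp (-2 * n * φ z) : ℂ) ^ 2
      = (((s₁ * s₀ - ‖s‖ ^ 2) * (c * n) ^ 3 / Real.pi ^ 2 : ℝ) : ℂ) := by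
    rw [Complex.ofReal_sub, Complex.ofReal_mul, Complex.ofReal_pow, k0, k1, k10]
    calc _ = (bergmanKernel11 P z z * (Real.exp (-2 * n * φ z) : ℂ)) *
          (bergmanKernel P z z * (Real.exp (-2 * n * φ z) : ℂ)) -
          (bergmanKernel10 P z z * (Real.exp (-2 * n * φ z) : ℂ)) *
          (bergmanKernel10 P z z * (Real.exp (-2 * n * φ z) : ℂ)) := by ring
      _ = _ := by
        rw [hE11, hE]
        nth_rewrite 2 [hE10c]
        rw [hE10]
        have e2 : (((s₁ * s₀ - ‖s‖ ^ 2) * (c * n) ^ 3 / Real.pi ^ 2 : ℝ) : ℂ)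
            = (s₁ * s₀ - s * conj s) * ((c * n : ℝ) : ℂ) ^ 2 * ((c * n : ℝ) : ℂ)
              / (Real.pi : ℂ) ^ 2 := by
          rw [hss]; push_cast; ring
        have e3 : ((c * n * √(c * n) / Real.pi : ℝ) : ℂ) ^ 2
            = ((c * n : ℝ) : ℂ) ^ 2 * ((c * n : ℝ) : ℂ) / (Real.pi : ℂ) ^ 2 := by
          rw [Complex.ofReal_div, Complex.ofReal_mul, div_pow, mul_pow, hsq]
        rw [e2]
        generalize ((c * n * √(c * n) / Real.pi : ℝ) : ℂ) = B at e3 ⊢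
        calc _ = s₁ * s₀ * (((c * n : ℝ) : ℂ) ^ 2 * ((c * n : ℝ) : ℂ) / (Real.pi : ℂ) ^ 2)
              - s * conj s * B ^ 2 := by push_cast; ring
          _ = _ := by rw [e3]; ring
  exact_mod_cast this

theorem tendstoUniformlyOn_gram_ratio {φ : ℂ → ℝ} (hφ : ContDiff ℝ 2 φ) (hg : HasLogGrowth φ)
    {P : (n : ℕ) → Fin (n + 1) → ℂ[X]} (hP : ∀ᶠ n : ℕ in atTop, IsWeightedOrthonormalBasis φ n (P n))
    (h10 : ∀ᶠ n : ℕ in atTop, ∀ x : ℝ, (bergmanKernel10 (P n) x x).im = 0)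
    {a b : ℝ} (hab : ∀ x ∈ Set.Icc a b, (x : ℂ) ∈ bulk φ) :
    TendstoUniformlyOn
      (fun (n : ℕ) (x : ℝ) =>
        1 / Real.sqrt n *
          (Real.sqrt ((bergmanKernel11 (P n) x x).re * (bergmanKernel (P n) x x).re -
              (bergmanKernel10 (P n) x x).re ^ 2) /
            (bergmanKernel (P n) x x).re))
      (fun x => Real.sqrt (1 / 2 * Laplacian.laplacian φ (x : ℂ)))
      atTop (Set.Icc a b) := by
  have hK : IsCompact ((fun x : ℝ => (x : ℂ)) '' Set.Icc a b) :=
    isCompact_Icc.image Complex.continuous_ofReal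
  have hKb : (fun x : ℝ => (x : ℂ)) '' Set.Icc a b ⊆ bulk φ := by
    rintro _ ⟨x, hx, rfl⟩
    exact hab x hx
  have hpos : ∀ z ∈ (fun x : ℝ => (x : ℂ)) '' Set.Icc a b, 0 < Laplacian.laplacian φ z :=
    fun z hz => (interior_subset (hKb hz)).2
  obtain ⟨m, hm, M, hM, hb⟩ := exists_laplacian_bounds hφ hK hpos
  refine Metric.tendstoUniformlyOn_iff.2 fun ε hε => ?_
  set δ := min (1 / 2) (ε ^ 2 / (40 * M)) with hδ
  have hδ0 : 0 < δ := by positivity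
  have hδ1 : δ ≤ 1 / 2 := min_le_left _ _
  have hδε : 20 * M * δ < ε ^ 2 := by
    have h1 : δ * (40 * M) ≤ ε ^ 2 := by
      rw [← le_div_iff₀ (by positivity)]
      exact min_le_right _ _
    have h2 := mul_pos hδ0 hM
    linarith
  obtain ⟨N, hN1, hN⟩ := exists_gram_asymptotics hφ hg hK hKb hδ0 (by linarith)
  filter_upwards [hP, h10, eventually_ge_atTop N] with n hPn h10n hn x hx
  have hz := Set.mem_image_of_mem (fun x : ℝ => (x : ℂ)) hx
  obtain ⟨s₀, s₁, s, h0, h1, hs, e0, es, e1⟩ := hN n hn (P n) hPn x hz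
  obtain ⟨hmc, hcM⟩ := hb _ hz
  have hn0 : (0 : ℝ) < n := by exact_mod_cast hN1.trans hn
  have hc0 : 0 < Laplacian.laplacian φ (x : ℂ) / 2 := hm.trans_le hmc
  have hs0 : 0 < s₀ := by linarith [(abs_le.1 h0).1]
  have hdet := kernel_det_eq hc0.le e0 es e1 (h10n x)
  have hk : (bergmanKernel (P n) x x).re * Real.exp (-2 * n * φ x)
      = s₀ * (Laplacian.laplacian φ (x : ℂ) / 2 * n / Real.pi) := by
    have h2 := congrArg Complex.re ((bergmanKernel_mul_exp φ (P n) x).trans e0)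
    rwa [Complex.re_mul_ofReal, Complex.ofReal_re] at h2
  rw [sqrt_gram_ratio hc0 hn0 hs0 (Real.exp_pos _) hk hdet, Real.dist_eq,
    show 1 / 2 * Laplacian.laplacian φ (x : ℂ) = Laplacian.laplacian φ (x : ℂ) / 2 by ring]
  refine (abs_sqrt_sub_sqrt_le _ _).trans_lt ?_
  rw [Real.sqrt_lt' hε]
  exact (abs_gram_ratio_sub_le hc0.le hcM hδ1 h0 h1 (norm_nonneg s) hs).trans_lt hδε

end

theorem theorem2p3 (φ : ℂ → ℝ) (hφ : ContDiff ℝ 2 φ) (hgrowth : HasLogGrowth φ) :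
    -- the spaces of polynomials carry orthonormal bases for all large `n`
    (∀ᶠ n : ℕ in atTop, ∃ Q : Fin (n + 1) → ℂ[X], IsWeightedOrthonormalBasis φ n Q) ∧
    -- whichever orthonormal bases are used to write the kernels
    ∀ P : (n : ℕ) → Fin (n + 1) → ℂ[X],
      (∀ᶠ n : ℕ in atTop, IsWeightedOrthonormalBasis φ n (P n)) →
      (∀ K : Set ℂ, IsCompact K → K ⊆ bulk φ →
        TendstoUniformlyOn
          (fun (n : ℕ) (z : ℂ) =>
            bergmanKernel10 (P n) z z * (Real.exp (-2 * n * φ z) : ℂ) / (n : ℂ) ^ 2)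
          (fun z => (1 / Real.pi : ℂ) * (Laplacian.laplacian φ z : ℂ) * wirtingerDeriv φ z)
          atTop K ∧
        TendstoUniformlyOn
          (fun (n : ℕ) (z : ℂ) =>
            bergmanKernel11 (P n) z z * (Real.exp (-2 * n * φ z) : ℂ) / (n : ℂ) ^ 3)
          (fun z => (1 / Real.pi : ℂ) * (Laplacian.laplacian φ z : ℂ) *
            (2 * wirtingerDeriv φ z * wirtingerDerivBar φ z))
          atTop K) ∧
      ((∀ z : ℂ, φ z = φ (‖z‖ : ℂ)) →
        -- for radial `φ` the kernels are real on the real diagonal, so taking real parts is harmless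
        (∀ᶠ n : ℕ in atTop, ∀ x : ℝ,
          (bergmanKernel (P n) x x).im = 0 ∧ (bergmanKernel10 (P n) x x).im = 0 ∧
            (bergmanKernel11 (P n) x x).im = 0) ∧
        ∀ a b : ℝ, (∀ x ∈ Set.Icc a b, (x : ℂ) ∈ bulk φ) →
          TendstoUniformlyOn
            (fun (n : ℕ) (x : ℝ) =>
              1 / Real.sqrt n *
                (Real.sqrt ((bergmanKernel11 (P n) x x).re * (bergmanKernel (P n) x x).re -
                    (bergmanKernel10 (P n) x x).re ^ 2) /
                  (bergmanKernel (P n) x x).re))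
            (fun x => Real.sqrt (1 / 2 * Laplacian.laplacian φ (x : ℂ)))
            atTop (Set.Icc a b)) := by

  obtain ⟨N, hint⟩ := exists_integrable_weighted hφ.continuous hgrowth
  refine ⟨(eventually_ge_atTop N).mono fun n hn =>
    exists_isWeightedOrthonormalBasis hφ.continuous (hint n hn), fun P hP =>
    ⟨fun K hK hKb => tendstoUniformlyOn_kernels hφ hgrowth hP hK hKb, fun hrad => ?_⟩⟩
  have hsymm : ∀ z, φ (conj z) = φ z := fun z => by
    rw [hrad (conj z), RCLike.norm_conj, ← hrad]
  have h10 : ∀ᶠ n : ℕ in atTop, ∀ x : ℝ, (bergmanKernel10 (P n) x x).im = 0 := by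
    filter_upwards [hP, eventually_ge_atTop N] with n hPn hn x
    exact bergmanKernel10_im hφ.continuous hsymm (hint n hn) hPn x
  exact ⟨h10.mono fun n hn x => ⟨bergmanKernel_im _ _, hn x, bergmanKernel11_im _ _⟩,
    fun a b hab => tendstoUniformlyOn_gram_ratio hφ hgrowth hP h10 hab⟩
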